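/- Fix an infinite set of propositional letters. Formulae are built from letters and a constant $I$ with two binary connectives $\otimes$ and $\to$, where $\otimes$ is strictly associative and $I$ is strictly neutral for $\otimes$. A formula is \emph{constant} if it contains no letters, and \emph{proper} if it has no subformula $B\to C$ with $C$ constant and $B$ not constant. Terms $f\colon A\vdash B$, whose type $A\vdash B$ is a pair of formulae, are built from the primitive terms $$\mathbf 1_A\colon A\vdash A,\quad c_{A,B}\colon A\otimes B\vdash B\otimes A,\quad \eta_{A,B}\colon B\vdash A\to(A\otimes B),\quad \varepsilon_{A,B}\colon A\otimes(A\to B)\vdash B$$ by composition ($g\circ f\colon A\vdash C$ for $f\colon A\vdash B$, $g\colon B\vdash C$), by $\otimes$ ($f_1\otimes f_2\colon A_1\otimes A_2\vdash B_1\otimes B_2$ for $f_i\colon A_i\vdash B_i$), and by $A\to f\colon A\to B_1\vdash A\to B_2$ for $f\colon B_1\vdash B_2$. Equality of terms is the congruence generated by strict associativity of $\otimes$ on terms and strict neutrality of $\mathbf 1_I$, and by the equations (for all correctly typed instances) $$g\circ\mathbf 1_A=g,\quad \mathbf 1_B\circ f=f,\quad h\circ(g\circ f)=(h\circ g)\circ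 f,$$ $$\mathbf 1_A\otimes\mathbf 1_B=\mathbf 1_{A\otimes B},\quad (g_1\otimes g_2)\circ(f_1\otimes f_2)=(g_1\circ f_1)\otimes(g_2\circ f_2),$$ $$c_{A',B'}\circ(f\otimes g)=(g\otimes f)\circ c_{A,B},\quad c_{B,A}\circ c_{A,B}=\mathbf 1_{A\otimes B},\quad c_{A\otimes B,C}=(c_{A,C}\otimes\mathbf 1_B)\circ(\mathbf 1_A\otimes c_{B,C}),$$ $$A\to(g\circ f)=(A\to g)\circ(A\to f),\quad A\to\mathbf 1_B=\mathbf 1_{A\to B},$$ $$\eta_{A,B'}\circ f=(A\to(\mathbf 1_A\otimes f))\circ\eta_{A,B},\quad \varepsilon_{A,B'}\circ(\mathbf 1_A\otimes(A\to f))=f\circ\varepsilon_{A,B},$$ $$\varepsilon_{A,A\otimes B}\circ(\mathbf 1_A\otimes\eta_{A,B})=\mathbf 1_{A\otimes B},\quad (A\to\varepsilon_{A,B})\circ\eta_{A,A\to B}=\mathbf 1_{A\to B}.$$ Every term $f\colon A\vdash B$ induces \emph{links}, a set of unordered pairs of occurrences of letters in $A\vdash B$. For a primitive term, the links join the corresponding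 occurrences of letters in the two copies of $A$, and in the two copies of $B$ if there is a $B$, that are displayed in its type. The links of $f_1\otimes f_2$ are those of $f_1$ and those of $f_2$ put side by side; the links of $A\to f$ are those of $\mathbf 1_A$ and those of $f$ put side by side. The links of $g\circ f$, for $f\colon A\vdash B$ and $g\colon B\vdash C$, are obtained by gluing along $B$: two distinct occurrences in $A\vdash C$ are linked when there is a path between them that consists of links of $f$ and links of $g$. \textbf{Proposition.} Let $A$ and $B$ be proper formulae and let $f,g\colon A\vdash B$ be two terms. Then $f=g$ if and only if $f$ and $g$ induce the same links between the occurrences of letters in $A\vdash B$. -/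

import Mathlib

/-! Strict formulae, terms coding derivations, equality of terms, and the links induced by a term. -/

namespace StrictIL

/-- Formulae built from letters, `I`, `⊗` and `→`, in which `⊗` is strictly associative and `I` is
strictly neutral. Such a formula is the same thing as the finite sequence of its prime factors
(the factors that are letters or implications), and this is how it is represented: it is `I`,
or `p ⊗ G` for a letter `p`, or `(A → B) ⊗ G`. -/
inductive Form (L : Type*) where
  | unit : Form L
  | letterTensor (p : L) (G : Form L) : Form L
  | impTensor (A B G : Form L) : Form L

namespace Form

variable {L : Type*}

/-- The letter `p` as a formula. -/
def letter (p : L) : Form L := letterTensor p unit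

/-- The implication `A → B`. -/
def imp (A B : Form L) : Form L := impTensor A B unit

/-- The operation `A ⊗ B`: concatenation of the sequences of prime factors. -/
def tensor : Form L → Form L → Form L
  | unit, E => E
  | letterTensor p G, E => letterTensor p (tensor G E)
  | impTensor A B G, E => impTensor A B (tensor G E)

theorem unit_tensor (A : Form L) : tensor unit A = A := rfl

theorem tensor_unit (A : Form L) : tensor A unit = A := by
  induction A with
  | unit => rfl
  | letterTensor p G ih => simp [tensor, ih]
  | impTensor A B G _ _ ih => simp [tensor, ih]

theorem tensor_assoc (A B C : Form L) :
    tensor (tensor A B) C = tensor A (tensor B C) := by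
  induction A with
  | unit => rfl
  | letterTensor p G ih => simp [tensor, ih]
  | impTensor A B G _ _ ih => simp [tensor, ih]

/-- The number of occurrences of letters in a formula. -/
def size : Form L → ℕ
  | unit => 0
  | letterTensor _ G => 1 + size G
  | impTensor A B G => size A + size B + size G

/-- A formula is constant when it contains no letters. -/
def IsConstant : Form L → Prop
  | unit => True
  | letterTensor _ _ => False
  | impTensor A B G => IsConstant A ∧ IsConstant B ∧ IsConstant G

/-- A formula is proper when it has no subformula `B → C` with `C` constant and `B` not
constant. -/
def IsProper : Form L → Prop
  | unit => True
  | letterTensor _ G => IsProper G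
  | impTensor B C G =>
      ¬ (C.IsConstant ∧ ¬ B.IsConstant) ∧ IsProper B ∧ IsProper C ∧ IsProper G

end Form

/-- Raw terms. `comp g f` is `g ∘ f`. -/
inductive Term (L : Type*) where
  /-- `1_A : A ⊢ A` -/
  | id (A : Form L) : Term L
  /-- `c_{A,B} : A ⊗ B ⊢ B ⊗ A` -/
  | swap (A B : Form L) : Term L
  /-- `η_{A,B} : B ⊢ A → (A ⊗ B)` -/
  | eta (A B : Form L) : Term L
  /-- `ε_{A,B} : A ⊗ (A → B) ⊢ B` -/
  | eps (A B : Form L) : Term L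
  | comp (g f : Term L) : Term L
  | tensor (f g : Term L) : Term L
  /-- `A → f`, for a formula `A` -/
  | imp (A : Form L) (f : Term L) : Term L

namespace Term

variable {L : Type*}

/-- The left-hand side of the type of a term. -/
def dom : Term L → Form L
  | id A => A
  | swap A B => A.tensor B
  | eta _ B => B
  | eps A B => A.tensor (A.imp B)
  | comp _ f => dom f
  | tensor f g => (dom f).tensor (dom g)
  | imp A f => A.imp (dom f)

/-- The right-hand side of the type of a term. -/
def cod : Term L → Form L
  | id A => A
  | swap A B => B.tensor A
  | eta A B => A.imp (A.tensor B)
  | eps _ B => B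
  | comp g _ => cod g
  | tensor f g => (cod f).tensor (cod g)
  | imp A f => A.imp (cod f)

/-- A raw term is well formed when only composable terms are composed in it. -/
def WellFormed : Term L → Prop
  | id _ => True
  | swap _ _ => True
  | eta _ _ => True
  | eps _ _ => True
  | comp g f => WellFormed g ∧ WellFormed f ∧ cod f = dom g
  | tensor f g => WellFormed f ∧ WellFormed g
  | imp _ f => WellFormed f

/-- `f.HasType A B` says that `f : A ⊢ B` is a term. -/
def HasType (f : Term L) (A B : Form L) : Prop :=
  f.WellFormed ∧ f.dom = A ∧ f.cod = B

/-- Equality of terms: the congruence on (well formed) terms that is generated by the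
identifications making the language of terms strict (the first three rules), and by the equations
of symmetric monoidal closed categories. -/
inductive TermEq : Term L → Term L → Prop
  -- strictness of the language
  | tensor_assoc {f g h : Term L} {A B C A' B' C' : Form L} :
      f.HasType A A' → g.HasType B B' → h.HasType C C' →
      TermEq (tensor f (tensor g h)) (tensor (tensor f g) h)
  | tensor_one {f : Term L} {A B : Form L} : f.HasType A B →
      TermEq (tensor f (id Form.unit)) f
  | one_tensor {f : Term L} {A B : Form L} : f.HasType A B →
      TermEq (tensor (id Form.unit) f) f
  -- the congruence rules
  | refl {f : Term L} {A B : Form L} : f.HasType A B → TermEq f f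
  | symm {f g : Term L} : TermEq f g → TermEq g f
  | trans {f g h : Term L} : TermEq f g → TermEq g h → TermEq f h
  | comp_congr {f f' g g' : Term L} {A B C : Form L} :
      f.HasType A B → g.HasType B C → TermEq f f' → TermEq g g' →
      TermEq (comp g f) (comp g' f')
  | tensor_congr {f f' g g' : Term L} : TermEq f f' → TermEq g g' →
      TermEq (tensor f g) (tensor f' g')
  | imp_congr (A : Form L) {f f' : Term L} : TermEq f f' → TermEq (imp A f) (imp A f')
  -- the category equations
  | comp_id {g : Term L} {A B : Form L} : g.HasType A B → TermEq (comp g (id A)) g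
  | id_comp {f : Term L} {A B : Form L} : f.HasType A B → TermEq (comp (id B) f) f
  | comp_assoc {f g h : Term L} {A B C D : Form L} :
      f.HasType A B → g.HasType B C → h.HasType C D →
      TermEq (comp h (comp g f)) (comp (comp h g) f)
  -- `⊗` is a bifunctor
  | tensor_id (A B : Form L) : TermEq (tensor (id A) (id B)) (id (A.tensor B))
  | tensor_comp {f₁ f₂ g₁ g₂ : Term L} {A₁ A₂ B₁ B₂ C₁ C₂ : Form L} :
      f₁.HasType A₁ B₁ → f₂.HasType A₂ B₂ → g₁.HasType B₁ C₁ → g₂.HasType B₂ C₂ →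
      TermEq (comp (tensor g₁ g₂) (tensor f₁ f₂)) (tensor (comp g₁ f₁) (comp g₂ f₂))
  -- the symmetry
  | swap_natural {f g : Term L} {A A' B B' : Form L} :
      f.HasType A A' → g.HasType B B' →
      TermEq (comp (swap A' B') (tensor f g)) (comp (tensor g f) (swap A B))
  | swap_swap (A B : Form L) : TermEq (comp (swap B A) (swap A B)) (id (A.tensor B))
  | swap_tensor (A B C : Form L) :
      TermEq (swap (A.tensor B) C)
        (comp (tensor (swap A C) (id B)) (tensor (id A) (swap B C)))
  -- `A → _` is a functor
  | imp_comp (A : Form L) {f g : Term L} {B C D : Form L} :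
      f.HasType B C → g.HasType C D →
      TermEq (imp A (comp g f)) (comp (imp A g) (imp A f))
  | imp_id (A B : Form L) : TermEq (imp A (id B)) (id (A.imp B))
  -- naturality of `η` and `ε`
  | eta_natural (A : Form L) {f : Term L} {B B' : Form L} : f.HasType B B' →
      TermEq (comp (eta A B') f) (comp (imp A (tensor (id A) f)) (eta A B))
  | eps_natural (A : Form L) {f : Term L} {B B' : Form L} : f.HasType B B' →
      TermEq (comp (eps A B') (tensor (id A) (imp A f))) (comp f (eps A B))
  -- the triangular equations
  | triangle_left (A B : Form L) :
      TermEq (comp (eps A (A.tensor B)) (tensor (id A) (eta A B))) (id (A.tensor B))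
  | triangle_right (A B : Form L) :
      TermEq (comp (imp A (eps A B)) (eta A (A.imp B))) (id (A.imp B))

end Term

/-- A name for an occurrence of a letter in a sequent `A ⊢ B`: `left i` is the `i`-th occurrence
in `A`, and `right j` is the `j`-th occurrence in `B`, counted from left to right, starting
with 0. -/
inductive Occ where
  | left (i : ℕ) : Occ
  | right (j : ℕ) : Occ

/-- Renumbering when the left-hand side is preceded by `a` and the right-hand side by `b`
occurrences of letters. -/
def Occ.shift (a b : ℕ) : Occ → Occ
  | left i => left (a + i)
  | right j => right (b + j)

/-- Points in the gluing of the links of `f : A ⊢ B` with the links of `g : B ⊢ C`: occurrences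
in `A`, in `B`, and in `C`. -/
inductive GluePoint where
  | bottom (i : ℕ) : GluePoint
  | middle (k : ℕ) : GluePoint
  | top (j : ℕ) : GluePoint

namespace GluePoint

/-- Occurrences in `A ⊢ B` as points of the gluing. -/
def ofFirst : Occ → GluePoint
  | .left i => bottom i
  | .right k => middle k

/-- Occurrences in `B ⊢ C` as points of the gluing. -/
def ofSecond : Occ → GluePoint
  | .left k => middle k
  | .right j => top j

/-- Occurrences in `A ⊢ C` as points of the gluing. -/
def ofOuter : Occ → GluePoint
  | .left i => bottom i
  | .right j => top j

end GluePoint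

/-- Two points are joined in the gluing by a link in `S` or by a link in `T`. -/
def GlueAdj (S T : Set (Sym2 Occ)) (u v : GluePoint) : Prop :=
  s(u, v) ∈ Sym2.map GluePoint.ofFirst '' S ∪ Sym2.map GluePoint.ofSecond '' T

/-- The gluing of links: two different outer occurrences are linked when there is a path between
them, composed of links in `S` and links in `T`. -/
def glue (S T : Set (Sym2 Occ)) : Set (Sym2 Occ) :=
  {e | ∃ x y : Occ, e = s(x, y) ∧ x ≠ y ∧
    Relation.ReflTransGen (GlueAdj S T) (GluePoint.ofOuter x) (GluePoint.ofOuter y)}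

/-- The links between the occurrences of letters in its type that are induced by a term. -/
def Term.links {L : Type*} : Term L → Set (Sym2 Occ)
  | .id A => {e | ∃ i < A.size, e = s(.left i, .right i)}
  | .swap A B =>
      {e | ∃ i < A.size, e = s(.left i, .right (B.size + i))} ∪
      {e | ∃ j < B.size, e = s(.left (A.size + j), .right j)}
  | .eta A B =>
      {e | ∃ i < A.size, e = s(.right i, .right (A.size + i))} ∪
      {e | ∃ j < B.size, e = s(.left j, .right (A.size + A.size + j))}
  | .eps A B =>
      {e | ∃ i < A.size, e = s(.left i, .left (A.size + i))} ∪
      {e | ∃ j < B.size, e = s(.left (A.size + A.size + j), .right j)}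
  | .comp g f => glue f.links g.links
  | .tensor f g =>
      f.links ∪ Sym2.map (Occ.shift f.dom.size f.cod.size) '' g.links
  | .imp A f =>
      {e | ∃ i < A.size, e = s(.left i, .right i)} ∪
      Sym2.map (Occ.shift A.size A.size) '' f.links

end StrictIL

/-! Equal terms induce equal links because the links can be read off a sound interpretation. A term
denotes the relation between those labellings of its two sides by numbers that give linked
occurrences the same number (`labels_iff_agree`). Composition becomes composition of relations,
every equation preserves the relation (`TermEq.labels`), and the relation determines the links
(`links_subset`).

The converse is a coherence theorem in the style of Kelly and Mac Lane. By cut elimination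
(`Ty.cutFree`) every term equals one coded by a cut-free derivation. Giving the axioms of the
derivation different tags shows that `f` is a substitution instance of some `f' : A' ⊢ B'` in whose
type no letter occurs more than twice (`CutFree.exists_lifts`). The tags are a labelling that `f`
allows. If `g` has the same links it allows the same labelling, and therefore it is an instance of
some `g' : A' ⊢ B'` of exactly the same type (`Labels.exists_lift`). It remains to prove `f' = g'`;
substitution then gives `f = g`.

Properness is used to pass to reduced formulae, in which `I` is never a side of an implication: a
proper formula is a retract of a reduced one with the same letters (`IsProper.exists_reduced`). A
nonempty reduced formula contains a letter, so a nonempty group of factors in a derivable sequent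
must share a letter with the rest (`CutFree.eq_unit_of_apart`). When no letter occurs more than
twice, two consequences follow. The factors on the left are distinct, so the permutation
isomorphisms are unique (`CutFree.nodup`, `IsPerm.unique`). Moreover, if the last rule of one
derivation splits the sequent into two premises, parity shows that the premises share no letters,
and every other morphism of the same type splits in the same way (`CutFree.splitsTensor`,
`CutFree.splitsImp`). Induction on the number of letters and implications then gives uniqueness
(`eq_of_good`); an implication on the right is removed by transposition. -/

namespace StrictIL

-- Terms modulo equality.

infixr:72 " ⊡ " => Form.tensor

variable {L : Type*}

attribute [simp] Form.unit_tensor Form.tensor_unit Form.tensor_assoc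

namespace Form

@[simp] theorem imp_inj {A B C D : Form L} : A.imp B = C.imp D ↔ A = C ∧ B = D := by
  simp [imp]

end Form

namespace Term

theorem TermEq.type {f g : Term L} (h : TermEq f g) :
    f.WellFormed ∧ g.WellFormed ∧ f.dom = g.dom ∧ f.cod = g.cod := by
  induction h <;> simp_all [HasType, WellFormed, dom, cod]

/-- Terms of the same type are identified when they are equal, or when both are ill formed. -/
instance setoid (L : Type*) : Setoid (Term L) where
  r f g := f.dom = g.dom ∧ f.cod = g.cod ∧
    (TermEq f g ∨ ¬ f.WellFormed ∧ ¬ g.WellFormed)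
  iseqv :=
    { refl := fun f => ⟨rfl, rfl, by
        by_cases h : f.WellFormed
        · exact .inl (.refl ⟨h, rfl, rfl⟩)
        · exact .inr ⟨h, h⟩⟩
      symm := fun ⟨h1, h2, h3⟩ => ⟨h1.symm, h2.symm, h3.imp TermEq.symm And.symm⟩
      trans := by
        rintro f g h ⟨h1, h2, h3⟩ ⟨k1, k2, k3⟩
        refine ⟨h1.trans k1, h2.trans k2, ?_⟩
        rcases h3 with h3 | h3 <;> rcases k3 with k3 | k3
        · exact .inl (h3.trans k3)
        · exact absurd h3.type.2.1 k3.1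
        · exact absurd k3.type.1 h3.2
        · exact .inr ⟨h3.1, k3.2⟩ }

theorem wellFormed_iff_of_equiv {f g : Term L} (h : f ≈ g) : f.WellFormed ↔ g.WellFormed := by
  rcases h.2.2 with h | h
  · simp [h.type.1, h.type.2.1]
  · simp [h.1, h.2]

theorem equiv_of {f g : Term L} (hd : f.dom = g.dom) (hc : f.cod = g.cod)
    (hw : f.WellFormed ↔ g.WellFormed) (h : f.WellFormed → TermEq f g) : f ≈ g :=
  ⟨hd, hc, by
    by_cases hf : f.WellFormed
    · exact .inl (h hf)
    · exact .inr ⟨hf, fun hg => hf (hw.2 hg)⟩⟩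

theorem termEq_of_equiv {f g : Term L} (h : f ≈ g) (hf : f.WellFormed) : TermEq f g :=
  h.2.2.resolve_right fun k => k.1 hf

end Term

/-- Terms up to equality. -/
def Mor (L : Type*) : Type _ := Quotient (Term.setoid L)

namespace Mor

open Term

def mk (f : Term L) : Mor L := Quotient.mk _ f

/-- The left-hand side of the type. -/
def dom (f : Mor L) : Form L := Quotient.lift Term.dom (fun _ _ (h : _ ∧ _) => h.1) f

/-- The right-hand side of the type. -/
def cod (f : Mor L) : Form L := Quotient.lift Term.cod (fun _ _ (h : _ ∧ _) => h.2.1) f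

/-- Well-formedness. -/
def Ok (f : Mor L) : Prop :=
  Quotient.lift Term.WellFormed (fun _ _ h => propext (wellFormed_iff_of_equiv h)) f

def id (A : Form L) : Mor L := mk (.id A)
def swap (A B : Form L) : Mor L := mk (.swap A B)
def eta (A B : Form L) : Mor L := mk (.eta A B)
def eps (A B : Form L) : Mor L := mk (.eps A B)

/-- Composition is total, and composites that do not match fall into ill-formed classes.
Associativity and functoriality therefore hold without typing hypotheses and can be used for
rewriting. -/
def comp (g f : Mor L) : Mor L :=
  Quotient.map₂ Term.comp (by
    intro g g' hg f f' hf
    refine equiv_of hf.1 hg.2.1 ?_ ?_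
    · simp only [WellFormed, wellFormed_iff_of_equiv hg, wellFormed_iff_of_equiv hf, hf.2.1, hg.1]
    · rintro ⟨h1, h2, h3⟩
      exact .comp_congr ⟨h2, rfl, rfl⟩ ⟨h1, h3.symm, rfl⟩ (termEq_of_equiv hf h2)
        (termEq_of_equiv hg h1)) g f

def tensor (f g : Mor L) : Mor L :=
  Quotient.map₂ Term.tensor (by
    intro f f' hf g g' hg
    refine equiv_of (congrArg₂ _ hf.1 hg.1) (congrArg₂ _ hf.2.1 hg.2.1) ?_ ?_
    · simp only [WellFormed, wellFormed_iff_of_equiv hg, wellFormed_iff_of_equiv hf]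
    · rintro ⟨h1, h2⟩
      exact .tensor_congr (termEq_of_equiv hf h1) (termEq_of_equiv hg h2)) f g

def imp (A : Form L) (f : Mor L) : Mor L :=
  Quotient.map (Term.imp A) (by
    intro f f' hf
    refine equiv_of (congrArg A.imp hf.1) (congrArg A.imp hf.2.1) ?_ ?_
    · simp only [WellFormed, wellFormed_iff_of_equiv hf]
    · intro h1
      exact .imp_congr A (termEq_of_equiv hf h1)) f

end Mor

infixr:70 " ⊚ " => Mor.comp
infixr:75 " ⊠ " => Mor.tensor

namespace Mor

open Term

theorem mk_eq_iff {f g : Term L} (hf : f.WellFormed) : mk f = mk g ↔ TermEq f g := by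
  refine Quotient.eq.trans ⟨fun h => termEq_of_equiv h hf, fun h => ?_⟩
  exact ⟨h.type.2.2.1, h.type.2.2.2, .inl h⟩

theorem mk_eq_of_termEq {f g : Term L} (h : TermEq f g) : mk f = mk g :=
  (mk_eq_iff h.type.1).2 h

@[simp] theorem dom_mk (f : Term L) : dom (mk f) = f.dom := rfl
@[simp] theorem cod_mk (f : Term L) : cod (mk f) = f.cod := rfl
@[simp] theorem ok_mk (f : Term L) : Ok (mk f) ↔ f.WellFormed := Iff.rfl

theorem mk_comp (g f : Term L) : mk (.comp g f) = mk g ⊚ mk f := rfl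
theorem mk_tensor (f g : Term L) : mk (.tensor f g) = mk f ⊠ mk g := rfl
theorem mk_imp (A : Form L) (f : Term L) : mk (.imp A f) = imp A (mk f) := rfl

@[simp] theorem dom_id (A : Form L) : (id A).dom = A := rfl
@[simp] theorem cod_id (A : Form L) : (id A).cod = A := rfl
@[simp] theorem ok_id (A : Form L) : (id A).Ok := trivial
@[simp] theorem dom_swap (A B : Form L) : (swap A B).dom = A ⊡ B := rfl
@[simp] theorem cod_swap (A B : Form L) : (swap A B).cod = B ⊡ A := rfl
@[simp] theorem ok_swap (A B : Form L) : (swap A B).Ok := trivial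
@[simp] theorem dom_eta (A B : Form L) : (eta A B).dom = B := rfl
@[simp] theorem cod_eta (A B : Form L) : (eta A B).cod = A.imp (A ⊡ B) := rfl
@[simp] theorem ok_eta (A B : Form L) : (eta A B).Ok := trivial
@[simp] theorem dom_eps (A B : Form L) : (eps A B).dom = A ⊡ A.imp B := rfl
@[simp] theorem cod_eps (A B : Form L) : (eps A B).cod = B := rfl
@[simp] theorem ok_eps (A B : Form L) : (eps A B).Ok := trivial

@[simp] theorem dom_comp (g f : Mor L) : (g ⊚ f).dom = f.dom := by
  induction g using Quotient.ind; induction f using Quotient.ind; rfl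
@[simp] theorem cod_comp (g f : Mor L) : (g ⊚ f).cod = g.cod := by
  induction g using Quotient.ind; induction f using Quotient.ind; rfl
@[simp] theorem ok_comp (g f : Mor L) : (g ⊚ f).Ok ↔ g.Ok ∧ f.Ok ∧ f.cod = g.dom := by
  induction g using Quotient.ind; induction f using Quotient.ind; rfl
@[simp] theorem dom_tensor (f g : Mor L) : (f ⊠ g).dom = f.dom ⊡ g.dom := by
  induction g using Quotient.ind; induction f using Quotient.ind; rfl
@[simp] theorem cod_tensor (f g : Mor L) : (f ⊠ g).cod = f.cod ⊡ g.cod := by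
  induction g using Quotient.ind; induction f using Quotient.ind; rfl
@[simp] theorem ok_tensor (f g : Mor L) : (f ⊠ g).Ok ↔ f.Ok ∧ g.Ok := by
  induction g using Quotient.ind; induction f using Quotient.ind; rfl
@[simp] theorem dom_imp (A : Form L) (f : Mor L) : (imp A f).dom = A.imp f.dom := by
  induction f using Quotient.ind; rfl
@[simp] theorem cod_imp (A : Form L) (f : Mor L) : (imp A f).cod = A.imp f.cod := by
  induction f using Quotient.ind; rfl
@[simp] theorem ok_imp (A : Form L) (f : Mor L) : (imp A f).Ok ↔ f.Ok := by
  induction f using Quotient.ind; rfl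

@[simp] theorem comp_assoc (h g f : Mor L) : (h ⊚ g) ⊚ f = h ⊚ g ⊚ f := by
  induction h using Quotient.ind; induction g using Quotient.ind; induction f using Quotient.ind
  refine Eq.symm (Quotient.sound (equiv_of rfl rfl ?_ ?_))
  · simp only [WellFormed, Term.dom, Term.cod]; tauto
  · rintro ⟨h1, ⟨h2, h3, h4⟩, h5⟩
    exact .comp_assoc ⟨h3, rfl, rfl⟩ ⟨h2, h4.symm, rfl⟩ ⟨h1, h5.symm, rfl⟩

@[simp] theorem tensor_assoc (f g h : Mor L) : (f ⊠ g) ⊠ h = f ⊠ g ⊠ h := by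
  induction h using Quotient.ind; induction g using Quotient.ind; induction f using Quotient.ind
  refine (Quotient.sound (equiv_of ?_ ?_ ?_ ?_)).symm
  · simp [Term.dom]
  · simp [Term.cod]
  · simp only [WellFormed, and_assoc]
  · rintro ⟨h1, h2, h3⟩
    exact .tensor_assoc ⟨h1, rfl, rfl⟩ ⟨h2, rfl, rfl⟩ ⟨h3, rfl, rfl⟩

@[simp] theorem tensor_id_unit (f : Mor L) : f ⊠ id .unit = f := by
  induction f using Quotient.ind
  refine Quotient.sound (equiv_of ?_ ?_ ?_ ?_)
  · simp [Term.dom]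
  · simp [Term.cod]
  · simp [WellFormed]
  · rintro ⟨h1, _⟩
    exact .tensor_one ⟨h1, rfl, rfl⟩

@[simp] theorem id_unit_tensor (f : Mor L) : id .unit ⊠ f = f := by
  induction f using Quotient.ind
  refine Quotient.sound (equiv_of ?_ ?_ ?_ ?_)
  · simp [Term.dom]
  · simp [Term.cod]
  · simp [WellFormed]
  · rintro ⟨_, h1⟩
    exact .one_tensor ⟨h1, rfl, rfl⟩

theorem comp_id {f : Mor L} {A : Form L} (h : f.dom = A) : f ⊚ id A = f := by
  subst h
  induction f using Quotient.ind
  refine Quotient.sound (equiv_of rfl rfl ?_ ?_)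
  · simp [WellFormed, Term.cod, ← mk.eq_def]
  · rintro ⟨h1, _⟩
    exact .comp_id ⟨h1, rfl, rfl⟩

theorem id_comp {f : Mor L} {A : Form L} (h : f.cod = A) : id A ⊚ f = f := by
  subst h
  induction f using Quotient.ind
  refine Quotient.sound (equiv_of rfl rfl ?_ ?_)
  · simp [WellFormed, Term.dom, ← mk.eq_def]
  · rintro ⟨_, h1, _⟩
    exact .id_comp ⟨h1, rfl, rfl⟩

@[simp] theorem id_tensor_id (A B : Form L) : id A ⊠ id B = id (A ⊡ B) :=
  mk_eq_of_termEq (.tensor_id A B)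

/-- The matching conditions cannot be dropped: two tensor products may coincide while being divided
at different places, and then the left-hand side can be well formed when the right-hand side is not.
-/
theorem interchange {f₁ f₂ g₁ g₂ : Mor L} (h₁ : f₁.cod = g₁.dom) (h₂ : f₂.cod = g₂.dom) :
    (g₁ ⊠ g₂) ⊚ (f₁ ⊠ f₂) = (g₁ ⊚ f₁) ⊠ (g₂ ⊚ f₂) := by
  induction f₁ using Quotient.ind; induction f₂ using Quotient.ind
  induction g₁ using Quotient.ind; induction g₂ using Quotient.ind
  simp only [← mk.eq_def, cod_mk, dom_mk] at h₁ h₂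
  refine Quotient.sound (equiv_of rfl rfl ?_ ?_)
  · simp [WellFormed, Term.dom, Term.cod, h₁, h₂]; tauto
  · rintro ⟨⟨k1, k2⟩, ⟨k3, k4⟩, _⟩
    exact .tensor_comp ⟨k3, rfl, rfl⟩ ⟨k4, rfl, rfl⟩ ⟨k1, h₁.symm, rfl⟩ ⟨k2, h₂.symm, rfl⟩

theorem swap_natural {f g : Mor L} {A A' B B' : Form L} (h₁ : f.dom = A) (h₂ : f.cod = A')
    (h₃ : g.dom = B) (h₄ : g.cod = B') :
    swap A' B' ⊚ (f ⊠ g) = (g ⊠ f) ⊚ swap A B := by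
  subst h₁ h₂ h₃ h₄
  induction f using Quotient.ind; induction g using Quotient.ind
  refine Quotient.sound (equiv_of rfl rfl ?_ ?_)
  · simp [WellFormed, Term.dom, Term.cod, ← mk.eq_def]; tauto
  · rintro ⟨_, ⟨k3, k4⟩, _⟩
    exact .swap_natural ⟨k3, rfl, rfl⟩ ⟨k4, rfl, rfl⟩

@[simp] theorem swap_swap (A B : Form L) : swap B A ⊚ swap A B = id (A ⊡ B) :=
  mk_eq_of_termEq (.swap_swap A B)

theorem swap_tensor (A B C : Form L) :
    swap (A ⊡ B) C = (swap A C ⊠ id B) ⊚ (id A ⊠ swap B C) :=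
  mk_eq_of_termEq (.swap_tensor A B C)

theorem imp_comp (A : Form L) (g f : Mor L) : imp A (g ⊚ f) = imp A g ⊚ imp A f := by
  induction f using Quotient.ind; induction g using Quotient.ind
  refine Quotient.sound (equiv_of rfl rfl ?_ ?_)
  · simp [WellFormed, Term.dom, Term.cod]
  · rintro ⟨k1, k2, k3⟩
    exact .imp_comp A ⟨k2, rfl, rfl⟩ ⟨k1, k3.symm, rfl⟩

@[simp] theorem imp_id (A B : Form L) : imp A (id B) = id (A.imp B) :=
  mk_eq_of_termEq (.imp_id A B)

theorem eta_natural (A : Form L) {f : Mor L} {B B' : Form L} (h₁ : f.dom = B) (h₂ : f.cod = B') :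
    eta A B' ⊚ f = imp A (id A ⊠ f) ⊚ eta A B := by
  subst h₁ h₂
  induction f using Quotient.ind
  refine Quotient.sound (equiv_of rfl rfl ?_ ?_)
  · simp [WellFormed, Term.dom, Term.cod, ← mk.eq_def]
  · rintro ⟨_, k, _⟩
    exact .eta_natural A ⟨k, rfl, rfl⟩

theorem eps_natural (A : Form L) {f : Mor L} {B B' : Form L} (h₁ : f.dom = B) (h₂ : f.cod = B') :
    eps A B' ⊚ (id A ⊠ imp A f) = f ⊚ eps A B := by
  subst h₁ h₂
  induction f using Quotient.ind
  refine Quotient.sound (equiv_of rfl rfl ?_ ?_)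
  · simp [WellFormed, Term.dom, Term.cod, ← mk.eq_def]
  · rintro ⟨_, ⟨_, k⟩, _⟩
    exact .eps_natural A ⟨k, rfl, rfl⟩

theorem triangle_left (A B : Form L) :
    eps A (A ⊡ B) ⊚ (id A ⊠ eta A B) = id (A ⊡ B) :=
  mk_eq_of_termEq (.triangle_left A B)

theorem triangle_right (A B : Form L) :
    imp A (eps A B) ⊚ eta A (A.imp B) = id (A.imp B) :=
  mk_eq_of_termEq (.triangle_right A B)

end Mor

/-! ### Formulae as sequences and as multisets of prime factors. -/

namespace Form

/-- The sequence of prime factors. -/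
def fac : Form L → List (Form L)
  | unit => []
  | letterTensor p G => letter p :: fac G
  | impTensor A B G => imp A B :: fac G

/-- The multiset of prime factors. -/
def mfac (A : Form L) : Multiset (Form L) := A.fac

/-- A prime formula: a letter or an implication. -/
def IsPrime (x : Form L) : Prop := x.fac = [x]

theorem isPrime_letter (p : L) : (letter p).IsPrime := rfl

theorem isPrime_imp (A B : Form L) : (imp A B).IsPrime := rfl

@[elab_as_elim]
-- Treats letters and implications alike, and does not descend into the sides of an implication.
theorem prime_induction {P : Form L → Prop} (A : Form L) (unit : P unit)
    (tensor : ∀ x G, x.IsPrime → P G → P (x ⊡ G)) : P A := by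
  induction A with
  | unit => exact unit
  | letterTensor p G ih => exact tensor (letter p) G rfl ih
  | impTensor A B G _ _ ih => exact tensor (imp A B) G rfl ih

@[simp] theorem fac_unit : fac (unit : Form L) = [] := rfl

@[simp] theorem fac_tensor (A B : Form L) : fac (A ⊡ B) = fac A ++ fac B := by
  induction A with
  | unit => rfl
  | letterTensor p G ih => simp [tensor, fac, ih]
  | impTensor A B G _ _ ih => simp [tensor, fac, ih]

theorem fac_injective : Function.Injective (fac : Form L → List (Form L)) := by
  intro A B h
  induction A generalizing B with
  | unit => cases B <;> simp_all [fac]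
  | letterTensor p G ih =>
    cases B <;> simp only [fac, letter, imp, List.cons.injEq, letterTensor.injEq,
      reduceCtorEq, false_and, List.cons_ne_nil] at h
    obtain ⟨H, h⟩ := h
    simp only [H, ih h]
  | impTensor A B G _ _ ih =>
    cases B <;> simp only [fac, letter, imp, List.cons.injEq, impTensor.injEq,
      reduceCtorEq, false_and, List.cons_ne_nil] at h
    obtain ⟨H, h⟩ := h
    simp only [H, ih h]

theorem isPrime_of_mem_fac {x A : Form L} (h : x ∈ A.fac) : x.IsPrime := by
  induction A with
  | unit => simp at h
  | letterTensor p G ih =>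
    rcases List.mem_cons.1 h with rfl | h
    exacts [rfl, ih h]
  | impTensor A B G _ _ ih =>
    rcases List.mem_cons.1 h with rfl | h
    exacts [rfl, ih h]

theorem exists_fac_eq (l : List (Form L)) (h : ∀ x ∈ l, x.IsPrime) : ∃ A : Form L, A.fac = l := by
  induction l with
  | nil => exact ⟨unit, rfl⟩
  | cons x l ih =>
    obtain ⟨A, hA⟩ := ih fun y hy => h y (List.mem_cons_of_mem _ hy)
    exact ⟨x ⊡ A, by rw [fac_tensor, hA, h x List.mem_cons_self]; rfl⟩

@[simp] theorem mfac_unit : mfac (unit : Form L) = 0 := rfl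

@[simp] theorem mfac_tensor (A B : Form L) : mfac (A ⊡ B) = mfac A + mfac B := by
  simp [mfac]

theorem IsPrime.mfac {x : Form L} (h : x.IsPrime) : x.mfac = {x} := by
  rw [Form.mfac, h]; rfl

@[simp] theorem mfac_letter (p : L) : mfac (letter p) = {letter p} := rfl

@[simp] theorem mfac_imp (A B : Form L) : mfac (imp A B) = {imp A B} := rfl

theorem IsPrime.ne_unit {x : Form L} (h : x.IsPrime) : x ≠ unit := by
  rintro rfl
  simp [IsPrime] at h

@[simp] theorem mfac_eq_zero {A : Form L} : A.mfac = 0 ↔ A = unit := by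
  refine ⟨fun h => fac_injective ?_, fun h => by simp [h]⟩
  simpa [mfac] using h

theorem mfac_eq_singleton {A x : Form L} : A.mfac = {x} → A = x := by
  intro h
  have h1 : A.fac = [x] := by simpa [mfac] using h
  have h2 : x.IsPrime := isPrime_of_mem_fac (A := A) (by simp [h1])
  exact fac_injective (h1.trans h2.symm)

@[simp] theorem tensor_eq_unit {A B : Form L} : A ⊡ B = unit ↔ A = unit ∧ B = unit := by
  rw [← mfac_eq_zero, mfac_tensor, add_eq_zero, mfac_eq_zero, mfac_eq_zero]

theorem IsPrime.eq_tensor {x A B : Form L} (hx : x.IsPrime) (h : x = A ⊡ B) :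
    A = unit ∧ B = x ∨ A = x ∧ B = unit := by
  have h1 := congrArg fac h
  rw [hx, fac_tensor] at h1
  rcases List.append_eq_singleton_iff.1 h1.symm with ⟨h2, h3⟩ | ⟨h2, h3⟩
  · have : A = unit := fac_injective h2
    subst this
    exact .inl ⟨rfl, h.symm⟩
  · have : B = unit := fac_injective h3
    subst this
    exact .inr ⟨by simpa using h.symm, rfl⟩

/-- Levi's lemma for the free monoid on the prime formulae. -/
theorem tensor_eq_tensor {A B C D : Form L} (h : A ⊡ B = C ⊡ D) :
    (∃ E, C = A ⊡ E ∧ B = E ⊡ D) ∨ ∃ E, A = C ⊡ E ∧ D = E ⊡ B := by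
  have h1 := congrArg fac h
  simp only [fac_tensor] at h1
  rcases List.append_eq_append_iff.1 h1 with ⟨l, h2, h3⟩ | ⟨l, h2, h3⟩
  · obtain ⟨E, rfl⟩ := exists_fac_eq l fun x hx => isPrime_of_mem_fac (A := C) (by simp [h2, hx])
    exact .inl ⟨E, fac_injective (by simp [h2]), fac_injective (by simp [h3])⟩
  · obtain ⟨E, rfl⟩ := exists_fac_eq l fun x hx => isPrime_of_mem_fac (A := A) (by simp [h2, hx])
    exact .inr ⟨E, fac_injective (by simp [h2]), fac_injective (by simp [h3])⟩

theorem tensor_eq_tensor_prime {A B C x D : Form L} (hx : x.IsPrime) (h : A ⊡ B = C ⊡ x ⊡ D) :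
    (∃ E, A = C ⊡ x ⊡ E ∧ D = E ⊡ B) ∨ ∃ E, C = A ⊡ E ∧ B = E ⊡ x ⊡ D := by
  rcases tensor_eq_tensor h with h | ⟨E, rfl, h1⟩
  · exact .inr h
  · rcases tensor_eq_tensor h1 with ⟨F, rfl, rfl⟩ | ⟨F, h2, rfl⟩
    · exact .inl ⟨F, rfl, rfl⟩
    · rcases hx.eq_tensor h2 with ⟨rfl, rfl⟩ | ⟨rfl, rfl⟩
      · exact .inr ⟨unit, by simp, rfl⟩
      · exact .inl ⟨unit, by simp, rfl⟩

/-- Without repetitions the position of `x` is determined. This is what identifies the factor that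
two permutations send to the same place. -/
theorem split_unique {A₁ A₂ B₁ B₂ x : Form L} (hx : x.IsPrime)
    (h : A₁ ⊡ x ⊡ A₂ = B₁ ⊡ x ⊡ B₂) (hn : (A₁ ⊡ x ⊡ A₂).fac.Nodup) : A₁ = B₁ ∧ A₂ = B₂ := by
  have h1 := congrArg fac h
  have hx' : x.fac = [x] := hx
  simp only [fac_tensor, hx', List.singleton_append] at h1 hn
  have hA : x ∉ A₁.fac := fun hm => (List.nodup_append.1 hn).2.2 x hm x (by simp) rfl
  have hn' := hn
  rw [h1] at hn'
  have hB : x ∉ B₁.fac := fun hm => (List.nodup_append.1 hn').2.2 x hm x (by simp) rfl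
  rcases List.append_eq_append_iff.1 h1 with ⟨l, h2, h3⟩ | ⟨l, h2, h3⟩
  · cases l with
    | nil => exact ⟨fac_injective (by simp [h2]), fac_injective (by simpa using h3)⟩
    | cons y l =>
      simp only [List.cons_append, List.cons.injEq] at h3
      exact absurd (by simp [h2, h3.1]) hB
  · cases l with
    | nil => exact ⟨fac_injective (by simp [h2]), fac_injective (by simpa using h3.symm)⟩
    | cons y l =>
      simp only [List.cons_append, List.cons.injEq] at h3
      exact absurd (by simp [h2, h3.1]) hA

theorem mem_mfac {x A : Form L} : x ∈ A.mfac ↔ x ∈ A.fac := Iff.rfl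

theorem exists_mfac_of_mem {x A : Form L} (h : x ∈ A.mfac) :
    ∃ A₀ : Form L, A.mfac = x ::ₘ A₀.mfac := by
  obtain ⟨l₁, l₂, hl⟩ := List.append_of_mem (mem_mfac.1 h)
  obtain ⟨A₀, h₀⟩ := exists_fac_eq (l₁ ++ l₂) fun y hy => isPrime_of_mem_fac (A := A) <| by
    rw [hl]; simp at hy ⊢; tauto
  refine ⟨A₀, ?_⟩
  rw [mfac, mfac, hl, h₀]
  simp

/-- Riesz refinement for tensor products, up to the order of the factors. -/
theorem exists_refinement {A B C D : Form L} (h : A.mfac + B.mfac = C.mfac + D.mfac) :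
    ∃ AC AD BC BD : Form L, A.mfac = AC.mfac + AD.mfac ∧ B.mfac = BC.mfac + BD.mfac ∧
      C.mfac = AC.mfac + BC.mfac ∧ D.mfac = AD.mfac + BD.mfac := by
  induction A using prime_induction generalizing C D with
  | unit => exact ⟨unit, unit, C, D, by simp, by simpa using h, by simp, by simp⟩
  | tensor x G hx ih =>
    have hm : x ∈ C.mfac + D.mfac := by rw [← h]; simp [hx.mfac]
    rcases Multiset.mem_add.1 hm with hm | hm
    · obtain ⟨C₀, hC⟩ := exists_mfac_of_mem hm
      obtain ⟨AC, AD, BC, BD, h1, h2, h3, h4⟩ := @ih C₀ D (by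
        simpa [hx.mfac, hC, add_assoc] using h)
      exact ⟨x ⊡ AC, AD, BC, BD, by simp [h1, add_assoc], h2, by simp [hC, h3, hx.mfac], h4⟩
    · obtain ⟨D₀, hD⟩ := exists_mfac_of_mem hm
      obtain ⟨AC, AD, BC, BD, h1, h2, h3, h4⟩ := @ih C D₀ (by
        rw [hD, mfac_tensor, hx.mfac, Multiset.singleton_add, Multiset.cons_add,
          Multiset.add_cons] at h
        exact (Multiset.cons_inj_right _).1 h)
      exact ⟨AC, x ⊡ AD, BC, BD, by simp [h1, add_left_comm], h2, h3, by
        simp [hD, h4, hx.mfac]⟩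

end Form

/-! ### Permutations of tensor factors. -/

open Mor

/-- `Ty f A B` says that `f : A ⊢ B`. -/
structure Ty (f : Mor L) (A B : Form L) : Prop where
  ok : f.Ok
  dom : f.dom = A
  cod : f.cod = B

theorem Ty.id (A : Form L) : Ty (Mor.id A) A A := ⟨trivial, rfl, rfl⟩

theorem Ty.comp {f g : Mor L} {A B C : Form L} (hg : Ty g B C) (hf : Ty f A B) :
    Ty (g ⊚ f) A C := by
  constructor <;> simp [hg.ok, hg.dom, hg.cod, hf.ok, hf.dom, hf.cod]

theorem Ty.tensor {f g : Mor L} {A B C D : Form L} (hf : Ty f A B) (hg : Ty g C D) :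
    Ty (f ⊠ g) (A ⊡ C) (B ⊡ D) := by
  constructor <;> simp [hg.ok, hg.dom, hg.cod, hf.ok, hf.dom, hf.cod]

/-- The isomorphisms that permute the factors of a tensor product. -/
inductive IsPerm : Form L → Form L → Mor L → Prop
  | id (A : Form L) : IsPerm A A (Mor.id A)
  | comp {A B C : Form L} {σ τ : Mor L} : IsPerm A B σ → IsPerm B C τ → IsPerm A C (τ ⊚ σ)
  | tensor {A B C D : Form L} {σ τ : Mor L} : IsPerm A B σ → IsPerm C D τ →
      IsPerm (A ⊡ C) (B ⊡ D) (σ ⊠ τ)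
  | swap (A B : Form L) : IsPerm (A ⊡ B) (B ⊡ A) (Mor.swap A B)

namespace IsPerm

theorem ty {A B : Form L} {σ : Mor L} (h : IsPerm A B σ) : Ty σ A B := by
  induction h with
  | id A => exact .id A
  | comp _ _ h1 h2 => exact h2.comp h1
  | tensor _ _ h1 h2 => exact h1.tensor h2
  | swap A B => exact ⟨trivial, rfl, rfl⟩

theorem mfac_eq {A B : Form L} {σ : Mor L} (h : IsPerm A B σ) : A.mfac = B.mfac := by
  induction h with
  | id A => rfl
  | comp _ _ h1 h2 => exact h1.trans h2
  | tensor _ _ h1 h2 => simp [h1, h2]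
  | swap A B => simp [add_comm]

theorem exists_inv {A B : Form L} {σ : Mor L} (h : IsPerm A B σ) :
    ∃ τ, IsPerm B A τ ∧ τ ⊚ σ = Mor.id A ∧ σ ⊚ τ = Mor.id B := by
  induction h with
  | id A => exact ⟨_, .id A, Mor.id_comp rfl, Mor.id_comp rfl⟩
  | @comp A B C σ τ h1 h2 ih1 ih2 =>
    obtain ⟨σ', h1', h3, h4⟩ := ih1
    obtain ⟨τ', h2', h5, h6⟩ := ih2
    refine ⟨_, h2'.comp h1', ?_, ?_⟩
    · rw [Mor.comp_assoc, ← Mor.comp_assoc τ', h5, Mor.id_comp h1.ty.cod, h3]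
    · rw [Mor.comp_assoc, ← Mor.comp_assoc σ, h4, Mor.id_comp h2'.ty.cod, h6]
  | @tensor A B C D σ τ h1 h2 ih1 ih2 =>
    obtain ⟨σ', h1', h3, h4⟩ := ih1
    obtain ⟨τ', h2', h5, h6⟩ := ih2
    refine ⟨_, h1'.tensor h2', ?_, ?_⟩
    · rw [interchange (h1.ty.cod.trans h1'.ty.dom.symm) (h2.ty.cod.trans h2'.ty.dom.symm), h3, h5,
        id_tensor_id]
    · rw [interchange (h1'.ty.cod.trans h1.ty.dom.symm) (h2'.ty.cod.trans h2.ty.dom.symm), h4, h6,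
        id_tensor_id]
  | swap A B => exact ⟨_, .swap B A, swap_swap A B, swap_swap B A⟩

/-- Induction on a permutation of the lists of factors: a transposition of the first two factors is
a symmetry tensored with an identity, and for transitivity the intermediate list has to be realised
as a formula. -/
theorem exists_of_mfac_eq {A B : Form L} (h : A.mfac = B.mfac) : ∃ σ, IsPerm A B σ := by
  have h1 : A.fac.Perm B.fac := Quotient.exact h
  suffices ∀ l m : List (Form L), l.Perm m → ∀ A B : Form L, A.fac = l → B.fac = m →
    ∃ σ, IsPerm A B σ from this _ _ h1 A B rfl rfl
  intro l m hlm
  have key : ∀ (x : Form L) l (A : Form L), A.fac = x :: l →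
      ∃ A', A'.fac = l ∧ A = x ⊡ A' ∧ x.IsPrime := by
    intro x l A hA
    have hp : ∀ y ∈ x :: l, y.IsPrime := fun y hy => Form.isPrime_of_mem_fac (A := A) (hA ▸ hy)
    obtain ⟨A', hA'⟩ := Form.exists_fac_eq l fun y hy => hp y (by simp [hy])
    have hx : x.fac = [x] := hp x (by simp)
    exact ⟨A', hA', Form.fac_injective (by simp [hA, hA', hx]), hx⟩
  induction hlm with
  | nil =>
    intro A B hA hB
    exact Form.fac_injective (hA.trans hB.symm) ▸ ⟨_, .id A⟩
  | cons x _ ih =>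
    intro A B hA hB
    obtain ⟨A', hA', rfl, -⟩ := key _ _ _ hA
    obtain ⟨B', hB', rfl, -⟩ := key _ _ _ hB
    obtain ⟨σ, hσ⟩ := ih A' B' hA' hB'
    exact ⟨_, (IsPerm.id x).tensor hσ⟩
  | swap x y l =>
    intro A B hA hB
    obtain ⟨A', hA', rfl, -⟩ := key _ _ _ hA
    obtain ⟨A', hA'', rfl, -⟩ := key _ _ _ hA'
    obtain ⟨B', hB', rfl, -⟩ := key _ _ _ hB
    obtain ⟨B', hB'', rfl, -⟩ := key _ _ _ hB'
    obtain rfl := Form.fac_injective (hA''.trans hB''.symm)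
    exact ⟨_, by simpa using (IsPerm.swap y x).tensor (.id A')⟩
  | @trans l₁ l₂ l₃ h1 _ ih1 ih2 =>
    intro A C hA hC
    obtain ⟨B, hB⟩ := Form.exists_fac_eq l₂ fun y hy =>
      Form.isPrime_of_mem_fac (A := A) (by rw [hA]; exact h1.mem_iff.2 hy)
    obtain ⟨σ, hσ⟩ := ih1 A B hA hB
    obtain ⟨τ, hτ⟩ := ih2 B C hB hC
    exact ⟨_, hσ.comp hτ⟩

end IsPerm

namespace Mor

-- The hexagon at `I`, `I`, `A` says that this isomorphism is idempotent, so it is the identity.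
@[simp] theorem swap_unit_left (A : Form L) : swap .unit A = id A := by
  have h := swap_tensor .unit .unit A
  simp only [Form.unit_tensor, tensor_id_unit, id_unit_tensor] at h
  have h1 := congrArg (fun f => swap A .unit ⊚ f) h
  simp only [← comp_assoc, swap_swap, Form.unit_tensor] at h1
  rwa [id_comp (by simp), eq_comm] at h1

/-- This is the other hexagon, obtained by inverting `swap_tensor`. -/
theorem swap_tensor_right (A B C : Form L) :
    swap A (B ⊡ C) = (id B ⊠ swap A C) ⊚ (swap A B ⊠ id C) := by
  have h1 : swap A (B ⊡ C) ⊚ swap (B ⊡ C) A = id _ := swap_swap _ _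
  rw [swap_tensor] at h1
  have h2 := congrArg (fun f => f ⊚ (id B ⊠ swap A C) ⊚ (swap A B ⊠ id C)) h1
  simp only [comp_assoc] at h2
  rw [← comp_assoc (id B ⊠ swap C A), interchange (by simp) (by simp), swap_swap,
    id_comp (by simp), id_tensor_id, id_comp (by simp), interchange (by simp) (by simp), swap_swap,
    id_comp (by simp), id_tensor_id, comp_id (by simp)] at h2
  rw [h2, id_comp (by simp)]

end Mor

namespace Mor

@[simp] theorem id_comp_id (A : Form L) : id A ⊚ id A = id A := id_comp rfl

theorem interchange_id_right {f g : Mor L} (A : Form L) (h : f.cod = g.dom) :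
    (g ⊚ f) ⊠ id A = (g ⊠ id A) ⊚ (f ⊠ id A) := by
  rw [interchange h rfl, id_comp_id]

theorem interchange_id_left {f g : Mor L} (A : Form L) (h : f.cod = g.dom) :
    id A ⊠ (g ⊚ f) = (id A ⊠ g) ⊚ (id A ⊠ f) := by
  rw [interchange rfl h, id_comp_id]

/-- A composite of tensor products, computed factorwise, under a continuation. -/
theorem interchange_assoc {f₁ f₂ g₁ g₂ : Mor L} (k : Mor L) (h₁ : f₁.cod = g₁.dom)
    (h₂ : f₂.cod = g₂.dom) :
    (g₁ ⊠ g₂) ⊚ (f₁ ⊠ f₂) ⊚ k = ((g₁ ⊚ f₁) ⊠ (g₂ ⊚ f₂)) ⊚ k := by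
  rw [← comp_assoc, interchange h₁ h₂]

theorem swap_tensor_whisker (A E x B : Form L) :
    swap (A ⊡ E) x ⊠ id B = (swap A x ⊠ id (E ⊡ B)) ⊚ (id A ⊠ swap E x ⊠ id B) := by
  rw [swap_tensor, interchange_id_right _ (by simp), tensor_assoc, id_tensor_id, tensor_assoc]

end Mor

namespace IsPerm

/-- The coset decomposition of a symmetric group modulo the stabiliser of a point. Up to moving the
chosen factor `x` to the front on both sides, `σ` is a permutation `σ'` of the remaining factors,
which allows induction on their number. In the generating cases it follows from naturality of the
symmetry and from the hexagons. -/
theorem extract {A A' : Form L} {σ : Mor L} (h : IsPerm A A' σ) {B₁ x B₂ : Form L}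
    (hx : x.IsPrime) (hA' : A' = B₁ ⊡ x ⊡ B₂) :
    ∃ A₁ A₂ σ', A = A₁ ⊡ x ⊡ A₂ ∧ IsPerm (A₁ ⊡ A₂) (B₁ ⊡ B₂) σ' ∧
      (Mor.swap B₁ x ⊠ Mor.id B₂) ⊚ σ = (Mor.id x ⊠ σ') ⊚ (Mor.swap A₁ x ⊠ Mor.id A₂) := by
  induction h generalizing B₁ B₂ with
  | id A =>
    exact ⟨B₁, B₂, _, hA', .id _, by
      rw [Mor.comp_id (by simp [hA']), id_tensor_id, Mor.id_comp (by simp)]⟩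
  | @comp A B C σ τ h1 h2 ih1 ih2 =>
    obtain ⟨C₁, C₂, τ', hB, h3, h4⟩ := ih2 hA'
    obtain ⟨D₁, D₂, σ', hA, h5, h6⟩ := ih1 hB
    refine ⟨D₁, D₂, _, hA, h5.comp h3, ?_⟩
    rw [← Mor.comp_assoc, h4, Mor.comp_assoc, h6,
      interchange_id_left _ (h5.ty.cod.trans h3.ty.dom.symm), Mor.comp_assoc]
  | @tensor A B C D σ τ h1 h2 ih1 ih2 =>
    rcases Form.tensor_eq_tensor_prime hx hA' with ⟨E, rfl, rfl⟩ | ⟨E, rfl, rfl⟩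
    · obtain ⟨A₁, A₂, σ', rfl, h3, h4⟩ := ih1 rfl
      refine ⟨A₁, A₂ ⊡ C, σ' ⊠ τ, by simp, by simpa using h3.tensor h2, ?_⟩
      rw [← id_tensor_id, ← Mor.tensor_assoc, interchange (by simp [h1.ty.cod]) (by simp [h2.ty.cod]),
        h4, ← id_tensor_id, ← Mor.tensor_assoc, ← Mor.tensor_assoc,
        interchange (f₁ := Mor.swap A₁ x ⊠ Mor.id A₂) (f₂ := Mor.id C) (by simp [h3.ty.dom])
        (by simp [h2.ty.dom]), Mor.id_comp h2.ty.cod, Mor.comp_id h2.ty.dom]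
    · obtain ⟨C₁, C₂, τ', rfl, h3, h4⟩ := ih2 rfl
      refine ⟨A ⊡ C₁, C₂, σ ⊠ τ', by simp, by simpa using h1.tensor h3, ?_⟩
      have e1 : (Mor.id B ⊠ Mor.swap E x ⊠ Mor.id B₂) ⊚ (σ ⊠ τ) =
          ((σ ⊠ Mor.id x) ⊠ τ') ⊚ (Mor.id A ⊠ Mor.swap C₁ x ⊠ Mor.id C₂) := by
        rw [Mor.tensor_assoc, interchange (by simp [h1.ty.cod]) (by simp [h2.ty.cod]),
          interchange (by simp [h1.ty.dom]) (by simp [h3.ty.dom]), h4, Mor.comp_id h1.ty.dom,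
          Mor.id_comp h1.ty.cod]
      have e2 : (Mor.swap B x ⊠ Mor.id (E ⊡ B₂)) ⊚ ((σ ⊠ Mor.id x) ⊠ τ') =
          (Mor.id x ⊠ σ ⊠ τ') ⊚ (Mor.swap A x ⊠ Mor.id (C₁ ⊡ C₂)) := by
        rw [interchange (by simp [h1.ty.cod]) (by simp [h3.ty.cod]), ← Mor.tensor_assoc,
          interchange (by simp [h1.ty.dom]) (by simp [h3.ty.dom]), Mor.comp_id h3.ty.dom,
          Mor.id_comp h3.ty.cod, swap_natural h1.ty.dom h1.ty.cod (dom_id x) (cod_id x)]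
      rw [swap_tensor_whisker, swap_tensor_whisker, Mor.comp_assoc, e1, ← Mor.comp_assoc, e2,
        Mor.comp_assoc]
  | swap A B =>
    rcases Form.tensor_eq_tensor_prime hx hA' with ⟨E, rfl, rfl⟩ | ⟨E, rfl, rfl⟩
    · refine ⟨A ⊡ B₁, E, Mor.swap A (B₁ ⊡ E), by simp, by simpa using IsPerm.swap A (B₁ ⊡ E), ?_⟩
      rw [← id_tensor_id, ← Mor.tensor_assoc, ← swap_natural (A := A) (A' := A) (B := B₁ ⊡ x ⊡ E)
        (B' := x ⊡ B₁ ⊡ E) rfl rfl (by simp) (by simp), swap_tensor_right, Mor.comp_assoc,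
        swap_tensor_whisker]
    · refine ⟨E, B₂ ⊡ B, Mor.swap (E ⊡ B₂) B, by simp, by simpa using IsPerm.swap (E ⊡ B₂) B, ?_⟩
      rw [swap_tensor_whisker, Mor.comp_assoc, ← swap_natural (A := E ⊡ x ⊡ B₂)
        (A' := x ⊡ E ⊡ B₂) (B := B) (B' := B) (by simp) (by simp) rfl rfl, swap_tensor, Mor.comp_assoc,
        interchange_assoc _ (by simp) (by simp), swap_swap, Mor.id_comp (by simp), id_tensor_id,
        Mor.id_comp (by simp), Mor.tensor_assoc, id_tensor_id]

/-- Coherence for symmetric monoidal categories. Both permutations take the first factor of `B` from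
the same place, because that factor occurs only once; `extract` strips it off, and the rest agrees
by induction. -/
theorem unique {A B : Form L} {σ τ : Mor L} (hσ : IsPerm A B σ) (hτ : IsPerm A B τ)
    (hn : A.fac.Nodup) : σ = τ := by
  induction B using Form.prime_induction generalizing A σ τ with
  | unit =>
    -- The induction needs a variable codomain: all intermediate formulae of a permutation that ends
    -- in `I` are `I` as well.
    have key : ∀ {A B : Form L} {σ}, IsPerm A B σ → B = .unit → σ = Mor.id .unit := by
      intro A B σ h hB
      induction h with
      | id A => rw [hB]
      | comp h1 h2 ih1 ih2 =>
        rw [ih2 hB, ih1 (by have := h2.mfac_eq; rw [hB] at this; exact Form.mfac_eq_zero.1 this),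
          id_comp_id]
      | tensor h1 h2 ih1 ih2 =>
        obtain ⟨h3, h4⟩ := Form.tensor_eq_unit.1 hB
        rw [ih1 h3, ih2 h4, id_unit_tensor]
      | swap A B =>
        obtain ⟨h3, h4⟩ := Form.tensor_eq_unit.1 hB
        rw [h3, h4, swap_unit_left]
    rw [key hσ rfl, key hτ rfl]
  | tensor x G hx ih =>
    obtain ⟨A₁, A₂, σ', rfl, h1, h2⟩ := hσ.extract (B₁ := .unit) (B₂ := G) hx rfl
    obtain ⟨C₁, C₂, τ', hA, h3, h4⟩ := hτ.extract (B₁ := .unit) (B₂ := G) hx rfl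
    obtain ⟨rfl, rfl⟩ := Form.split_unique hx hA hn
    have hn' : (A₁ ⊡ A₂).fac.Nodup := by
      refine hn.sublist ?_
      rw [Form.fac_tensor, Form.fac_tensor, Form.fac_tensor]
      exact (List.sublist_append_right _ _).append_left _
    rw [swap_unit_left, id_tensor_id, Mor.id_comp hσ.ty.cod] at h2
    rw [swap_unit_left, id_tensor_id, Mor.id_comp hτ.ty.cod] at h4
    rw [h2, h4, ih h1 h3 hn']

end IsPerm

/-! ### Transposition and left introduction of implications; cut-free derivations. -/

namespace Mor

/-- The transpose `A ⊢ X → C` of `f : X ⊗ A ⊢ C`. -/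
def cur (X A : Form L) (f : Mor L) : Mor L := imp X f ⊚ eta X A

/-- The left introduction of an implication: `Δ ⊗ (X → C) ⊗ S ⊢ B` obtained from `f : Δ ⊢ X` and
`g : C ⊗ S ⊢ B`. -/
def limp (X C S : Form L) (f g : Mor L) : Mor L :=
  g ⊚ ((eps X C ⊚ (f ⊠ id (X.imp C))) ⊠ id S)

/-- Together with `cur_eps` this is the bijection of the adjunction between `X ⊗ _` and `X → _`. -/
theorem eps_cur {X A C : Form L} {f : Mor L} (h : Ty f (X ⊡ A) C) :
    eps X C ⊚ (id X ⊠ cur X A f) = f := by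
  rw [cur, interchange_id_left _ (by simp [h.dom]), ← comp_assoc, eps_natural X h.dom h.cod,
    comp_assoc, triangle_left, comp_id h.dom]

theorem cur_eps {X A C : Form L} {f : Mor L} (h : Ty f A (X.imp C)) :
    cur X A (eps X C ⊚ (id X ⊠ f)) = f := by
  rw [cur, imp_comp, comp_assoc, ← eta_natural X h.dom h.cod, ← comp_assoc, triangle_right,
    id_comp h.cod]

theorem cur_comp {X A B : Form L} {f σ : Mor L} (h₁ : σ.dom = A) (h₂ : σ.cod = B) :
    cur X B f ⊚ σ = cur X A (f ⊚ (id X ⊠ σ)) := by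
  rw [cur, cur, comp_assoc, eta_natural X h₁ h₂, imp_comp, comp_assoc]

theorem comp_limp (X C S : Form L) (k f g : Mor L) :
    k ⊚ limp X C S f g = limp X C S f (k ⊚ g) := by
  simp [limp]

theorem limp_tensor {X C S : Form L} {f g : Mor L} (k : Mor L) (hg : g.dom = C ⊡ S) :
    limp X C S f g ⊠ k = limp X C (S ⊡ k.dom) f (g ⊠ k) := by
  rw [limp, limp, ← id_tensor_id, ← tensor_assoc, interchange (by simp [hg]) (by simp), comp_id rfl]

/-- A factor on the left stands in front of `Δ ⊗ (X → C)`. It is first moved behind the implication,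
so that it becomes part of the side formula, and in the second premise it is moved back in front of
`C`. -/
theorem tensor_limp {X C S Δ : Form L} {f g : Mor L} (k : Mor L) (hf : f.dom = Δ)
    (hg : g.dom = C ⊡ S) :
    k ⊠ limp X C S f g =
      limp X C (k.dom ⊡ S) f ((k ⊠ g) ⊚ (swap C k.dom ⊠ id S)) ⊚
        (swap k.dom (Δ ⊡ X.imp C) ⊠ id S) := by
  subst hf
  rw [limp, limp, ← id_tensor_id k.dom S]
  generalize he : eps X C ⊚ (f ⊠ id (X.imp C)) = e
  have h1 : e.dom = f.dom ⊡ X.imp C := by simp [← he]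
  have h2 : e.cod = C := by simp [← he]
  rw [← tensor_assoc e, comp_assoc, comp_assoc, interchange (by simp [h1]) (by simp),
    id_comp_id, ← swap_natural (dom_id k.dom) (cod_id k.dom) h1 h2, interchange (by simp) (by simp),
    ← comp_assoc (swap C _), swap_swap, id_comp_id, id_comp (by simp [h2]), tensor_assoc,
    interchange (by simp) (by simp [h2, hg]), comp_id rfl]

theorem limp_comp_right {X C S S' : Form L} {f g σ : Mor L} (hσ : Ty σ S' S) :
    limp X C S f g ⊚ (id (f.dom ⊡ X.imp C) ⊠ σ) = limp X C S' f (g ⊚ (id C ⊠ σ)) := by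
  rw [limp, limp, comp_assoc, interchange (by simp) (by simp [hσ.cod]), comp_assoc g,
    interchange (by simp) (by simp [hσ.dom]), comp_id (A := f.dom ⊡ X.imp C) (by simp),
    id_comp (A := C) (by simp), id_comp hσ.cod, comp_id hσ.dom]

theorem limp_comp_left {X C S : Form L} {f g σ : Mor L} (hσ : f.dom = σ.cod) :
    limp X C S f g ⊚ (σ ⊠ id (X.imp C ⊡ S)) = limp X C S (f ⊚ σ) g := by
  rw [limp, limp, comp_assoc, ← id_tensor_id (X.imp C), ← tensor_assoc,
    interchange (by simp [hσ]) (by simp), comp_assoc, interchange hσ.symm (by simp), id_comp_id,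
    id_comp_id]

end Mor

theorem Ty.cur {X A C : Form L} {f : Mor L} (h : Ty f (X ⊡ A) C) :
    Ty (Mor.cur X A f) A (X.imp C) := by
  constructor <;> simp [Mor.cur, h.ok, h.dom, h.cod]

theorem Ty.limp {X C S Δ B : Form L} {f g : Mor L} (hf : Ty f Δ X) (hg : Ty g (C ⊡ S) B) :
    Ty (Mor.limp X C S f g) (Δ ⊡ X.imp C ⊡ S) B := by
  constructor <;> simp [Mor.limp, hf.ok, hf.dom, hf.cod, hg.ok, hg.dom, hg.cod]

/-- The morphisms that are coded by cut-free derivations. -/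
inductive CutFree : Form L → Form L → Mor L → Prop
  | ax (p : L) : CutFree (.letter p) (.letter p) (Mor.id (.letter p))
  | unit : CutFree .unit .unit (Mor.id .unit)
  | perm {A B Γ : Form L} {f σ : Mor L} : CutFree A B f → IsPerm Γ A σ → CutFree Γ B (f ⊚ σ)
  | tensor {A B C D : Form L} {f g : Mor L} : CutFree A B f → CutFree C D g →
      CutFree (A ⊡ C) (B ⊡ D) (f ⊠ g)
  | cur {X A C : Form L} {f : Mor L} : CutFree (X ⊡ A) C f → CutFree A (X.imp C) (cur X A f)
  | limp {X C S Δ B : Form L} {f g : Mor L} : CutFree Δ X f → CutFree (C ⊡ S) B g →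
      CutFree (Δ ⊡ X.imp C ⊡ S) B (limp X C S f g)

theorem CutFree.ty {A B : Form L} {f : Mor L} (h : CutFree A B f) : Ty f A B := by
  induction h with
  | ax p => exact .id _
  | unit => exact .id _
  | perm _ hσ ih => exact ih.comp hσ.ty
  | tensor _ _ h1 h2 => exact h1.tensor h2
  | cur _ h => exact h.cur
  | limp _ _ h1 h2 => exact h1.limp h2

/-! ### Cut elimination by the method of computability. -/

/-- Closure of a set of morphisms under permutation and left introduction of implications. -/
inductive Closure (S : Form L → Mor L → Prop) : Form L → Mor L → Prop
  | base {Γ : Form L} {f : Mor L} : S Γ f → Closure S Γ f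
  | perm {A Γ : Form L} {f σ : Mor L} : Closure S A f → IsPerm Γ A σ → Closure S Γ (f ⊚ σ)
  | limp {X C D Δ : Form L} {f g : Mor L} : CutFree Δ X f → Closure S (C ⊡ D) g →
      Closure S (Δ ⊡ X.imp C ⊡ D) (limp X C D f g)

/-- Sets of morphisms closed under permutation and left introduction of implications. -/
structure Saturated (T : Form L → Mor L → Prop) : Prop where
  dom {Γ : Form L} {f : Mor L} : T Γ f → f.dom = Γ
  perm {A Γ : Form L} {f σ : Mor L} : T A f → IsPerm Γ A σ → T Γ (f ⊚ σ)
  limp {X C D Δ : Form L} {f g : Mor L} : CutFree Δ X f → T (C ⊡ D) g →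
      T (Δ ⊡ X.imp C ⊡ D) (Mor.limp X C D f g)

theorem Closure.elim {S T : Form L → Mor L → Prop} (hT : Saturated T)
    (h : ∀ Γ f, S Γ f → T Γ f) {Γ : Form L} {f : Mor L} (hf : Closure S Γ f) : T Γ f := by
  induction hf with
  | base hf => exact h _ _ hf
  | perm _ hσ ih => exact hT.perm ih hσ
  | limp hf _ ih => exact hT.limp hf ih

theorem saturated_ty (B : Form L) : Saturated fun Γ f => Ty f Γ B where
  dom h := h.dom
  perm h hσ := h.comp hσ.ty
  limp h hg := h.ty.limp hg

theorem saturated_cutFree (B : Form L) : Saturated fun Γ f => CutFree Γ B f where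
  dom h := h.ty.dom
  perm := .perm
  limp := .limp

namespace Saturated

variable {T : Form L → Mor L → Prop}

/-- Composition with a fixed morphism and tensoring with one commute with permutations and left
introductions. These lemmas supply the target predicates for inductions over a closure in which one
component is kept fixed. -/
theorem comp (hT : Saturated T) (k : Mor L) : Saturated fun Γ f => T Γ (k ⊚ f) where
  dom h := by simpa using hT.dom h
  perm h hσ := by simpa using hT.perm h hσ
  limp hf hg := by simpa only [comp_limp] using hT.limp hf hg

theorem tensor_right (hT : Saturated T) (k : Mor L) :
    Saturated fun Γ f => f.dom = Γ ∧ T (Γ ⊡ k.dom) (f ⊠ k) where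
  dom h := h.1
  perm := by
    rintro A Γ f σ ⟨h1, h2⟩ hσ
    refine ⟨by simp [hσ.ty.dom], ?_⟩
    have h3 := hT.perm h2 (hσ.tensor (.id k.dom))
    rwa [interchange (by simp [hσ.ty.cod, h1]) (by simp), comp_id rfl] at h3
  limp := by
    rintro X C D Δ f g hf ⟨h1, h2⟩
    refine ⟨by simp [Mor.limp, hf.ty.dom], ?_⟩
    rw [limp_tensor k h1]
    simpa using hT.limp (D := D ⊡ k.dom) hf (by simpa using h2)

theorem tensor_left (hT : Saturated T) (k : Mor L) :
    Saturated fun Γ f => f.dom = Γ ∧ T (k.dom ⊡ Γ) (k ⊠ f) where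
  dom h := h.1
  perm := by
    rintro A Γ f σ ⟨h1, h2⟩ hσ
    refine ⟨by simp [hσ.ty.dom], ?_⟩
    have h3 := hT.perm h2 ((IsPerm.id k.dom).tensor hσ)
    rwa [interchange (by simp) (by simp [hσ.ty.cod, h1]), comp_id rfl] at h3
  limp := by
    rintro X C D Δ f g hf ⟨h1, h2⟩
    refine ⟨by simp [Mor.limp, hf.ty.dom], ?_⟩
    rw [tensor_limp k hf.ty.dom h1]
    have h3 := hT.perm (Γ := C ⊡ k.dom ⊡ D) h2
      (by simpa using (IsPerm.swap C k.dom).tensor (.id D))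
    refine hT.perm (hT.limp hf h3) ?_
    simpa using (IsPerm.swap k.dom (Δ ⊡ X.imp C)).tensor (.id D)

end Saturated

/-- The computable morphisms into a formula. -/
def Computable : Form L → Form L → Mor L → Prop
  | .unit => Closure fun Γ f => Γ = .unit ∧ f = Mor.id .unit
  | .letterTensor p G => Closure fun Γ f => ∃ Γ' f', Computable G Γ' f' ∧
      Γ = .letter p ⊡ Γ' ∧ f = Mor.id (.letter p) ⊠ f'
  -- The recursion is on the formula: `f₁` must send computable arguments to computable values. The
  -- closure lets permutations and left introductions act on the tensor product as a whole.
  | .impTensor X C G => Closure fun Γ f => ∃ Γ₁ f₁ Γ₂ f₂,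
      (Ty f₁ Γ₁ (X.imp C) ∧ ∀ Δ a, Computable X Δ a →
        Computable C (Δ ⊡ Γ₁) (eps X C ⊚ (a ⊠ f₁))) ∧
      Computable G Γ₂ f₂ ∧ Γ = Γ₁ ⊡ Γ₂ ∧ f = f₁ ⊠ f₂

namespace Computable

theorem ty {B Γ : Form L} {f : Mor L} (h : Computable B Γ f) : Ty f Γ B := by
  induction B generalizing Γ f with
  | unit =>
    refine h.elim (saturated_ty _) ?_
    rintro _ _ ⟨rfl, rfl⟩
    exact .id _
  | letterTensor p G ih =>
    refine h.elim (saturated_ty _) ?_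
    rintro _ _ ⟨Γ', f', hf, rfl, rfl⟩
    exact (Ty.id _).tensor (ih hf)
  | impTensor X C G _ _ ih =>
    refine h.elim (saturated_ty _) ?_
    rintro _ _ ⟨Γ₁, f₁, Γ₂, f₂, ⟨hf, -⟩, hg, rfl, rfl⟩
    exact hf.tensor (ih hg)

theorem saturated (B : Form L) : Saturated (Computable B) where
  dom h := h.ty.dom
  perm h hσ := by cases B <;> exact .perm h hσ
  limp hf hg := by cases B <;> exact .limp hf hg

/-- The prime factors of `A` are peeled off one by one; the component of a peeled factor is kept as
a fixed left factor by `Saturated.tensor_left`. -/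
theorem tensor_elim {A B : Form L} {T : Form L → Mor L → Prop} (hT : Saturated T)
    (h : ∀ Γ a Δ b, Computable A Γ a → Computable B Δ b → T (Γ ⊡ Δ) (a ⊠ b)) {Γ : Form L}
    {f : Mor L} (hf : Computable (A ⊡ B) Γ f) : T Γ f := by
  induction A generalizing T Γ f with
  | unit => simpa using h .unit (Mor.id .unit) Γ f (.base ⟨rfl, rfl⟩) hf
  | letterTensor p G ih =>
    refine Closure.elim hT ?_ hf
    rintro _ _ ⟨Γ', f', hf', rfl, rfl⟩
    refine (ih (hT.tensor_left (Mor.id (.letter p))) ?_ hf').2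
    intro Γ a Δ b ha hb
    refine ⟨by simp [ha.ty.dom, hb.ty.dom], ?_⟩
    simpa using h (.letter p ⊡ Γ) (Mor.id (.letter p) ⊠ a) Δ b (.base ⟨_, _, ha, rfl, rfl⟩) hb
  | impTensor X C G _ _ ih =>
    refine Closure.elim hT ?_ hf
    rintro _ _ ⟨Γ₁, f₁, Γ₂, f₂, hf₁, hf₂, rfl, rfl⟩
    have := (ih (hT.tensor_left f₁) ?_ hf₂).2
    · rwa [hf₁.1.dom] at this
    intro Γ a Δ b ha hb
    refine ⟨by simp [ha.ty.dom, hb.ty.dom], ?_⟩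
    simpa [hf₁.1.dom] using
      h (Γ₁ ⊡ Γ) (f₁ ⊠ a) Δ b (.base ⟨_, _, _, _, hf₁, ha, rfl, rfl⟩) hb

theorem tensor {A B Γ Δ : Form L} {a b : Mor L} (ha : Computable A Γ a) (hb : Computable B Δ b) :
    Computable (A ⊡ B) (Γ ⊡ Δ) (a ⊠ b) := by
  induction A generalizing Γ a with
  | unit =>
    have := (Closure.elim ((saturated B).tensor_right b) ?_ ha).2
    · rwa [hb.ty.dom] at this
    rintro _ _ ⟨rfl, rfl⟩
    exact ⟨rfl, by simpa [hb.ty.dom] using hb⟩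
  | letterTensor p G ih =>
    have := (Closure.elim ((saturated (.letterTensor p G ⊡ B)).tensor_right b) ?_ ha).2
    · rwa [hb.ty.dom] at this
    rintro _ _ ⟨Γ', f', hf, rfl, rfl⟩
    refine ⟨by simp [hf.ty.dom], ?_⟩
    simp only [hb.ty.dom, Form.tensor_assoc, Mor.tensor_assoc]
    exact .base ⟨_, _, ih hf, rfl, rfl⟩
  | impTensor X C G _ _ ih =>
    have := (Closure.elim ((saturated (.impTensor X C G ⊡ B)).tensor_right b) ?_ ha).2
    · rwa [hb.ty.dom] at this
    rintro _ _ ⟨Γ₁, f₁, Γ₂, f₂, hf₁, hf₂, rfl, rfl⟩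
    refine ⟨by simp [hf₁.1.dom, hf₂.ty.dom], ?_⟩
    simp only [hb.ty.dom, Form.tensor_assoc, Mor.tensor_assoc]
    exact .base ⟨_, _, _, _, hf₁, ih hf₂, rfl, rfl⟩

/-- For a single implication the closure in the definition adds nothing: application to a fixed
argument commutes with permutations and left introductions, and the computable morphisms into `C`
are closed under both. -/
theorem imp_iff {X C Γ : Form L} {f : Mor L} :
    Computable (X.imp C) Γ f ↔ Ty f Γ (X.imp C) ∧
      ∀ Δ a, Computable X Δ a → Computable C (Δ ⊡ Γ) (eps X C ⊚ (a ⊠ f)) := by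
  constructor
  · intro h
    refine ⟨h.ty, fun Δ a ha => ?_⟩
    have hs := ((saturated C).comp (eps X C)).tensor_left a
    have := (Closure.elim hs ?_ h).2
    · rwa [ha.ty.dom] at this
    rintro _ _ ⟨Γ₁, f₁, Γ₂, f₂, hf₁, hf₂, rfl, rfl⟩
    have := (Closure.elim (hs.tensor_left f₁) ?_ hf₂).2
    · rwa [hf₁.1.dom] at this
    rintro _ _ ⟨rfl, rfl⟩
    simpa [hf₁.1.dom, ha.ty.dom] using hf₁.2 Δ a ha
  · intro h
    exact .base ⟨Γ, f, .unit, Mor.id .unit, h, .base ⟨rfl, rfl⟩, by simp, by simp⟩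

/-- The fundamental lemma of the method, by induction on terms. A composite of terms needs only two
uses of the induction hypothesis, and this is how cuts disappear. The cases of `η`, `ε` and `A → f`
use a triangular equation, the definition for implications, and naturality of `ε`. -/
theorem comp {t : Term L} (ht : t.WellFormed) {Γ : Form L} {a : Mor L}
    (ha : Computable t.dom Γ a) : Computable t.cod Γ (mk t ⊚ a) := by
  induction t generalizing Γ a with
  | id A => rwa [← Mor.id, Mor.id_comp (A := A) ha.ty.cod]
  | swap A B =>
    refine tensor_elim ((saturated _).comp _) ?_ ha
    intro Γ a Δ b ha hb
    rw [← Mor.swap, swap_natural ha.ty.dom ha.ty.cod hb.ty.dom hb.ty.cod]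
    exact (saturated _).perm (tensor hb ha) (.swap _ _)
  | eta A B =>
    refine imp_iff.2 ⟨?_, fun Δ b hb => ?_⟩
    · exact Ty.comp ⟨trivial, rfl, rfl⟩ ha.ty
    · rw [← Mor.eta]
      have : b ⊠ (Mor.eta A B ⊚ a) = (Mor.id A ⊠ Mor.eta A B) ⊚ (b ⊠ a) := by
        rw [interchange hb.ty.cod ha.ty.cod, Mor.id_comp hb.ty.cod]
      rw [this, ← Mor.comp_assoc, triangle_left, Mor.id_comp (by simp [ha.ty.cod, hb.ty.cod, Term.dom])]
      exact tensor hb ha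
  | eps A B =>
    refine tensor_elim ((saturated _).comp _) ?_ ha
    intro Γ a Δ b ha hb
    exact (imp_iff.1 hb).2 _ _ ha
  | comp g f ihg ihf =>
    obtain ⟨h1, h2, h3⟩ := ht
    rw [mk_comp, Mor.comp_assoc]
    exact ihg h1 (h3 ▸ ihf h2 ha)
  | tensor f g ihf ihg =>
    refine tensor_elim ((saturated _).comp _) ?_ ha
    intro Γ a Δ b ha hb
    rw [mk_tensor, interchange (by simp [ha.ty.cod]) (by simp [hb.ty.cod])]
    exact tensor (ihf ht.1 ha) (ihg ht.2 hb)
  | imp A f ih =>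
    refine imp_iff.2 ⟨?_, fun Δ b hb => ?_⟩
    · exact Ty.comp ⟨ht, rfl, rfl⟩ ha.ty
    · have : b ⊠ (mk (.imp A f) ⊚ a) = (Mor.id A ⊠ Mor.imp A (mk f)) ⊚ (b ⊠ a) := by
        rw [interchange hb.ty.cod ha.ty.cod, Mor.id_comp hb.ty.cod, mk_imp]
      rw [this, ← Mor.comp_assoc]
      change Computable _ _ ((Mor.eps A f.cod ⊚ _) ⊚ _)
      rw [eps_natural A (dom_mk f) (cod_mk f), Mor.comp_assoc]
      exact ih ht ((imp_iff.1 ha).2 _ _ hb)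

/-- The two claims need each other at an implication. The identity of `X → C` is computable because
computable arguments are cut-free and can be used in a left introduction; a computable morphism into
`X → C` is cut-free because it can be applied to the identity of `X` and transposed back. -/
theorem id_and_cutFree (B : Form L) :
    Computable B B (Mor.id B) ∧ ∀ Γ f, Computable B Γ f → CutFree Γ B f := by
  induction B with
  | unit =>
    refine ⟨.base ⟨rfl, rfl⟩, fun Γ f => Closure.elim (saturated_cutFree _) ?_⟩
    rintro _ _ ⟨rfl, rfl⟩
    exact .unit
  | letterTensor p G ih =>
    refine ⟨.base ⟨G, Mor.id G, ih.1, rfl, (id_tensor_id (.letter p) G).symm⟩,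
      fun Γ f => Closure.elim (saturated_cutFree _) ?_⟩
    rintro _ _ ⟨Γ', f', hf', rfl, rfl⟩
    exact .tensor (.ax p) (ih.2 _ _ hf')
  | impTensor X C G ihX ihC ihG =>
    refine ⟨.base ⟨X.imp C, Mor.id _, G, Mor.id G, ⟨.id _, fun Δ a ha => ?_⟩, ihG.1, rfl,
      (id_tensor_id (X.imp C) G).symm⟩, fun Γ f => Closure.elim (saturated_cutFree _) ?_⟩
    · have := (saturated C).limp (D := .unit) (C := C) (g := Mor.id C) (ihX.2 _ _ ha)
        (by simpa using ihC.1)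
      simpa [Mor.limp, Mor.id_comp] using this
    rintro _ _ ⟨Γ₁, f₁, Γ₂, f₂, hf₁, hf₂, rfl, rfl⟩
    refine .tensor (B := X.imp C) ?_ (ihG.2 _ _ hf₂)
    rw [← cur_eps hf₁.1]
    exact .cur (ihC.2 _ _ (hf₁.2 _ _ ihX.1))

end Computable

/-- Cut elimination. -/
theorem Ty.cutFree {A B : Form L} {f : Mor L} (h : Ty f A B) : CutFree A B f := by
  induction f using Quotient.ind with
  | _ t =>
    obtain ⟨h1, rfl, rfl⟩ := h
    have := Computable.comp h1 (Computable.id_and_cutFree t.dom).1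
    rw [Mor.comp_id (dom_mk t)] at this
    exact (Computable.id_and_cutFree _).2 _ _ this

/-! ### Reduced formulae and the letters that occur in them. -/

namespace Form

/-- A formula is reduced when `I` does not occur in it as a side of an implication. -/
def Reduced : Form L → Prop
  | unit => True
  | letterTensor _ G => Reduced G
  | impTensor X C G => X ≠ unit ∧ C ≠ unit ∧ Reduced X ∧ Reduced C ∧ Reduced G

/-- The multiset of occurrences of letters. -/
def letters : Form L → Multiset L
  | unit => 0
  | letterTensor p G => p ::ₘ letters G
  | impTensor X C G => letters X + letters C + letters G

/-- The number of letters and implications. -/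
def weight : Form L → ℕ
  | unit => 0
  | letterTensor _ G => 1 + weight G
  | impTensor X C G => 1 + weight X + weight C + weight G

@[simp] theorem letters_unit : letters (unit : Form L) = 0 := rfl

@[simp] theorem letters_letter (p : L) : letters (letter p) = {p} := rfl

@[simp] theorem letters_imp (X C : Form L) : letters (imp X C) = letters X + letters C := by
  simp [imp, letters]

@[simp] theorem reduced_letter (p : L) : Reduced (letter p) := trivial

@[simp] theorem weight_letter (p : L) : weight (letter p) = 1 := rfl

@[simp] theorem reduced_unit : Reduced (unit : Form L) := trivial

@[simp] theorem reduced_imp {X C : Form L} :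
    Reduced (imp X C) ↔ X ≠ unit ∧ C ≠ unit ∧ Reduced X ∧ Reduced C := by
  simp [imp, Reduced]

@[simp] theorem weight_imp (X C : Form L) : weight (imp X C) = 1 + weight X + weight C := by
  simp [imp, weight]

theorem letters_eq (A : Form L) : A.letters = A.mfac.bind letters := by
  induction A with
  | unit => rfl
  | letterTensor p G ih =>
    change _ = (letter p ⊡ G).mfac.bind _
    simp [letters, ih]
  | impTensor X C G _ _ ih =>
    change _ = (imp X C ⊡ G).mfac.bind _
    simp [letters, ih]

theorem reduced_iff (A : Form L) : A.Reduced ↔ ∀ x ∈ A.mfac, x.Reduced := by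
  induction A with
  | unit => simp
  | letterTensor p G ih =>
    change _ ↔ ∀ x ∈ (letter p ⊡ G).mfac, _
    simp [Reduced, ih]
  | impTensor X C G _ _ ih =>
    change _ ↔ ∀ x ∈ (imp X C ⊡ G).mfac, _
    simp [Reduced, ih, and_assoc]

theorem weight_eq (A : Form L) : A.weight = (A.mfac.map weight).sum := by
  induction A with
  | unit => simp [weight]
  | letterTensor p G ih =>
    change _ = ((letter p ⊡ G).mfac.map _).sum
    simp [weight, ih]
  | impTensor X C G _ _ ih =>
    change _ = ((imp X C ⊡ G).mfac.map _).sum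
    simp [weight, ih]

@[simp] theorem letters_tensor (A B : Form L) : (A ⊡ B).letters = A.letters + B.letters := by
  simp [letters_eq (A ⊡ B), letters_eq A, letters_eq B]

@[simp] theorem reduced_tensor {A B : Form L} : (A ⊡ B).Reduced ↔ A.Reduced ∧ B.Reduced := by
  simp only [reduced_iff (A ⊡ B), reduced_iff A, reduced_iff B, mfac_tensor, Multiset.mem_add]
  exact ⟨fun h => ⟨fun x hx => h x (.inl hx), fun x hx => h x (.inr hx)⟩,
    fun h x hx => hx.elim (h.1 x) (h.2 x)⟩

theorem letters_congr {A B : Form L} (h : A.mfac = B.mfac) : A.letters = B.letters := by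
  rw [letters_eq, h, ← letters_eq]

theorem reduced_congr {A B : Form L} (h : A.mfac = B.mfac) : A.Reduced ↔ B.Reduced := by
  rw [reduced_iff, h, ← reduced_iff]

theorem weight_congr {A B : Form L} (h : A.mfac = B.mfac) : A.weight = B.weight := by
  rw [weight_eq, h, ← weight_eq]

@[simp] theorem weight_tensor (A B : Form L) : (A ⊡ B).weight = A.weight + B.weight := by
  simp [weight_eq (A ⊡ B), weight_eq A, weight_eq B]

theorem weight_pos {A : Form L} (h : A ≠ unit) : 0 < A.weight := by
  cases A with
  | unit => exact absurd rfl h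
  | letterTensor p G => simp [weight]
  | impTensor X C G => simp [weight]

/-- Going repeatedly to the left side of the first implication never ends in `I`, so it ends in a
letter. -/
theorem Reduced.exists_mem {A : Form L} (h : A.Reduced) (hA : A ≠ unit) : ∃ p, p ∈ A.letters := by
  induction A with
  | unit => exact absurd rfl hA
  | letterTensor p G => exact ⟨p, by simp [letters]⟩
  | impTensor X C G ih _ _ =>
    obtain ⟨p, hp⟩ := ih h.2.2.1 h.1
    exact ⟨p, by simp [letters, hp]⟩

theorem letters_of_add {A B C : Form L} (h : A.mfac = B.mfac + C.mfac) :
    A.letters = B.letters + C.letters := by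
  rw [← letters_tensor]
  exact letters_congr (by simpa using h)

theorem mem_letters_of_add {A B C : Form L} (h : A.mfac = B.mfac + C.mfac) (p : L) :
    p ∈ A.letters ↔ p ∈ B.letters ∨ p ∈ C.letters := by
  simp [letters_of_add h]

theorem mem_letters_of_cons {A B X C : Form L} (h : A.mfac = X.imp C ::ₘ B.mfac) (p : L) :
    p ∈ A.letters ↔ (p ∈ X.letters ∨ p ∈ C.letters) ∨ p ∈ B.letters := by
  rw [mem_letters_of_add (B := X.imp C) (C := B) (by simpa using h)]
  simp

theorem Reduced.left {A B C : Form L} (hA : A.Reduced) (h : A.mfac = B.mfac + C.mfac) :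
    B.Reduced ∧ C.Reduced := by
  rw [← reduced_tensor]
  exact (reduced_congr (by simpa using h)).1 hA

/-- No letter occurs in both formulae. -/
def Apart (A B : Form L) : Prop := ∀ p ∈ A.letters, p ∉ B.letters

end Form

/-- A group of factors that shares no letters with the rest of a derivable sequent is empty. -/
theorem CutFree.eq_unit_of_apart {Γ B : Form L} {f : Mor L} (h : CutFree Γ B f) (hΓ : Γ.Reduced)
    (hB : B.Reduced) {E G : Form L} (hm : Γ.mfac = E.mfac + G.mfac) (hd : E.Apart (G ⊡ B)) :
    E = .unit := by
  induction h generalizing E G with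
  | ax p =>
    by_contra hE
    obtain ⟨q, hq⟩ := (hΓ.left hm).1.exists_mem hE
    have := (Form.mem_letters_of_add hm q).2 (.inl hq)
    have := hd q hq
    simp_all
  | unit =>
    rw [Form.mfac_unit, eq_comm, add_eq_zero] at hm
    exact Form.mfac_eq_zero.1 hm.1
  | @perm A B Γ f σ h hσ ih =>
    rw [hσ.mfac_eq] at hm
    exact ih ((Form.reduced_congr hσ.mfac_eq).1 hΓ) hB hm hd
  | @tensor A B C D f g h1 h2 ih1 ih2 =>
    simp only [Form.reduced_tensor, Form.mfac_tensor] at hΓ hB hm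
    obtain ⟨AE, AG, CE, CG, e1, e2, e3, e4⟩ := Form.exists_refinement hm
    have l3 := Form.mem_letters_of_add e3
    have l4 := Form.mem_letters_of_add e4
    have d1 := ih1 hΓ.1 hB.1 e1 (by
      intro p; have := hd p; simp [l3, l4] at this ⊢; tauto)
    have d2 := ih2 hΓ.2 hB.2 e2 (by
      intro p; have := hd p; simp [l3, l4] at this ⊢; tauto)
    simpa [d1, d2] using e3
  | @cur X A C f h ih =>
    simp only [Form.reduced_imp] at hB
    refine ih (G := X ⊡ G) (by simp [hΓ, hB]) hB.2.2.2 (by simp [hm, add_left_comm]) ?_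
    intro p; have := hd p; simp at this ⊢; tauto
  | @limp X C S Δ B f g h1 h2 ih1 ih2 =>
    simp only [Form.reduced_tensor, Form.reduced_imp, Form.mfac_tensor, Form.mfac_imp] at hΓ hm
    obtain ⟨rΔ, ⟨rX, rC, rX', rC'⟩, rS⟩ := hΓ
    have hi : X.imp C ∈ E.mfac + G.mfac := by rw [← hm]; simp
    rcases Multiset.mem_add.1 hi with hi | hi
    -- If the principal implication belongs to `E`, then `C` with the share of `S` in `E` is a group
    -- apart in the second premise. Hence `C` would be `I`, which reducedness forbids.
    · obtain ⟨E₀, hE⟩ := Form.exists_mfac_of_mem hi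
      have hm' : Δ.mfac + S.mfac = E₀.mfac + G.mfac := by
        rw [hE, Multiset.singleton_add, Multiset.add_cons, Multiset.cons_add] at hm
        exact (Multiset.cons_inj_right _).1 hm
      obtain ⟨ΔE, ΔG, SE, SG, e1, e2, e3, e4⟩ := Form.exists_refinement hm'
      have l := Form.mem_letters_of_cons hE
      have l3 := Form.mem_letters_of_add e3
      have l4 := Form.mem_letters_of_add e4
      have := ih2 (E := C ⊡ SE) (G := SG) (by simp [*]) hB (by simp [e2, add_assoc]) (by
        intro p; have := hd p; simp [l, l3, l4] at this ⊢; tauto)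
      exact absurd (Form.tensor_eq_unit.1 this).1 rC
    -- Otherwise `X` and `C` belong to the rest, and the shares of `E` in the two premises are empty
    -- by induction.
    · obtain ⟨G₀, hG⟩ := Form.exists_mfac_of_mem hi
      have hm' : Δ.mfac + S.mfac = E.mfac + G₀.mfac := by
        rw [hG, Multiset.singleton_add, Multiset.add_cons, Multiset.add_cons] at hm
        exact (Multiset.cons_inj_right _).1 hm
      obtain ⟨ΔE, ΔG, SE, SG, e1, e2, e3, e4⟩ := Form.exists_refinement hm'
      have l := Form.mem_letters_of_cons hG
      have l3 := Form.mem_letters_of_add e3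
      have l4 := Form.mem_letters_of_add e4
      have d1 := ih1 rΔ rX' e1 (by
        intro p; have := hd p; simp [l, l3, l4] at this ⊢; tauto)
      have d2 := ih2 (E := SE) (G := C ⊡ SG) (by simp [*]) hB (by simp [e2, add_left_comm]) (by
        intro p; have := hd p; simp [l, l3, l4] at this ⊢; tauto)
      simpa [d1, d2] using e3

/-- The two ways in which a further factor `y` can be placed in a decomposition of a context. -/
theorem Form.cons_add_cases {D E G : Form L} {y : Form L}
    (h : y ::ₘ D.mfac = E.mfac + G.mfac) :
    (∃ E₀ : Form L, E.mfac = y ::ₘ E₀.mfac ∧ D.mfac = E₀.mfac + G.mfac) ∨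
      ∃ G₀ : Form L, G.mfac = y ::ₘ G₀.mfac ∧ D.mfac = E.mfac + G₀.mfac := by
  have hi : y ∈ E.mfac + G.mfac := by rw [← h]; simp
  rcases Multiset.mem_add.1 hi with hi | hi
  · obtain ⟨E₀, hE⟩ := Form.exists_mfac_of_mem hi
    refine .inl ⟨E₀, hE, ?_⟩
    rw [hE, Multiset.cons_add] at h
    exact (Multiset.cons_inj_right _).1 h
  · obtain ⟨G₀, hG⟩ := Form.exists_mfac_of_mem hi
    refine .inr ⟨G₀, hG, ?_⟩
    rw [hG, Multiset.add_cons] at h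
    exact (Multiset.cons_inj_right _).1 h

/-! ### Sequents with at most two occurrences of each letter; splitting along a tensor product. -/

section Good

variable [DecidableEq L]

/-- Sequents of reduced formulae in which no letter occurs more than twice. -/
structure Good (Γ B : Form L) : Prop where
  left : Γ.Reduced
  right : B.Reduced
  count_le (p : L) : Γ.letters.count p + B.letters.count p ≤ 2

/-- If a factor `x` occurred twice, the two copies would use up both permitted occurrences of every
letter of `x`. The group `x ⊗ x` would then be apart from the rest, hence empty. -/
theorem CutFree.nodup {Γ B : Form L} {f : Mor L} (h : CutFree Γ B f) (hg : Good Γ B) :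
    Γ.fac.Nodup := by
  rw [← Multiset.coe_nodup, Multiset.nodup_iff_le]
  intro x hx
  obtain ⟨m, hm⟩ := Multiset.le_iff_exists_add.1 hx
  have hm : Γ.mfac = x ::ₘ x ::ₘ m := by rw [Form.mfac, hm]; simp
  have hx : x.IsPrime := Form.isPrime_of_mem_fac (A := Γ) (Form.mem_mfac.1 (by simp [hm]))
  obtain ⟨A, hA⟩ := Form.exists_mfac_of_mem (x := x) (A := Γ) (by simp [hm])
  obtain ⟨G, hG⟩ := Form.exists_mfac_of_mem (x := x) (A := A) (by
    have : A.mfac = x ::ₘ m := (Multiset.cons_inj_right x).1 (hA.symm.trans hm)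
    simp [this])
  have hΓ : Γ.mfac = (x ⊡ x).mfac + G.mfac := by
    simp [hA, hG, hx.mfac]
  have hl := Form.letters_of_add hΓ
  have := h.eq_unit_of_apart hg.left hg.right hΓ (by
    intro p hp hq
    have h2 := hg.count_le p
    simp only [hl, Form.letters_tensor, Multiset.count_add] at h2
    simp only [Form.letters_tensor, Multiset.mem_add, or_self] at hp hq
    have h3 := Multiset.count_pos.2 hp
    rcases hq with hq | hq
    · have := Multiset.count_pos.2 hq; omega
    · have := Multiset.count_pos.2 hq; omega)
  exact hx.ne_unit (Form.tensor_eq_unit.1 this).1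

theorem Good.congr {Γ Δ B : Form L} (hg : Good Γ B) (h : Γ.mfac = Δ.mfac) : Good Δ B :=
  ⟨(Form.reduced_congr h).1 hg.left, hg.right, by
    rw [← Form.letters_congr h]; exact hg.count_le⟩

theorem Good.of_tensor {A B C D : Form L} (hg : Good (A ⊡ C) (B ⊡ D)) : Good A B ∧ Good C D := by
  obtain ⟨h1, h2, h3⟩ := hg
  simp only [Form.reduced_tensor, Form.letters_tensor, Multiset.count_add] at h1 h2 h3
  exact ⟨⟨h1.1, h2.1, fun p => by have := h3 p; omega⟩,
    ⟨h1.2, h2.2, fun p => by have := h3 p; omega⟩⟩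

theorem Good.of_cur {A X C : Form L} (hg : Good A (X.imp C)) : Good (X ⊡ A) C := by
  obtain ⟨h1, h2, h3⟩ := hg
  simp only [Form.reduced_imp, Form.letters_imp, Multiset.count_add] at h1 h2 h3
  exact ⟨by simp [h1, h2], h2.2.2.2, fun p => by
    have := h3 p; simp only [Form.letters_tensor, Multiset.count_add]; omega⟩

theorem Good.of_limp {Δ X C S B : Form L} (hg : Good (Δ ⊡ X.imp C ⊡ S) B) :
    Good Δ X ∧ Good (C ⊡ S) B := by
  obtain ⟨h1, h2, h3⟩ := hg
  simp only [Form.reduced_tensor, Form.reduced_imp, Form.letters_tensor, Form.letters_imp,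
    Multiset.count_add] at h1 h2 h3
  exact ⟨⟨h1.1, h1.2.1.2.2.1, fun p => by have := h3 p; omega⟩,
    ⟨by simp [h1], h2, fun p => by
      have := h3 p; simp only [Form.letters_tensor, Multiset.count_add]; omega⟩⟩

end Good

namespace Mor

theorem tensor_limp' {X C S Δ : Form L} {f g : Mor L} (k : Mor L) (hf : f.dom = Δ)
    (hg : g.dom = C ⊡ S) :
    limp X C (k.dom ⊡ S) f ((k ⊠ g) ⊚ (swap C k.dom ⊠ id S)) =
      (k ⊠ limp X C S f g) ⊚ (swap (Δ ⊡ X.imp C) k.dom ⊠ id S) := by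
  rw [tensor_limp k hf hg, comp_assoc, interchange (f₁ := swap (Δ ⊡ X.imp C) k.dom) (by simp)
    (by simp), swap_swap, id_comp_id, id_tensor_id, comp_id (by simp [limp, hf])]

end Mor

/-- `f` is a tensor product `Γ₁ ⊗ Γ₂ ⊢ B₁ ⊗ B₂`, up to a permutation of the factors on the left. -/
def SplitsTensor (f : Mor L) (Γ Γ₁ Γ₂ B₁ B₂ : Form L) : Prop :=
  ∃ f₁ f₂ σ, Ty f₁ Γ₁ B₁ ∧ Ty f₂ Γ₂ B₂ ∧ IsPerm Γ (Γ₁ ⊡ Γ₂) σ ∧ f = (f₁ ⊠ f₂) ⊚ σ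

/-- Only the multisets of factors matter, as a reordering can be moved between the components and
the permutation. The cases of `CutFree.splitsTensor` may therefore produce any convenient order. -/
theorem SplitsTensor.congr {f : Mor L} {Γ Γ₁ Γ₂ Δ₁ Δ₂ B₁ B₂ : Form L}
    (h : SplitsTensor f Γ Γ₁ Γ₂ B₁ B₂) (h₁ : Γ₁.mfac = Δ₁.mfac) (h₂ : Γ₂.mfac = Δ₂.mfac) :
    SplitsTensor f Γ Δ₁ Δ₂ B₁ B₂ := by
  obtain ⟨f₁, f₂, σ, t1, t2, hσ, rfl⟩ := h
  obtain ⟨α, hα⟩ := IsPerm.exists_of_mfac_eq h₁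
  obtain ⟨α', hα', e1, -⟩ := hα.exists_inv
  obtain ⟨β, hβ⟩ := IsPerm.exists_of_mfac_eq h₂
  obtain ⟨β', hβ', e2, -⟩ := hβ.exists_inv
  refine ⟨f₁ ⊚ α', f₂ ⊚ β', (α ⊠ β) ⊚ σ, t1.comp hα'.ty, t2.comp hβ'.ty, hσ.comp (hα.tensor hβ), ?_⟩
  rw [← comp_assoc, interchange (by simp [hα.ty.cod, hα'.ty.dom]) (by simp [hβ.ty.cod, hβ'.ty.dom]),
    comp_assoc, comp_assoc, e1, e2, comp_id t1.dom, comp_id t2.dom]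

theorem SplitsTensor.comp {f σ : Mor L} {Γ Δ Γ₁ Γ₂ B₁ B₂ : Form L}
    (h : SplitsTensor f Γ Γ₁ Γ₂ B₁ B₂) (hσ : IsPerm Δ Γ σ) :
    SplitsTensor (f ⊚ σ) Δ Γ₁ Γ₂ B₁ B₂ := by
  obtain ⟨f₁, f₂, τ, t1, t2, hτ, rfl⟩ := h
  exact ⟨f₁, f₂, τ ⊚ σ, t1, t2, hσ.comp hτ, by simp⟩

theorem SplitsTensor.of_unit_left {Γ Γ₁ Γ₂ B : Form L} {f : Mor L} (h : CutFree Γ B f)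
    (hΓ : Γ.Reduced) (hB : B.Reduced) (hm : Γ.mfac = Γ₁.mfac + Γ₂.mfac)
    (hd : Γ₁.Apart (Γ₂ ⊡ B)) : SplitsTensor f Γ Γ₁ Γ₂ .unit B := by
  obtain rfl := h.eq_unit_of_apart hΓ hB hm hd
  refine SplitsTensor.congr (Γ₁ := .unit) (Γ₂ := Γ) ?_ rfl (by simpa using hm)
  exact ⟨Mor.id .unit, f, Mor.id Γ, .id _, h.ty, .id _, by simp [comp_id h.ty.dom]⟩

theorem SplitsTensor.of_unit_right {Γ Γ₁ Γ₂ B : Form L} {f : Mor L} (h : CutFree Γ B f)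
    (hΓ : Γ.Reduced) (hB : B.Reduced) (hm : Γ.mfac = Γ₁.mfac + Γ₂.mfac)
    (hd : Γ₂.Apart (Γ₁ ⊡ B)) : SplitsTensor f Γ Γ₁ Γ₂ B .unit := by
  obtain rfl := h.eq_unit_of_apart hΓ hB (hm.trans (add_comm _ _)) hd
  refine SplitsTensor.congr (Γ₁ := Γ) (Γ₂ := .unit) ?_ (by simpa using hm) rfl
  exact ⟨f, Mor.id .unit, Mor.id Γ, h.ty, .id _, by simpa using IsPerm.id Γ,
    by simp [comp_id h.ty.dom]⟩

theorem SplitsTensor.of_prime {Γ Γ₁ Γ₂ B B₁ B₂ : Form L} {f : Mor L} (h : CutFree Γ B f)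
    (hΓ : Γ.Reduced) (hB : B.Reduced) (hm : Γ.mfac = Γ₁.mfac + Γ₂.mfac)
    (hd : (Γ₁ ⊡ B₁).Apart (Γ₂ ⊡ B₂)) (hBp : B.IsPrime) (he : B = B₁ ⊡ B₂) :
    SplitsTensor f Γ Γ₁ Γ₂ B₁ B₂ := by
  rcases hBp.eq_tensor he with ⟨rfl, rfl⟩ | ⟨rfl, rfl⟩
  · refine .of_unit_left h hΓ hB hm ?_
    intro p; have := hd p; simp at this ⊢; tauto
  · refine .of_unit_right h hΓ hB hm ?_
    intro p; have := hd p; simp at this ⊢; tauto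

/-- When the letters of `Γ₁` and `B₁` are apart from those of `Γ₂` and `B₂`, a morphism
`Γ₁ ⊗ Γ₂ ⊢ B₁ ⊗ B₂` is a tensor product. -/
theorem CutFree.splitsTensor [DecidableEq L] {Γ B : Form L} {f : Mor L} (h : CutFree Γ B f)
    (hg : Good Γ B) {Γ₁ Γ₂ B₁ B₂ : Form L} (he : B = B₁ ⊡ B₂)
    (hm : Γ.mfac = Γ₁.mfac + Γ₂.mfac) (hd : (Γ₁ ⊡ B₁).Apart (Γ₂ ⊡ B₂)) :
    SplitsTensor f Γ Γ₁ Γ₂ B₁ B₂ := by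
  induction h generalizing Γ₁ Γ₂ B₁ B₂ with
  | ax p => exact .of_prime (.ax p) hg.left hg.right hm hd (Form.isPrime_letter p) he
  | unit =>
    obtain ⟨rfl, rfl⟩ := Form.tensor_eq_unit.1 he.symm
    refine .of_unit_left .unit hg.left hg.right hm ?_
    intro p; have := hd p; simpa using this
  | @perm A B Γ f σ h hσ ih =>
    exact (ih (hg.congr hσ.mfac_eq) he (hσ.mfac_eq ▸ hm) hd).comp hσ
  | cur h ih => exact .of_prime (.cur h) hg.left hg.right hm hd (Form.isPrime_imp _ _) he
  | @tensor A B C D f g h1 h2 ih1 ih2 =>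
    obtain ⟨hg1, hg2⟩ := hg.of_tensor
    rw [Form.mfac_tensor] at hm
    obtain ⟨A₁, A₂, C₁, C₂, e1, e2, e3, e4⟩ := Form.exists_refinement hm
    have l3 := Form.mem_letters_of_add e3
    have l4 := Form.mem_letters_of_add e4
    -- Either `B` lies within `B₁` or `D` lies within `B₂`. The premise whose right side is not
    -- divided has no share in the opposite half of the context; the other premise is split by
    -- induction.
    rcases Form.tensor_eq_tensor he with ⟨E, rfl, rfl⟩ | ⟨E, rfl, rfl⟩
    · obtain rfl := h1.eq_unit_of_apart hg1.left hg1.right (e1.trans (add_comm _ _)) (by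
        intro p; have := hd p; simp [l3, l4] at this ⊢; tauto)
      obtain ⟨g₁, g₂, σ, t1, t2, hσ, rfl⟩ := ih2 hg2 rfl e2 (by
        intro p; have := hd p; simp [l3, l4] at this ⊢; tauto)
      refine SplitsTensor.congr (Γ₁ := A ⊡ C₁) (Γ₂ := C₂) ?_ (by simp [e1, e3]) (by simp [e4])
      refine ⟨f ⊠ g₁, g₂, Mor.id A ⊠ σ, h1.ty.tensor t1, t2, ?_, ?_⟩
      · simpa using (IsPerm.id A).tensor hσ
      · rw [Mor.tensor_assoc, interchange (f₁ := Mor.id A) h1.ty.dom.symm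
          (by simp [hσ.ty.cod, t1.dom, t2.dom]),
          comp_id h1.ty.dom]
    · obtain rfl := h2.eq_unit_of_apart hg2.left hg2.right e2 (by
        intro p; have := hd p; simp [l3, l4] at this ⊢; tauto)
      obtain ⟨f₁, f₂, σ, t1, t2, hσ, rfl⟩ := ih1 hg1 rfl e1 (by
        intro p; have := hd p; simp [l3, l4] at this ⊢; tauto)
      refine SplitsTensor.congr (Γ₁ := A₁) (Γ₂ := A₂ ⊡ C) ?_ (by simp [e3]) (by simp [e2, e4])
      refine ⟨f₁, f₂ ⊠ g, σ ⊠ Mor.id C, t1, t2.tensor h2.ty, ?_, ?_⟩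
      · simpa using hσ.tensor (IsPerm.id C)
      · rw [← Mor.tensor_assoc, interchange (f₂ := Mor.id C)
          (by simp [hσ.ty.cod, t1.dom, t2.dom]) h2.ty.dom.symm,
          comp_id h2.ty.dom]
  | @limp X C S Δ B f g h1 h2 ih1 ih2 =>
    obtain ⟨hg1, hg2⟩ := hg.of_limp
    have hn := h2.nodup hg2
    have hm' : X.imp C ::ₘ (Δ ⊡ S).mfac = Γ₁.mfac + Γ₂.mfac := by
      rw [← hm]; simp [Multiset.singleton_add]
    subst he
    -- The half of the context that contains the principal implication takes all of `Δ`, and in the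
    -- second premise it takes `C`.
    rcases Form.cons_add_cases hm' with ⟨E, hE, e⟩ | ⟨E, hE, e⟩
    · rw [Form.mfac_tensor] at e
      obtain ⟨Δ₁, Δ₂, S₁, S₂, e1, e2, e3, e4⟩ := Form.exists_refinement e
      have l := Form.mem_letters_of_cons hE
      have l3 := Form.mem_letters_of_add e3
      have l4 := Form.mem_letters_of_add e4
      obtain rfl := h1.eq_unit_of_apart hg1.left hg1.right (e1.trans (add_comm _ _)) (by
        intro p; have := hd p; simp [l, l3, l4] at this ⊢; tauto)
      obtain ⟨g₁, g₂, τ, t1, t2, hτ, rfl⟩ := ih2 hg2 (Γ₁ := C ⊡ S₁) (Γ₂ := S₂) rfl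
        (by simp [e2, add_assoc]) (by
          intro p; have := hd p; simp [l, l3, l4] at this ⊢; tauto)
      obtain ⟨ρ, hρ⟩ := IsPerm.exists_of_mfac_eq (A := S) (B := S₁ ⊡ S₂) (by simp [e2])
      -- The factors of `C ⊗ S` are distinct, so the permutation from the induction hypothesis must
      -- be the one that leaves `C` in place, and it can be moved past the left introduction.
      obtain rfl : τ = Mor.id C ⊠ ρ :=
        hτ.unique (by simpa using (IsPerm.id C).tensor hρ) hn
      refine SplitsTensor.congr (Γ₁ := Δ ⊡ X.imp C ⊡ S₁) (Γ₂ := S₂) ?_ (by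
        simp only [Form.mfac_tensor, Form.mfac_imp, hE, e3, e1, Form.mfac_unit, ← Multiset.singleton_add]; abel) (by simp [e4])
      refine ⟨Mor.limp X C S₁ f g₁, g₂, Mor.id (Δ ⊡ X.imp C) ⊠ ρ, h1.ty.limp t1, t2, ?_, ?_⟩
      · simpa using (IsPerm.id (Δ ⊡ X.imp C)).tensor hρ
      · rw [limp_tensor g₂ t1.dom, t2.dom, ← h1.ty.dom, limp_comp_right hρ.ty]
    · rw [Form.mfac_tensor] at e
      obtain ⟨Δ₁, Δ₂, S₁, S₂, e1, e2, e3, e4⟩ := Form.exists_refinement e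
      have l := Form.mem_letters_of_cons hE
      have l3 := Form.mem_letters_of_add e3
      have l4 := Form.mem_letters_of_add e4
      obtain rfl := h1.eq_unit_of_apart hg1.left hg1.right e1 (by
        intro p; have := hd p; simp [l, l3, l4] at this ⊢; tauto)
      obtain ⟨g₁, g₂, τ, t1, t2, hτ, rfl⟩ := ih2 hg2 (Γ₁ := S₁) (Γ₂ := C ⊡ S₂) rfl
        (by simp [e2, add_left_comm]) (by
          intro p; have := hd p; simp [l, l3, l4] at this ⊢; tauto)
      obtain ⟨ρ, hρ⟩ := IsPerm.exists_of_mfac_eq (A := S) (B := S₁ ⊡ S₂) (by simp [e2])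
      -- Here uniqueness splits the permutation into a reordering of `S`, which can be moved past
      -- the left introduction, and the motion of `C` behind `S₁`, which `tensor_limp'` absorbs.
      obtain rfl : τ = (Mor.swap C S₁ ⊠ Mor.id S₂) ⊚ (Mor.id C ⊠ ρ) := by
        refine hτ.unique (((IsPerm.id C).tensor hρ).comp ?_) hn
        simpa using (IsPerm.swap C S₁).tensor (.id S₂)
      refine SplitsTensor.congr (Γ₁ := S₁) (Γ₂ := Δ ⊡ X.imp C ⊡ S₂) ?_ (by simp [e3]) (by
        simp only [Form.mfac_tensor, Form.mfac_imp, hE, e4, e1, Form.mfac_unit, ← Multiset.singleton_add]; abel)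
      refine ⟨g₁, Mor.limp X C S₂ f g₂, (Mor.swap (Δ ⊡ X.imp C) S₁ ⊠ Mor.id S₂) ⊚
        (Mor.id (Δ ⊡ X.imp C) ⊠ ρ), t1, h1.ty.limp t2, ?_, ?_⟩
      · have := ((IsPerm.id (Δ ⊡ X.imp C)).tensor hρ).comp (τ := Mor.swap (Δ ⊡ X.imp C) S₁ ⊠
          Mor.id S₂) (C := S₁ ⊡ Δ ⊡ X.imp C ⊡ S₂)
          (by simpa using (IsPerm.swap (Δ ⊡ X.imp C) S₁).tensor (.id S₂))
        simpa using this
      · have := tensor_limp' (X := X) (S := S₂) g₁ h1.ty.dom t2.dom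
        rw [t1.dom] at this
        rw [← Mor.comp_assoc, ← Mor.comp_assoc (_ ⊠ _), ← this, ← h1.ty.dom,
          limp_comp_right hρ.ty]

/-! ### Permuting left introductions; splitting along an implication on the left. -/

namespace Mor

/-- This lemma and the next three bring the introduction of `X → C` to the last place. Here it took
place in the derivation of the argument of `Y → D`; in `limp_comp_limp`, `D` is used in the argument
of `X → C`; in `cur_limp` the last rule is a transposition. -/
theorem limp_limp {X C P Y D S : Form L} {a b g : Mor L} (hb : Ty b (C ⊡ P) Y) :
    limp Y D S (limp X C P a b) g = limp X C (P ⊡ Y.imp D ⊡ S) a (limp Y D S b g) := by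
  simp only [limp, comp_assoc]
  generalize he : eps X C ⊚ (a ⊠ id (X.imp C)) = e
  have h2 : e.cod = C := by simp [← he]
  rw [← id_tensor_id P, ← id_tensor_id, ← tensor_assoc e, ← tensor_assoc (e ⊠ id P),
    interchange (f₂ := id S) (by simp [h2, hb.dom]) (by simp), id_comp_id, comp_assoc,
    interchange (f₂ := id (Y.imp D)) (by simp [h2, hb.dom]) (by simp), id_comp_id]

theorem limp_comp_limp {X C S Y D Q : Form L} {f a b : Mor L} (ha : a.dom = D ⊡ Q) :
    limp Y D (Q ⊡ X.imp C ⊡ S) f (limp X C S a b) = limp X C S (limp Y D Q f a) b := by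
  have : ∀ e : Mor L, e.cod = D →
      limp X C S a b ⊚ (e ⊠ id (Q ⊡ X.imp C ⊡ S)) = limp X C S (a ⊚ (e ⊠ id Q)) b := by
    intro e he
    rw [← limp_comp_left (by simp [he, ha]), tensor_assoc, id_tensor_id]
  rw [limp, this _ (by simp)]
  rfl

/-- The two introductions act on disjoint groups of factors and commute by functoriality of the
tensor product, up to exchanging these groups. -/
theorem limp_limp_swap {X C Y D Q Δ Δ₀ : Form L} {f a b : Mor L} (hf : Ty f Δ₀ Y) (ha : Ty a Δ X) :
    limp Y D (Δ ⊡ X.imp C ⊡ Q) f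
        (limp X C (D ⊡ Q) a b ⊚ (swap D (Δ ⊡ X.imp C) ⊠ id Q)) =
      limp X C (Δ₀ ⊡ Y.imp D ⊡ Q) a
          (b ⊚ (id C ⊠ (eps Y D ⊚ (f ⊠ id (Y.imp D))) ⊠ id Q)) ⊚
        (swap (Δ₀ ⊡ Y.imp D) (Δ ⊡ X.imp C) ⊠ id Q) := by
  simp only [limp, comp_assoc]
  generalize he : eps X C ⊚ (a ⊠ id (X.imp C)) = e
  generalize he₀ : eps Y D ⊚ (f ⊠ id (Y.imp D)) = e₀
  have c : e.cod = C := by simp [← he]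
  have c₀ : e₀.cod = D := by simp [← he₀]
  have d : e.dom = Δ ⊡ X.imp C := by simp [← he, ha.dom]
  have d₀ : e₀.dom = Δ₀ ⊡ Y.imp D := by simp [← he₀, hf.dom]
  have h1 : (swap D (Δ ⊡ X.imp C) ⊠ id Q) ⊚ (e₀ ⊠ id (Δ ⊡ X.imp C ⊡ Q)) =
      ((id (Δ ⊡ X.imp C) ⊠ e₀) ⊚ swap (Δ₀ ⊡ Y.imp D) (Δ ⊡ X.imp C)) ⊠ id Q := by
    rw [← swap_natural d₀ c₀ (dom_id _) (cod_id _), ← Form.tensor_assoc, ← id_tensor_id _ Q,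
      ← tensor_assoc, interchange (by simp [c₀]) (by simp), id_comp_id]
  have h2 : (id C ⊠ e₀ ⊠ id Q) ⊚ (e ⊠ id (Δ₀ ⊡ Y.imp D ⊡ Q)) =
      (e ⊠ id (D ⊡ Q)) ⊚ (id (Δ ⊡ X.imp C) ⊠ e₀ ⊠ id Q) := by
    rw [interchange (by simp [c]) (by simp [d₀]), interchange (by simp [d]) (by simp [c₀]),
      id_comp c, comp_id d, id_comp (by simp [c₀]), comp_id (by simp [d₀])]
  rw [h1, ← comp_assoc (id C ⊠ _), h2, comp_assoc, ← tensor_assoc (id (Δ ⊡ X.imp C)),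
    interchange (g₂ := id Q) (by simp [d₀]) (by simp), id_comp_id]

theorem cur_limp {X C S Y Δ : Form L} {a b : Mor L} (ha : a.dom = Δ) :
    cur Y (Δ ⊡ X.imp C ⊡ S) (limp X C (Y ⊡ S) a b ⊚ (swap Y (Δ ⊡ X.imp C) ⊠ id S)) =
      limp X C S a (cur Y (C ⊡ S) (b ⊚ (swap Y C ⊠ id S))) := by
  have key : ∀ e : Mor L, e.cod = C → e.dom = Δ ⊡ X.imp C →
      cur Y (Δ ⊡ X.imp C ⊡ S) ((b ⊚ (e ⊠ id (Y ⊡ S))) ⊚ (swap Y (Δ ⊡ X.imp C) ⊠ id S)) =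
        cur Y (C ⊡ S) (b ⊚ (swap Y C ⊠ id S)) ⊚ (e ⊠ id S) := by
    intro e c d
    have h : (e ⊠ id (Y ⊡ S)) ⊚ (swap Y (Δ ⊡ X.imp C) ⊠ id S) =
        (swap Y C ⊠ id S) ⊚ (id Y ⊠ e ⊠ id S) := by
      rw [← id_tensor_id Y S, ← tensor_assoc e, ← tensor_assoc (id Y),
        interchange (f₂ := id S) (by simp [d]) (by simp),
        interchange (f₂ := id S) (by simp [c]) (by simp),
        swap_natural (dom_id Y) (cod_id Y) d c]
    rw [cur_comp (A := Δ ⊡ X.imp C ⊡ S) (by simp [d]) (by simp [c]), comp_assoc, comp_assoc, h]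
  exact key _ (by simp) (by simp [ha])

end Mor

/-- Up to a permutation of the factors on the left, `f` is obtained by the left introduction of
`X → C`, with `Δ` on the left-hand side of the first premise. -/
def SplitsImp (f : Mor L) (Γ Δ X C S B : Form L) : Prop :=
  ∃ a b σ, Ty a Δ X ∧ Ty b (C ⊡ S) B ∧ IsPerm Γ (Δ ⊡ X.imp C ⊡ S) σ ∧ f = limp X C S a b ⊚ σ

theorem SplitsImp.congr {f : Mor L} {Γ Δ Δ' X C S S' B : Form L}
    (h : SplitsImp f Γ Δ X C S B) (h₁ : Δ.mfac = Δ'.mfac) (h₂ : S.mfac = S'.mfac) :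
    SplitsImp f Γ Δ' X C S' B := by
  obtain ⟨a, b, σ, ta, tb, hσ, rfl⟩ := h
  obtain ⟨α, hα⟩ := IsPerm.exists_of_mfac_eq h₁
  obtain ⟨α', hα', e1, -⟩ := hα.exists_inv
  obtain ⟨β, hβ⟩ := IsPerm.exists_of_mfac_eq h₂
  obtain ⟨β', hβ', e2, -⟩ := hβ.exists_inv
  refine ⟨a ⊚ α', b ⊚ (Mor.id C ⊠ β'), (α ⊠ Mor.id (X.imp C) ⊠ β) ⊚ σ, ta.comp hα'.ty,
    tb.comp ((Ty.id C).tensor hβ'.ty), hσ.comp (hα.tensor ((IsPerm.id _).tensor hβ)), ?_⟩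
  rw [← limp_comp_left (by simp [ta.dom, hα'.ty.cod]), ← limp_comp_right hβ'.ty, ta.dom,
    comp_assoc, comp_assoc]
  have h3 : (α' ⊠ Mor.id (X.imp C ⊡ S')) ⊚ (α ⊠ Mor.id (X.imp C) ⊠ β) =
      Mor.id (Δ ⊡ X.imp C) ⊠ β := by
    rw [interchange (by simp [hα.ty.cod, hα'.ty.dom]) (by simp [hβ.ty.cod]), e1,
      Mor.id_comp (by simp [hβ.ty.cod]), ← Mor.tensor_assoc, id_tensor_id]
  have h4 : (Mor.id (Δ ⊡ X.imp C) ⊠ β') ⊚ (Mor.id (Δ ⊡ X.imp C) ⊠ β) =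
      Mor.id (Δ ⊡ X.imp C ⊡ S) := by
    rw [interchange rfl (by simp [hβ.ty.cod, hβ'.ty.dom]), e2, id_comp_id, id_tensor_id,
      Form.tensor_assoc]
  rw [← Mor.comp_assoc _ _ σ, h3, ← Mor.comp_assoc _ _ σ, h4, Mor.id_comp hσ.ty.cod]

theorem SplitsImp.comp {f σ : Mor L} {Γ Γ' Δ X C S B : Form L}
    (h : SplitsImp f Γ Δ X C S B) (hσ : IsPerm Γ' Γ σ) :
    SplitsImp (f ⊚ σ) Γ' Δ X C S B := by
  obtain ⟨a, b, τ, ta, tb, hτ, rfl⟩ := h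
  exact ⟨a, b, τ ⊚ σ, ta, tb, hσ.comp hτ, by simp⟩

set_option maxHeartbeats 1000000 in
/-- When the letters of `Δ` and `X` are apart from those of `C`, `S` and `B`, a morphism
`Δ ⊗ (X → C) ⊗ S ⊢ B` is obtained by the left introduction of `X → C`. -/
theorem CutFree.splitsImp [DecidableEq L] {Γ B : Form L} {f : Mor L} (h : CutFree Γ B f)
    (hg : Good Γ B) {Δ X C S : Form L} (hm : Γ.mfac = X.imp C ::ₘ (Δ.mfac + S.mfac))
    (hd : (Δ ⊡ X).Apart (C ⊡ S ⊡ B)) : SplitsImp f Γ Δ X C S B := by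
  induction h generalizing Δ X C S with
  | ax p =>
    have := hm ▸ Multiset.mem_cons_self (X.imp C) (Δ.mfac + S.mfac)
    rw [Form.mfac_letter, Multiset.mem_singleton] at this
    simp [Form.letter, Form.imp] at this
  | unit => simp at hm
  | @perm A B Γ f σ h hσ ih =>
    exact (ih (hg.congr hσ.mfac_eq) (hσ.mfac_eq ▸ hm) hd).comp hσ
  | @tensor A B A' B' f g h1 h2 ih1 ih2 =>
    obtain ⟨hg1, hg2⟩ := hg.of_tensor
    rw [Form.mfac_tensor, ← Form.mfac_tensor Δ, eq_comm] at hm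
    rcases Form.cons_add_cases hm with ⟨E, hE, e⟩ | ⟨E, hE, e⟩
    · rw [Form.mfac_tensor, eq_comm] at e
      obtain ⟨P, Q, P', Q', e1, e2, e3, e4⟩ := Form.exists_refinement e
      have l3 := Form.mem_letters_of_add e3
      have l4 := Form.mem_letters_of_add e4
      obtain rfl := h2.eq_unit_of_apart hg2.left hg2.right e2 (by
        intro p; have := hd p; simp [l3, l4] at this ⊢; tauto)
      obtain ⟨a, b, σ, ta, tb, hσ, rfl⟩ := ih1 hg1 (Δ := P) (S := Q) (by rw [hE, e1]) (by
        intro p; have := hd p; simp [l3, l4] at this ⊢; tauto)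
      refine SplitsImp.congr (Δ := P) (S := Q ⊡ A') ?_ (by simp [e3]) (by simp [e2, e4])
      refine ⟨a, b ⊠ g, σ ⊠ Mor.id A', ta, by simpa using tb.tensor h2.ty, ?_, ?_⟩
      · simpa using hσ.tensor (.id A')
      · have := limp_tensor (X := X) (f := a) g tb.dom
        rw [h2.ty.dom] at this
        rw [← this, interchange (by simp [hσ.ty.cod, Mor.limp, ta.dom]) (by simp [h2.ty.dom]),
          Mor.comp_id h2.ty.dom]
    · rw [Form.mfac_tensor, eq_comm] at e
      obtain ⟨P, Q, P', Q', e1, e2, e3, e4⟩ := Form.exists_refinement e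
      have l3 := Form.mem_letters_of_add e3
      have l4 := Form.mem_letters_of_add e4
      obtain rfl := h1.eq_unit_of_apart hg1.left hg1.right e1 (by
        intro p; have := hd p; simp [l3, l4] at this ⊢; tauto)
      obtain ⟨a, b, σ, ta, tb, hσ, rfl⟩ := ih2 hg2 (Δ := P') (S := Q') (by rw [hE, e2]) (by
        intro p; have := hd p; simp [l3, l4] at this ⊢; tauto)
      refine SplitsImp.congr (Δ := P') (S := A ⊡ Q') ?_ (by simp [e3]) (by simp [e1, e4])
      refine ⟨a, (f ⊠ b) ⊚ (Mor.swap C A ⊠ Mor.id Q'),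
        (Mor.swap A (P' ⊡ X.imp C) ⊠ Mor.id Q') ⊚ (Mor.id A ⊠ σ), ta, ?_, ?_, ?_⟩
      · refine (h1.ty.tensor tb).comp ?_
        simpa using ((IsPerm.swap C A).tensor (.id Q')).ty
      · refine ((IsPerm.id A).tensor hσ).comp ?_
        simpa using (IsPerm.swap A (P' ⊡ X.imp C)).tensor (.id Q')
      · have := tensor_limp (X := X) f ta.dom tb.dom
        rw [h1.ty.dom] at this
        rw [← Mor.comp_assoc, ← this, interchange (f₁ := Mor.id A) h1.ty.dom.symm
          (by simp [hσ.ty.cod, Mor.limp, ta.dom]), Mor.comp_id h1.ty.dom]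
  | @cur Y Γ D f h ih =>
    obtain ⟨a, b, σ, ta, tb, hσ, rfl⟩ := ih hg.of_cur (Δ := Δ) (S := Y ⊡ S) (by
      simp only [Form.mfac_tensor, hm, ← Multiset.singleton_add]; abel) (by
        intro p; have := hd p; simp at this ⊢; tauto)
    obtain ⟨ρ, hρ⟩ := IsPerm.exists_of_mfac_eq (A := Γ) (B := Δ ⊡ X.imp C ⊡ S) (by
      simp only [Form.mfac_tensor, Form.mfac_imp, hm, ← Multiset.singleton_add]; abel)
    -- Uniqueness of permutations separates the motion of the discharged `Y` from a permutation `ρ`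
    -- of the context, and `ρ` can be taken out of the transpose.
    obtain rfl : σ = (Mor.swap Y (Δ ⊡ X.imp C) ⊠ Mor.id S) ⊚ (Mor.id Y ⊠ ρ) := by
      refine hσ.unique (((IsPerm.id Y).tensor hρ).comp ?_) (h.nodup hg.of_cur)
      simpa using (IsPerm.swap Y (Δ ⊡ X.imp C)).tensor (.id S)
    refine ⟨a, Mor.cur Y (C ⊡ S) (b ⊚ (Mor.swap Y C ⊠ Mor.id S)), ρ, ta, ?_, hρ, ?_⟩
    · refine Ty.cur (tb.comp ?_)
      simpa using ((IsPerm.swap Y C).tensor (.id S)).ty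
    · rw [← cur_limp ta.dom, cur_comp hρ.ty.dom hρ.ty.cod, Mor.comp_assoc]
  | @limp Y D S₀ Δ₀ B f g h1 h2 ih1 ih2 =>
    obtain ⟨hg1, hg2⟩ := hg.of_limp
    have rD : D ≠ .unit := by
      have := hg.left
      simp only [Form.reduced_tensor, Form.reduced_imp] at this
      exact this.2.1.2.1
    have hn := h2.nodup hg2
    by_cases hi : X.imp C = Y.imp D
    -- When the principal implication is the chosen one, the part of `Δ₀` outside `Δ` is apart in
    -- the first premise and the part of `S₀` outside `S` is apart in the second. Both are empty, so
    -- the given derivation already has the required form.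
    · obtain ⟨rfl, rfl⟩ := Form.imp_inj.1 hi
      have e : Δ₀.mfac + S₀.mfac = Δ.mfac + S.mfac := by
        refine (Multiset.cons_inj_right (X.imp C)).1 (Eq.trans ?_ hm)
        simp only [Form.mfac_tensor, Form.mfac_imp, ← Multiset.singleton_add]; abel
      obtain ⟨P, P', Q, Q', e1, e2, e3, e4⟩ := Form.exists_refinement e
      have l3 := Form.mem_letters_of_add e3
      have l4 := Form.mem_letters_of_add e4
      obtain rfl := h1.eq_unit_of_apart hg1.left hg1.right (e1.trans (add_comm _ _)) (by
        intro p; have := hd p; simp [l3, l4] at this ⊢; tauto)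
      obtain rfl := h2.eq_unit_of_apart hg2.left hg2.right (E := Q) (G := C ⊡ Q')
        (by simp [e2, add_left_comm]) (by
        intro p; have := hd p; simp [l3, l4] at this ⊢; tauto)
      refine SplitsImp.congr (Δ := Δ₀) (S := S₀) ?_ (by simp [e1, e3]) (by simp [e2, e4])
      exact ⟨f, g, Mor.id _, h1.ty, h2.ty, .id _, (Mor.comp_id (h1.ty.limp h2.ty).dom).symm⟩
    · have m : Y.imp D ::ₘ (Δ₀ ⊡ S₀).mfac = X.imp C ::ₘ (Δ ⊡ S).mfac := by
        rw [Form.mfac_tensor Δ, ← hm]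
        simp only [Form.mfac_tensor, Form.mfac_imp, ← Multiset.singleton_add]; abel
      have hmem : X.imp C ∈ (Δ₀ ⊡ S₀).mfac := by
        have := m ▸ Multiset.mem_cons_self (X.imp C) (Δ ⊡ S).mfac
        exact (Multiset.mem_cons.1 this).resolve_left hi
      obtain ⟨K, hK⟩ := Form.exists_mfac_of_mem hmem
      have hK' : (Δ ⊡ S).mfac = Y.imp D ::ₘ K.mfac := by
        rw [hK, Multiset.cons_swap] at m
        exact ((Multiset.cons_inj_right _).1 m).symm
      rw [Form.mfac_tensor, eq_comm] at hK hK'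
      -- Four cases: `X → C` lies in `Δ₀` or in `S₀`, and `Y → D` lies in `Δ` or in `S`.
      rcases Form.cons_add_cases hK with ⟨E, hE, hE'⟩ | ⟨E, hE, hE'⟩ <;>
      rcases Form.cons_add_cases hK' with ⟨F, hF, hF'⟩ | ⟨F, hF, hF'⟩
      -- This case is impossible: `D` with the share of `S₀` in `Δ` would be a group apart in the
      -- second premise, forcing `D` to be `I`.
      · obtain ⟨P, P', Q, Q', e1, e2, e3, e4⟩ := Form.exists_refinement (hE'.symm.trans hF')
        have l3 := Form.mem_letters_of_add e3
        have l4 := Form.mem_letters_of_add e4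
        have l := Form.mem_letters_of_cons hF
        have := h2.eq_unit_of_apart hg2.left hg2.right (E := D ⊡ Q) (G := Q')
          (by simp [e2, add_assoc]) (by
            intro p; have := hd p; simp [l, l3, l4] at this ⊢; tauto)
        exact absurd (Form.tensor_eq_unit.1 this).1 rD
      -- `X → C` is introduced in the first premise; `limp_limp` moves its introduction down.
      · obtain ⟨P, P', Q, Q', e1, e2, e3, e4⟩ := Form.exists_refinement (hE'.symm.trans hF')
        have l3 := Form.mem_letters_of_add e3
        have l4 := Form.mem_letters_of_add e4
        have l := Form.mem_letters_of_cons hF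
        obtain rfl := h2.eq_unit_of_apart hg2.left hg2.right (E := Q) (G := D ⊡ Q')
          (by simp [e2, add_left_comm]) (by
            intro p; have := hd p; simp [l, l3, l4] at this ⊢; tauto)
        obtain ⟨a, b, σ, ta, tb, hσ, rfl⟩ := ih1 hg1 (Δ := P) (S := P') (by rw [hE, e1]) (by
          intro p; have := hd p; simp [l, l3, l4] at this ⊢; tauto)
        refine SplitsImp.congr (Δ := P) (S := P' ⊡ Y.imp D ⊡ S₀) ?_ (by simp [e3]) (by
          simp only [Form.mfac_tensor, Form.mfac_imp, hF, e4, e2, Form.mfac_unit,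
            ← Multiset.singleton_add]; abel)
        refine ⟨a, Mor.limp Y D S₀ b g, σ ⊠ Mor.id (Y.imp D ⊡ S₀), ta, ?_, ?_, ?_⟩
        · simpa using tb.limp h2.ty
        · simpa using hσ.tensor (.id (Y.imp D ⊡ S₀))
        · rw [← limp_limp tb, limp_comp_left (by simp [Mor.limp, hσ.ty.cod, ta.dom])]
      -- `Y → D` is used in producing the argument of `X → C`: in the second premise `D` joins the
      -- context of that argument.
      · obtain ⟨P, P', Q, Q', e1, e2, e3, e4⟩ := Form.exists_refinement (hE'.symm.trans hF')
        have l3 := Form.mem_letters_of_add e3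
        have l4 := Form.mem_letters_of_add e4
        have l := Form.mem_letters_of_cons hF
        obtain rfl := h1.eq_unit_of_apart hg1.left hg1.right (e1.trans (add_comm _ _)) (by
          intro p; have := hd p; simp [l, l3, l4] at this ⊢; tauto)
        obtain ⟨a, b, σ, ta, tb, hσ, rfl⟩ := ih2 hg2 (Δ := D ⊡ Q) (S := Q') (by
          simp only [Form.mfac_tensor, hE, e2, ← Multiset.singleton_add]; abel) (by
          intro p; have := hd p; simp [l, l3, l4] at this ⊢; tauto)
        obtain ⟨ρ, hρ⟩ := IsPerm.exists_of_mfac_eq (A := S₀) (B := Q ⊡ X.imp C ⊡ Q') (by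
          simp only [Form.mfac_tensor, Form.mfac_imp, hE, e2, ← Multiset.singleton_add]; abel)
        obtain rfl : σ = Mor.id D ⊠ ρ :=
          hσ.unique (by simpa using (IsPerm.id D).tensor hρ) hn
        refine SplitsImp.congr (Δ := Δ₀ ⊡ Y.imp D ⊡ Q) (S := Q') ?_ (by
          simp only [Form.mfac_tensor, Form.mfac_imp, hF, e1, e3, Form.mfac_unit,
            ← Multiset.singleton_add]; abel) (by simp [e4])
        refine ⟨Mor.limp Y D Q f a, b, Mor.id (Δ₀ ⊡ Y.imp D) ⊠ ρ, h1.ty.limp ta, tb, ?_, ?_⟩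
        · simpa using (IsPerm.id (Δ₀ ⊡ Y.imp D)).tensor hρ
        · rw [← limp_comp_limp ta.dom, ← h1.ty.dom, limp_comp_right hρ.ty]
      -- The two implications are independent: in the second premise `D` remains in the side context
      -- of `X → C`.
      · obtain ⟨P, P', Q, Q', e1, e2, e3, e4⟩ := Form.exists_refinement (hE'.symm.trans hF')
        have l3 := Form.mem_letters_of_add e3
        have l4 := Form.mem_letters_of_add e4
        have l := Form.mem_letters_of_cons hF
        obtain rfl := h1.eq_unit_of_apart hg1.left hg1.right e1 (by
          intro p; have := hd p; simp [l, l3, l4] at this ⊢; tauto)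
        obtain ⟨a, b, σ, ta, tb, hσ, rfl⟩ := ih2 hg2 (Δ := Q) (S := D ⊡ Q') (by
          simp only [Form.mfac_tensor, hE, e2, ← Multiset.singleton_add]; abel) (by
          intro p; have := hd p; simp [l, l3, l4] at this ⊢; tauto)
        obtain ⟨ρ, hρ⟩ := IsPerm.exists_of_mfac_eq (A := S₀) (B := Q ⊡ X.imp C ⊡ Q') (by
          simp only [Form.mfac_tensor, Form.mfac_imp, hE, e2, ← Multiset.singleton_add]; abel)
        obtain rfl : σ = (Mor.swap D (Q ⊡ X.imp C) ⊠ Mor.id Q') ⊚ (Mor.id D ⊠ ρ) := by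
          refine hσ.unique (((IsPerm.id D).tensor hρ).comp ?_) hn
          simpa using (IsPerm.swap D (Q ⊡ X.imp C)).tensor (.id Q')
        refine SplitsImp.congr (Δ := Q) (S := Δ₀ ⊡ Y.imp D ⊡ Q') ?_ (by simp [e3]) (by
          simp only [Form.mfac_tensor, Form.mfac_imp, hF, e1, e4, Form.mfac_unit,
            ← Multiset.singleton_add]; abel)
        refine ⟨a, b ⊚ (Mor.id C ⊠ (Mor.eps Y D ⊚ (f ⊠ Mor.id (Y.imp D))) ⊠ Mor.id Q'),
          (Mor.swap (Δ₀ ⊡ Y.imp D) (Q ⊡ X.imp C) ⊠ Mor.id Q') ⊚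
          (Mor.id (Δ₀ ⊡ Y.imp D) ⊠ ρ), ta, ?_, ?_, ?_⟩
        · refine tb.comp ((Ty.id C).tensor ?_)
          simpa [Mor.limp, Mor.id_comp] using h1.ty.limp (Ty.id (D ⊡ Q'))
        · refine IsPerm.comp (B := (Δ₀ ⊡ Y.imp D) ⊡ Q ⊡ X.imp C ⊡ Q') ?_ ?_
          · simpa using (IsPerm.id (Δ₀ ⊡ Y.imp D)).tensor hρ
          · simpa using (IsPerm.swap (Δ₀ ⊡ Y.imp D) (Q ⊡ X.imp C)).tensor (.id Q')
        · rw [← Mor.comp_assoc, ← Mor.comp_assoc, ← limp_limp_swap h1.ty ta, ← h1.ty.dom,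
            limp_comp_right hρ.ty]

/-! ### Coherence when no letter occurs more than twice. -/

theorem CutFree.eq_id {Γ B : Form L} {f : Mor L} (h : CutFree Γ B f) (hΓ : Γ = .unit)
    (hB : B = .unit) : f = Mor.id .unit := by
  induction h with
  | ax p => exact absurd hB (Form.isPrime_letter p).ne_unit
  | unit => rfl
  | @perm A B Γ f σ h hσ ih =>
    subst hΓ
    obtain rfl : A = .unit := Form.mfac_eq_zero.1 hσ.mfac_eq.symm
    rw [hσ.unique (.id _) (by simp), ih rfl hB, id_comp_id]
  | tensor _ _ ih1 ih2 =>
    rw [Form.tensor_eq_unit] at hΓ hB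
    rw [ih1 hΓ.1 hB.1, ih2 hΓ.2 hB.2, id_unit_tensor]
  | cur => exact absurd hB (Form.isPrime_imp _ _).ne_unit
  | limp =>
    rw [Form.tensor_eq_unit, Form.tensor_eq_unit] at hΓ
    exact absurd hΓ.2.1 (Form.isPrime_imp _ _).ne_unit

theorem CutFree.dom_eq_unit {Γ B : Form L} {f : Mor L} (h : CutFree Γ B f) (hΓ : Γ.Reduced)
    (hB : B = .unit) : Γ = .unit :=
  h.eq_unit_of_apart hΓ (hB ▸ trivial) (E := Γ) (G := .unit) (by simp) (by
    subst hB; intro p; simp)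

/-- Occurrences of a letter are linked in pairs. Only the parity of their number is needed, and it
follows by induction on terms without speaking of links. -/
theorem Mor.even_count [DecidableEq L] {f : Mor L} (h : f.Ok) (p : L) :
    Even (f.dom.letters.count p + f.cod.letters.count p) := by
  induction f using Quotient.ind with
  | _ t =>
    change Even (t.dom.letters.count p + t.cod.letters.count p)
    replace h : t.WellFormed := h
    induction t with
    | comp g f ihg ihf =>
      obtain ⟨h1, h2, h3⟩ := h
      have := ihg h1
      have := ihf h2
      rw [h3] at this
      simp only [Term.dom, Term.cod, Nat.even_add] at *
      tauto
    | tensor f g ihf ihg =>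
      have := ihf h.1
      have := ihg h.2
      simp only [Term.dom, Term.cod, Form.letters_tensor, Multiset.count_add, Nat.even_add] at *
      tauto
    | imp A f ih =>
      have := ih h
      simp only [Term.dom, Term.cod, Form.letters_imp, Multiset.count_add, Nat.even_add] at *
      tauto
    | _ =>
      simp only [Term.dom, Term.cod, Form.letters_imp, Form.letters_tensor, Multiset.count_add,
        Nat.even_add] <;> tauto

section Coherence

variable [DecidableEq L]

theorem Ty.even_count {f : Mor L} {A B : Form L} (h : Ty f A B) (p : L) :
    Even (A.letters.count p + B.letters.count p) := by
  rw [← h.dom, ← h.cod]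
  exact Mor.even_count h.ok p

/-- The possible last steps of a derivation. -/
theorem CutFree.last_step {Γ B : Form L} {f : Mor L} (h : CutFree Γ B f) (hg : Good Γ B) :
    B = .unit ∨ (∃ p, B = .letter p ∧ Γ = .letter p ∧ f = Mor.id (.letter p)) ∨
    (∃ X C, B = .imp X C) ∨
    (∃ B₁ B₂ Γ₁ Γ₂, B = B₁ ⊡ B₂ ∧ B₁ ≠ .unit ∧ B₂ ≠ .unit ∧ SplitsTensor f Γ Γ₁ Γ₂ B₁ B₂) ∨
    ∃ Δ X C S, SplitsImp f Γ Δ X C S B := by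
  induction h with
  | ax p => exact .inr (.inl ⟨p, rfl, rfl, rfl⟩)
  | unit => exact .inl rfl
  | @perm A B Γ f σ h hσ ih =>
    rcases ih (hg.congr hσ.mfac_eq) with h1 | ⟨p, h1, h2, h3⟩ | h1 |
      ⟨B₁, B₂, Γ₁, Γ₂, h1, h2, h3, h4⟩ | ⟨Δ, X, C, S, h1⟩
    · exact .inl h1
    · subst h2 h3
      obtain rfl := Form.mfac_eq_singleton (A := Γ) (x := .letter p) hσ.mfac_eq
      refine .inr (.inl ⟨p, h1, rfl, ?_⟩)
      rw [hσ.unique (.id _) (by simp [show (Form.letter p).fac = _ from Form.isPrime_letter p]),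
        id_comp_id]
    · exact .inr (.inr (.inl h1))
    · exact .inr (.inr (.inr (.inl ⟨B₁, B₂, Γ₁, Γ₂, h1, h2, h3, h4.comp hσ⟩)))
    · exact .inr (.inr (.inr (.inr ⟨Δ, X, C, S, h1.comp hσ⟩)))
  | @tensor A B C D f g h1 h2 ih1 ih2 =>
    obtain ⟨hg1, hg2⟩ := hg.of_tensor
    -- A component with right side `I` is the identity of `I` and can be discarded; so in the tensor
    -- alternative both components have a nonempty right side, and each is lighter than the whole.
    by_cases hB : B = .unit
    · have hA := h1.dom_eq_unit hg1.left hB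
      rw [h1.eq_id hA hB, hA, hB]
      simpa using ih2 hg2
    by_cases hD : D = .unit
    · have hC := h2.dom_eq_unit hg2.left hD
      rw [h2.eq_id hC hD, hC, hD]
      simpa using ih1 hg1
    refine .inr (.inr (.inr (.inl ⟨B, D, A, C, rfl, hB, hD, f, g, Mor.id _, h1.ty, h2.ty, .id _, ?_⟩)))
    rw [Mor.comp_id (h1.ty.tensor h2.ty).dom]
  | cur => exact .inr (.inr (.inl ⟨_, _, rfl⟩))
  | @limp X C S Δ B f g h1 h2 =>
    exact .inr (.inr (.inr (.inr ⟨Δ, X, C, S, f, g, Mor.id _, h1.ty, h2.ty, .id _,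
      (Mor.comp_id (h1.ty.limp h2.ty).dom).symm⟩)))

/-- A letter shared by the two sequents would occur at least twice in each by parity, hence at least
four times altogether. -/
theorem apart_of_good {A B C D : Form L} {f g : Mor L} (hg : Good (A ⊡ B) (C ⊡ D))
    (h1 : Ty f A C) (h2 : Ty g B D) : (A ⊡ C).Apart (B ⊡ D) := by
  intro p hp hq
  have k := hg.count_le p
  obtain ⟨m, hm⟩ := h1.even_count p
  obtain ⟨n, hn⟩ := h2.even_count p
  rw [← Multiset.count_pos] at hp hq
  simp only [Form.letters_tensor, Multiset.count_add] at *
  omega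

/-- Coherence for reduced sequents in which no letter occurs more than twice. -/
theorem eq_of_good {Γ B : Form L} {f g : Mor L} (hg : Good Γ B) (tf : Ty f Γ B) (tg : Ty g Γ B) :
    f = g := by
  induction hn : Γ.weight + B.weight using Nat.strong_induction_on generalizing Γ B f g with
  | _ n ih =>
  subst hn
  have cf := tf.cutFree
  have cg := tg.cutFree
  have hnd := cf.nodup hg
  rcases cf.last_step hg with rfl | ⟨p, rfl, rfl, rfl⟩ | ⟨X, C, rfl⟩ |
    ⟨B₁, B₂, Γ₁, Γ₂, rfl, hB₁, hB₂, f₁, f₂, σ, t₁, t₂, hσ, rfl⟩ |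
    ⟨Δ, X, C, S, a, b, σ, ta, tb, hσ, rfl⟩
  · have hΓ := cf.dom_eq_unit hg.left rfl
    rw [cf.eq_id hΓ rfl, cg.eq_id hΓ rfl]
  · rcases cg.last_step hg with h | ⟨q, h, -, rfl⟩ | ⟨X, C, h⟩ | ⟨B₁, B₂, Γ₁, Γ₂, h, h₁, h₂, -⟩ |
      ⟨Δ, X, C, S, a, b, τ, -, -, hτ, -⟩
    · exact absurd h (Form.isPrime_letter p).ne_unit
    · rw [h]
    · simp [Form.letter, Form.imp] at h
    · rcases (Form.isPrime_letter p).eq_tensor h with h | h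
      · exact absurd h.1 h₁
      · exact absurd h.2 h₂
    · have : X.imp C ∈ (Form.letter p).mfac := by rw [hτ.mfac_eq]; simp
      rw [Form.mfac_letter, Multiset.mem_singleton] at this
      simp [Form.letter, Form.imp] at this
  -- Transposition is a bijection, and undoing it removes one implication from the weight.
  · have key : ∀ {f : Mor L}, Ty f Γ (X.imp C) → Ty (eps X C ⊚ (Mor.id X ⊠ f)) (X ⊡ Γ) C :=
      fun h => Ty.comp ⟨trivial, rfl, rfl⟩ ((Ty.id X).tensor h)
    rw [← cur_eps tf, ← cur_eps tg]
    congr 1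
    exact ih _ (by simp; omega) hg.of_cur (key tf) (key tg) rfl
  · have hg' := hg.congr hσ.mfac_eq
    have hd := apart_of_good hg' t₁ t₂
    -- The decomposition found for `f` is imposed on `g`; the permutations agree by uniqueness and
    -- the components by induction.
    obtain ⟨g₁, g₂, τ, s₁, s₂, hτ, rfl⟩ := cg.splitsTensor hg rfl (by simp [hσ.mfac_eq]) hd
    have hw := Form.weight_congr hσ.mfac_eq
    have := Form.weight_pos hB₁
    have := Form.weight_pos hB₂
    rw [hσ.unique hτ hnd, ih _ (by simp [hw]; omega) hg'.of_tensor.1 t₁ s₁ rfl,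
      ih _ (by simp [hw]; omega) hg'.of_tensor.2 t₂ s₂ rfl]
  · have hg' := hg.congr hσ.mfac_eq
    -- The same parity count: the letters of the two premises together are those of the conclusion.
    have hd : (Δ ⊡ X).Apart (C ⊡ S ⊡ B) := by
      intro p hp hq
      have k := hg'.count_le p
      obtain ⟨m, hm⟩ := ta.even_count p
      obtain ⟨n, hn⟩ := tb.even_count p
      rw [← Multiset.count_pos] at hp hq
      simp only [Form.letters_tensor, Form.letters_imp, Multiset.count_add] at *
      omega
    obtain ⟨a', b', τ, ta', tb', hτ, rfl⟩ := cg.splitsImp hg (Δ := Δ) (X := X) (C := C) (S := S) (by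
      simp only [hσ.mfac_eq, Form.mfac_tensor, Form.mfac_imp, ← Multiset.singleton_add]; abel) hd
    have hw := Form.weight_congr hσ.mfac_eq
    rw [hσ.unique hτ hnd, ih _ (by simp [hw]; omega) hg'.of_limp.1 ta ta' rfl,
      ih _ (by simp [hw]; omega) hg'.of_limp.2 tb tb' rfl]

end Coherence

/-! ### From proper formulae to reduced ones. -/

/-- `A` is a retract of `B`. -/
def IsRetract (A B : Form L) : Prop :=
  ∃ i j : Mor L, Ty i A B ∧ Ty j B A ∧ j ⊚ i = Mor.id A

namespace IsRetract

theorem refl (A : Form L) : IsRetract A A := ⟨_, _, .id A, .id A, id_comp_id A⟩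

theorem trans {A B C : Form L} (h : IsRetract A B) (k : IsRetract B C) : IsRetract A C := by
  obtain ⟨i, j, hi, hj, e⟩ := h
  obtain ⟨i', j', hi', hj', e'⟩ := k
  refine ⟨i' ⊚ i, j ⊚ j', hi'.comp hi, hj.comp hj', ?_⟩
  rw [comp_assoc, ← comp_assoc j', e', Mor.id_comp hi.cod, e]

theorem tensor {A B C D : Form L} (h : IsRetract A B) (k : IsRetract C D) :
    IsRetract (A ⊡ C) (B ⊡ D) := by
  obtain ⟨i, j, hi, hj, e⟩ := h
  obtain ⟨i', j', hi', hj', e'⟩ := k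
  refine ⟨i ⊠ i', j ⊠ j', hi.tensor hi', hj.tensor hj', ?_⟩
  rw [interchange (hi.cod.trans hj.dom.symm) (hi'.cod.trans hj'.dom.symm), e, e', id_tensor_id]

/-- The language has only the covariant functor `X → _`, so the action on the left side is built by
transposition. It is contravariant: the injection of `X → C` into `Y → D` uses the retraction `j` of
`Y` onto `X`. -/
theorem imp {X Y C D : Form L} (h : IsRetract X Y) (k : IsRetract C D) :
    IsRetract (X.imp C) (Y.imp D) := by
  obtain ⟨i, j, hi, hj, e⟩ := h
  obtain ⟨i', j', hi', hj', e'⟩ := k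
  have te : ∀ X C : Form L, Ty (eps X C) (X ⊡ X.imp C) C := fun X C => ⟨trivial, rfl, rfl⟩
  have t1 : Ty (i' ⊚ eps X C ⊚ (j ⊠ Mor.id (X.imp C))) (Y ⊡ X.imp C) D :=
    hi'.comp ((te X C).comp (hj.tensor (.id _)))
  have t2 : Ty (j' ⊚ eps Y D ⊚ (i ⊠ Mor.id (Y.imp D))) (X ⊡ Y.imp D) C :=
    hj'.comp ((te Y D).comp (hi.tensor (.id _)))
  refine ⟨_, _, t1.cur, t2.cur, ?_⟩
  have h1 : (i ⊠ Mor.id (Y.imp D)) ⊚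
        (Mor.id X ⊠ cur Y (X.imp C) (i' ⊚ eps X C ⊚ (j ⊠ Mor.id (X.imp C)))) =
      (Mor.id Y ⊠ cur Y (X.imp C) (i' ⊚ eps X C ⊚ (j ⊠ Mor.id (X.imp C)))) ⊚
        (i ⊠ Mor.id (X.imp C)) := by
    rw [interchange (f₁ := Mor.id X) (g₂ := Mor.id (Y.imp D)) hi.dom.symm t1.cur.cod,
      interchange (g₁ := Mor.id Y) (f₂ := Mor.id (X.imp C)) hi.cod t1.cur.dom.symm,
      Mor.id_comp hi.cod, Mor.comp_id hi.dom, Mor.id_comp t1.cur.cod, Mor.comp_id t1.cur.dom]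
  rw [cur_comp t1.cur.dom t1.cur.cod, comp_assoc, comp_assoc, h1, ← comp_assoc (eps Y D),
    eps_cur t1, comp_assoc, comp_assoc, interchange (hi.cod.trans hj.dom.symm) rfl, e, id_comp_id,
    ← comp_assoc j', e', Mor.id_comp (by simp), cur_eps (.id _)]

theorem unit_imp (C : Form L) : IsRetract (Form.unit.imp C) C := by
  refine ⟨eps .unit C, eta .unit C, ⟨trivial, rfl, rfl⟩, ⟨trivial, rfl, rfl⟩, ?_⟩
  have := eta_natural .unit (dom_eps .unit C) (cod_eps .unit C)
  rw [this, id_unit_tensor]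
  exact triangle_right .unit C

end IsRetract

namespace Form

theorem isConstant_iff (A : Form L) : A.IsConstant ↔ A.letters = 0 := by
  induction A with
  | unit => simp [IsConstant]
  | letterTensor p G => simp [IsConstant, letters]
  | impTensor X C G h1 h2 h3 => simp [IsConstant, letters, h1, h2, h3, and_assoc]

theorem Reduced.eq_unit {A : Form L} (h : A.Reduced) (hA : A.letters = 0) : A = unit := by
  by_contra hne
  obtain ⟨p, hp⟩ := h.exists_mem hne
  simp [hA] at hp

/-- Reduce both sides of an implication. If the left side becomes `I`, the implication is replaced
by its right side. If only the right side became `I`, it would be constant while the left side was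
not, which is what properness excludes. A retract is enough, as equality of morphisms can be tested
after composing with the injections and retractions. -/
theorem IsProper.exists_reduced {A : Form L} (h : A.IsProper) :
    ∃ B : Form L, B.Reduced ∧ B.letters = A.letters ∧ IsRetract A B := by
  induction A with
  | unit => exact ⟨unit, trivial, rfl, .refl _⟩
  | letterTensor p G ih =>
    obtain ⟨G', h1, h2, h3⟩ := ih h
    exact ⟨letterTensor p G', h1, by simp [letters, h2], (IsRetract.refl (letter p)).tensor h3⟩
  | impTensor X C G ihX ihC ihG =>
    obtain ⟨h0, hX, hC, hG⟩ := h
    obtain ⟨X', rX, lX, tX⟩ := ihX hX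
    obtain ⟨C', rC, lC, tC⟩ := ihC hC
    obtain ⟨G', rG, lG, tG⟩ := ihG hG
    by_cases hX' : X' = unit
    · subst hX'
      refine ⟨C' ⊡ G', by simp [rC, rG], by simp [letters, ← lX, lC, lG], ?_⟩
      exact ((tX.imp tC).trans (.unit_imp C')).tensor tG
    · refine ⟨impTensor X' C' G', ⟨hX', ?_, rX, rC, rG⟩, by simp [letters, lX, lC, lG],
        (tX.imp tC).tensor tG⟩
      rintro rfl
      refine h0 ⟨(isConstant_iff C).2 (by simp [← lC]), fun hc => hX' (rX.eq_unit ?_)⟩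
      rw [lX, (isConstant_iff X).1 hc]

end Form

/-- Coherence for proper sequents in which no letter occurs more than twice. -/
theorem eq_of_proper [DecidableEq L] {A B : Form L} {f g : Mor L} (hA : A.IsProper)
    (hB : B.IsProper) (hc : ∀ p, A.letters.count p + B.letters.count p ≤ 2) (hf : Ty f A B)
    (hg : Ty g A B) : f = g := by
  obtain ⟨A', rA, lA, i, j, hi, hj, e⟩ := hA.exists_reduced
  obtain ⟨B', rB, lB, i', j', hi', hj', e'⟩ := hB.exists_reduced
  have key : i' ⊚ f ⊚ j = i' ⊚ g ⊚ j :=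
    eq_of_good ⟨rA, rB, by simpa [lA, lB] using hc⟩ (hi'.comp (hf.comp hj))
      (hi'.comp (hg.comp hj))
  have := congrArg (fun k => j' ⊚ k ⊚ i) key
  simp only [comp_assoc, e] at this
  rwa [Mor.comp_id hf.dom, Mor.comp_id hg.dom, ← comp_assoc j', ← comp_assoc j', e',
    Mor.id_comp hf.cod, Mor.id_comp hg.cod] at this

/-! ### Labellings of occurrences as a sound interpretation of terms. -/

namespace Form

@[simp] theorem size_unit : size (unit : Form L) = 0 := rfl

@[simp] theorem size_tensor (A B : Form L) : (A ⊡ B).size = A.size + B.size := by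
  induction A with
  | unit => simp
  | letterTensor p G ih => simp [tensor, size, ih, add_assoc]
  | impTensor X C G _ _ ih => simp [tensor, size, ih, add_assoc]

@[simp] theorem size_imp (A B : Form L) : (A.imp B).size = A.size + B.size := by
  simp [imp, size]

end Form

namespace Term

/-- The labellings of the occurrences of letters on the two sides that a term allows. -/
def Labels : Term L → List ℕ → List ℕ → Prop
  | id A, a, b => a.length = A.size ∧ b = a
  | swap A B, a, b => ∃ x y : List ℕ, x.length = A.size ∧ y.length = B.size ∧
      a = x ++ y ∧ b = y ++ x
  | eta A B, a, b => ∃ x : List ℕ, x.length = A.size ∧ a.length = B.size ∧ b = x ++ (x ++ a)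
  | eps A B, a, b => ∃ x : List ℕ, x.length = A.size ∧ b.length = B.size ∧ a = x ++ (x ++ b)
  | comp g f, a, b => ∃ m, f.Labels a m ∧ g.Labels m b
  | tensor f g, a, b => ∃ a₁ a₂ b₁ b₂, a = a₁ ++ a₂ ∧ b = b₁ ++ b₂ ∧ f.Labels a₁ b₁ ∧
      g.Labels a₂ b₂
  | imp A f, a, b => ∃ x a' b' : List ℕ, x.length = A.size ∧ a = x ++ a' ∧ b = x ++ b' ∧
      f.Labels a' b'

theorem Labels.length {f : Term L} {a b : List ℕ} (h : f.Labels a b) :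
    a.length = f.dom.size ∧ b.length = f.cod.size := by
  induction f generalizing a b with
  | id A => obtain ⟨h, rfl⟩ := h; exact ⟨h, h⟩
  | swap A B => obtain ⟨x, y, hx, hy, rfl, rfl⟩ := h; simp [dom, cod, hx, hy]
  | eta A B => obtain ⟨x, hx, ha, rfl⟩ := h; simp [dom, cod, hx, ha]
  | eps A B => obtain ⟨x, hx, ha, rfl⟩ := h; simp [dom, cod, hx, ha]
  | comp g f ihg ihf =>
    obtain ⟨m, h1, h2⟩ := h
    exact ⟨(ihf h1).1, (ihg h2).2⟩
  | tensor f g ihf ihg =>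
    obtain ⟨a₁, a₂, b₁, b₂, rfl, rfl, h1, h2⟩ := h
    simp [dom, cod, ihf h1, ihg h2]
  | imp A f ih =>
    obtain ⟨x, a', b', hx, rfl, rfl, h⟩ := h
    simp [dom, cod, ih h, hx]

theorem HasType.length {f : Term L} {A B : Form L} (hf : f.HasType A B) {a b : List ℕ}
    (h : f.Labels a b) : a.length = A.size ∧ b.length = B.size := by
  obtain ⟨-, rfl, rfl⟩ := hf
  exact h.length

theorem labels_tensor_iff {f g : Term L} {a₁ a₂ b₁ b₂ : List ℕ} (h₁ : a₁.length = f.dom.size)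
    (h₂ : b₁.length = f.cod.size) :
    (tensor f g).Labels (a₁ ++ a₂) (b₁ ++ b₂) ↔ f.Labels a₁ b₁ ∧ g.Labels a₂ b₂ := by
  constructor
  · rintro ⟨c₁, c₂, d₁, d₂, hc, hd, h, k⟩
    obtain ⟨rfl, rfl⟩ := List.append_inj hc (by rw [h.length.1, h₁])
    obtain ⟨rfl, rfl⟩ := List.append_inj hd (by rw [h.length.2, h₂])
    exact ⟨h, k⟩
  · rintro ⟨h, k⟩
    exact ⟨_, _, _, _, rfl, rfl, h, k⟩

theorem exists_append {n m : ℕ} {a : List ℕ} (h : a.length = n + m) :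
    ∃ x y : List ℕ, a = x ++ y ∧ x.length = n ∧ y.length = m :=
  ⟨a.take n, a.drop n, by simp, by simp [h], by simp [h]⟩

/-- Terms denote relations between lists, so each equation reduces to rearranging concatenations.
The lengths of the pieces are fixed by the types, which makes decompositions of a concatenated list
unique. -/
theorem TermEq.labels {f g : Term L} (h : TermEq f g) (a b : List ℕ) :
    f.Labels a b ↔ g.Labels a b := by
  induction h generalizing a b with
  | tensor_assoc hf hg hh =>
    constructor
    · rintro ⟨a₁, _, b₁, _, rfl, rfl, h1, a₂, a₃, b₂, b₃, rfl, rfl, h2, h3⟩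
      exact ⟨a₁ ++ a₂, a₃, b₁ ++ b₂, b₃, by simp, by simp, ⟨_, _, _, _, rfl, rfl, h1, h2⟩, h3⟩
    · rintro ⟨_, a₃, _, b₃, rfl, rfl, ⟨a₁, a₂, b₁, b₂, rfl, rfl, h1, h2⟩, h3⟩
      exact ⟨a₁, a₂ ++ a₃, b₁, b₂ ++ b₃, by simp, by simp, h1, ⟨_, _, _, _, rfl, rfl, h2, h3⟩⟩
  | tensor_one hf =>
    constructor
    · rintro ⟨a₁, a₂, b₁, b₂, rfl, rfl, h1, h2, h3⟩
      obtain rfl : a₂ = [] := by simpa using h2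
      simpa [h3] using h1
    · intro h
      exact ⟨a, [], b, [], by simp, by simp, h, by simp, rfl⟩
  | one_tensor hf =>
    constructor
    · rintro ⟨a₁, a₂, b₁, b₂, rfl, rfl, ⟨h1, h3⟩, h2⟩
      obtain rfl : a₁ = [] := by simpa using h1
      simpa [h3] using h2
    · intro h
      exact ⟨[], a, [], b, by simp, by simp, ⟨by simp, rfl⟩, h⟩
  | refl _ => rfl
  | symm _ ih => exact (ih a b).symm
  | trans _ _ ih1 ih2 => exact (ih1 a b).trans (ih2 a b)
  | comp_congr _ _ _ _ ih1 ih2 => simp only [Labels, ih1, ih2]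
  | tensor_congr _ _ ih1 ih2 => simp only [Labels, ih1, ih2]
  | imp_congr A _ ih => simp only [Labels, ih]
  | comp_id hg =>
    constructor
    · rintro ⟨m, ⟨-, rfl⟩, h⟩
      exact h
    · intro h
      exact ⟨a, ⟨(hg.length h).1, rfl⟩, h⟩
  | id_comp hf =>
    constructor
    · rintro ⟨m, h, ⟨-, rfl⟩⟩
      exact h
    · intro h
      exact ⟨b, h, (hf.length h).2, rfl⟩
  | comp_assoc _ _ _ =>
    constructor
    · rintro ⟨m, ⟨n, h1, h2⟩, h3⟩
      exact ⟨n, h1, m, h2, h3⟩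
    · rintro ⟨m, h1, n, h2, h3⟩
      exact ⟨n, ⟨m, h1, h2⟩, h3⟩
  | tensor_id A B =>
    constructor
    · rintro ⟨a₁, a₂, b₁, b₂, rfl, rfl, ⟨h1, rfl⟩, h2, rfl⟩
      exact ⟨by simp [h1, h2], rfl⟩
    · rintro ⟨h, rfl⟩
      obtain ⟨x, y, rfl, hx, hy⟩ := exists_append (h.trans (Form.size_tensor A B))
      exact ⟨_, _, _, _, rfl, rfl, ⟨hx, rfl⟩, hy, rfl⟩
  | tensor_comp h1 h2 h3 h4 =>
    constructor
    · rintro ⟨m, ⟨a₁, a₂, m₁, m₂, rfl, rfl, k1, k2⟩, n₁, n₂, b₁, b₂, hm, rfl, k3, k4⟩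
      obtain ⟨rfl, rfl⟩ := List.append_inj hm (by rw [(h1.length k1).2, (h3.length k3).1])
      exact ⟨_, _, _, _, rfl, rfl, ⟨_, k1, k3⟩, _, k2, k4⟩
    · rintro ⟨a₁, a₂, b₁, b₂, rfl, rfl, ⟨m₁, k1, k3⟩, m₂, k2, k4⟩
      exact ⟨_, ⟨_, _, _, _, rfl, rfl, k1, k2⟩, _, _, _, _, rfl, rfl, k3, k4⟩
  | swap_natural hf hg =>
    constructor
    · rintro ⟨m, ⟨a₁, a₂, b₁, b₂, rfl, rfl, k1, k2⟩, x, y, hx, hy, hm, rfl⟩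
      obtain ⟨rfl, rfl⟩ := List.append_inj hm (by rw [(hf.length k1).2, hx])
      exact ⟨_, ⟨_, _, (hf.length k1).1, (hg.length k2).1, rfl, rfl⟩, _, _, _, _, rfl, rfl, k2, k1⟩
    · rintro ⟨m, ⟨x, y, hx, hy, rfl, rfl⟩, a₁, a₂, b₁, b₂, hm, rfl, k1, k2⟩
      obtain ⟨rfl, rfl⟩ := List.append_inj hm (by rw [(hg.length k1).1, hy])
      exact ⟨_, ⟨_, _, _, _, rfl, rfl, k2, k1⟩, _, _, (hf.length k2).2, (hg.length k1).2, rfl, rfl⟩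
  | swap_swap A B =>
    constructor
    · rintro ⟨m, ⟨x, y, hx, hy, rfl, rfl⟩, z, w, hz, hw, hm, rfl⟩
      obtain ⟨rfl, rfl⟩ := List.append_inj hm (by rw [hz, hy])
      exact ⟨by simp [hz, hw], rfl⟩
    · rintro ⟨h, rfl⟩
      obtain ⟨x, y, rfl, hx, hy⟩ := exists_append (h.trans (Form.size_tensor A B))
      exact ⟨y ++ x, ⟨x, y, hx, hy, rfl, rfl⟩, y, x, hy, hx, rfl, rfl⟩
  | swap_tensor A B C =>
    constructor
    · rintro ⟨x, z, h, hz, rfl, rfl⟩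
      obtain ⟨x, y, rfl, hx, hy⟩ := exists_append (h.trans (Form.size_tensor A B))
      exact ⟨x ++ (z ++ y), ⟨x, y ++ z, x, z ++ y, by simp, rfl, ⟨hx, rfl⟩, y, z, hy, hz, rfl, rfl⟩,
        x ++ z, y, z ++ x, y, by simp, by simp, ⟨x, z, hx, hz, rfl, rfl⟩, hy, rfl⟩
    · rintro ⟨m, ⟨x, _, _, _, rfl, rfl, ⟨hx, rfl⟩, y, z, hy, hz, rfl, rfl⟩, _, y', _, _, hm, rfl,
        ⟨x', z', hx', hz', rfl, rfl⟩, hy', rfl⟩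
      rw [List.append_assoc] at hm
      obtain ⟨rfl, hm2⟩ := List.append_inj hm (by rw [hx, hx'])
      obtain ⟨rfl, rfl⟩ := List.append_inj hm2 (by rw [hz, hz'])
      exact ⟨_, _, by simp [hx, hy], hz, (List.append_assoc _ _ _).symm, by simp⟩
  | imp_comp A hf hg =>
    constructor
    · rintro ⟨x, a, b, hx, rfl, rfl, m, h1, h2⟩
      exact ⟨x ++ m, ⟨x, a, m, hx, rfl, rfl, h1⟩, x, m, b, hx, rfl, rfl, h2⟩
    · rintro ⟨_, ⟨x, a, m, hx, rfl, rfl, h1⟩, y, n, b, hy, hm, rfl, h2⟩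
      obtain ⟨rfl, rfl⟩ := List.append_inj hm (by rw [hx, hy])
      exact ⟨x, a, b, hx, rfl, rfl, m, h1, h2⟩
  | imp_id A B =>
    constructor
    · rintro ⟨x, a, b, hx, rfl, rfl, h, rfl⟩
      exact ⟨by simp [hx, h], rfl⟩
    · rintro ⟨h, rfl⟩
      obtain ⟨x, y, rfl, hx, hy⟩ := exists_append (h.trans (Form.size_imp A B))
      exact ⟨x, y, y, hx, rfl, rfl, hy, rfl⟩
  | eta_natural A hf =>
    constructor
    · rintro ⟨m, h, x, hx, hm, rfl⟩
      exact ⟨x ++ (x ++ a), ⟨x, hx, (hf.length h).1, rfl⟩, x, x ++ a, x ++ m, hx, rfl, rfl,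
        x, a, x, m, rfl, rfl, ⟨hx, rfl⟩, h⟩
    · rintro ⟨_, ⟨x, hx, ha, rfl⟩, y, _, _, hy, hm, rfl, z, c, _, d, rfl, rfl, ⟨hz, rfl⟩, h⟩
      obtain ⟨rfl, hm2⟩ := List.append_inj hm (by rw [hx, hy])
      obtain ⟨rfl, rfl⟩ := List.append_inj hm2 (by rw [hx, hz])
      exact ⟨d, h, x, hx, (hf.length h).2, rfl⟩
  | eps_natural A hf =>
    constructor
    · rintro ⟨_, ⟨x, _, _, _, rfl, rfl, ⟨hx, rfl⟩, y, c, d, hy, rfl, rfl, h⟩, z, hz, hb, hm⟩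
      obtain ⟨rfl, hm2⟩ := List.append_inj hm (by rw [hx, hz])
      obtain ⟨rfl, rfl⟩ := List.append_inj hm2 (by rw [hx, hy])
      exact ⟨c, ⟨y, hx, (hf.length h).1, rfl⟩, h⟩
    · rintro ⟨m, ⟨x, hx, hm, rfl⟩, h⟩
      exact ⟨x ++ (x ++ b), ⟨x, x ++ m, x, x ++ b, rfl, rfl, ⟨hx, rfl⟩, x, m, b, hx, rfl, rfl, h⟩,
        x, hx, (hf.length h).2, rfl⟩
  | triangle_left A B =>
    constructor
    · rintro ⟨_, ⟨x, y, _, _, rfl, rfl, ⟨hx, rfl⟩, z, hz, hy, rfl⟩, w, hw, hb, hm⟩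
      obtain ⟨rfl, hm2⟩ := List.append_inj hm (by rw [hx, hw])
      obtain ⟨rfl, rfl⟩ := List.append_inj hm2 (by rw [hx, hz])
      exact ⟨by simp [hx, hy], rfl⟩
    · rintro ⟨h, rfl⟩
      obtain ⟨x, y, rfl, hx, hy⟩ := exists_append (h.trans (Form.size_tensor A B))
      exact ⟨x ++ (x ++ (x ++ y)), ⟨x, y, x, _, rfl, rfl, ⟨hx, rfl⟩, x, hx, hy, rfl⟩, x, hx,
        by simp [hx, hy], rfl⟩
  | triangle_right A B =>
    constructor
    · rintro ⟨_, ⟨x, hx, ha, rfl⟩, y, _, c, hy, hm, rfl, z, hz, hc, rfl⟩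
      obtain ⟨rfl, hm2⟩ := List.append_inj hm (by rw [hx, hy])
      obtain ⟨rfl, rfl⟩ := List.append_inj hm2 (by rw [hx, hz])
      exact ⟨by simpa using ha, rfl⟩
    · rintro ⟨h, rfl⟩
      obtain ⟨x, y, rfl, hx, hy⟩ := exists_append (h.trans (Form.size_imp A B))
      exact ⟨x ++ (x ++ (x ++ y)), ⟨x, hx, by simpa using h, rfl⟩, x, x ++ (x ++ y), y, hx, rfl, rfl,
        x, hx, hy, rfl⟩

end Term

/-! ### Labellings and links determine each other. -/

/-- The occurrence is one in a sequent with `n` occurrences of letters on the left and `m` on the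
right. -/
def Occ.Within (n m : ℕ) : Occ → Prop
  | left i => i < n
  | right j => j < m

/-- Linked points have the same colour. -/
def Agree {P α : Type*} (S : Set (Sym2 P)) (φ : P → α) : Prop :=
  ∀ ⦃x y⦄, s(x, y) ∈ S → φ x = φ y

section Agree

variable {P Q α : Type*}

theorem agree_union {S T : Set (Sym2 P)} {φ : P → α} :
    Agree (S ∪ T) φ ↔ Agree S φ ∧ Agree T φ :=
  ⟨fun h => ⟨fun _ _ hx => h (.inl hx), fun _ _ hx => h (.inr hx)⟩,
    fun h _ _ hx => hx.elim (fun k => h.1 k) fun k => h.2 k⟩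

theorem agree_image {S : Set (Sym2 P)} {h : P → Q} {φ : Q → α} :
    Agree (Sym2.map h '' S) φ ↔ Agree S (φ ∘ h) := by
  constructor
  · intro H x y hx
    exact H ⟨_, hx, rfl⟩
  · rintro H x y ⟨e, he, heq⟩
    induction e with | _ u v
    rw [Sym2.map_mk, Sym2.eq_iff] at heq
    rcases heq with ⟨rfl, rfl⟩ | ⟨rfl, rfl⟩
    · exact H he
    · exact (H he).symm

theorem agree_pairs {n : ℕ} {p q : ℕ → P} {φ : P → α} :
    Agree {e | ∃ i < n, e = s(p i, q i)} φ ↔ ∀ i < n, φ (p i) = φ (q i) := by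
  constructor
  · intro H i hi
    exact H ⟨i, hi, rfl⟩
  · rintro H x y ⟨i, hi, heq⟩
    rw [Sym2.eq_iff] at heq
    rcases heq with ⟨rfl, rfl⟩ | ⟨rfl, rfl⟩
    · exact H i hi
    · exact (H i hi).symm

theorem agree_congr {S : Set (Sym2 P)} {φ ψ : P → α} (h : ∀ x y, s(x, y) ∈ S → φ x = ψ x) :
    Agree S φ ↔ Agree S ψ := by
  have h' : ∀ x y, s(x, y) ∈ S → φ y = ψ y := fun x y hx => h y x (Sym2.eq_swap ▸ hx)
  refine forall₃_congr fun x y hx => ?_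
  rw [h x y hx, h' x y hx]

end Agree

theorem agree_glue {α : Type*} {S T : Set (Sym2 Occ)} {φ : Occ → α} :
    Agree (glue S T) φ ↔ ∀ x y, Relation.ReflTransGen (GlueAdj S T) (GluePoint.ofOuter x)
      (GluePoint.ofOuter y) → φ x = φ y := by
  constructor
  · intro H x y hp
    by_cases hxy : x = y
    · rw [hxy]
    · exact H ⟨x, y, rfl, hxy, hp⟩
  · rintro H x y ⟨u, v, heq, -, hp⟩
    rw [Sym2.eq_iff] at heq
    rcases heq with ⟨rfl, rfl⟩ | ⟨rfl, rfl⟩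
    · exact H _ _ hp
    · exact (H _ _ hp).symm

theorem GlueAdj.symm {S T : Set (Sym2 Occ)} {u v : GluePoint} (h : GlueAdj S T u v) :
    GlueAdj S T v u := by
  rwa [GlueAdj, Sym2.eq_swap]

theorem glue_path_symm {S T : Set (Sym2 Occ)} {u v : GluePoint}
    (h : Relation.ReflTransGen (GlueAdj S T) u v) : Relation.ReflTransGen (GlueAdj S T) v u := by
  induction h with
  | refl => exact .refl
  | tail _ h ih => exact .head h.symm ih

theorem GluePoint.ofOuter_injective : Function.Injective GluePoint.ofOuter := by
  rintro (i | i) (j | j) <;> simp [ofOuter]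

theorem Occ.shift_injective (n m : ℕ) : Function.Injective (Occ.shift n m) := by
  rintro (i | i) (j | j) <;> simp [shift]

theorem Occ.not_within_shift (n m : ℕ) (x : Occ) : ¬ (x.shift n m).Within n m := by
  cases x <;> simp [shift, Within]

theorem mem_image_pair {P Q : Type*} {S : Set (Sym2 P)} {h : P → Q} {x y : Q} :
    s(x, y) ∈ Sym2.map h '' S ↔ ∃ u v, s(u, v) ∈ S ∧ h u = x ∧ h v = y := by
  constructor
  · rintro ⟨e, he, heq⟩
    induction e with | _ u v
    rw [Sym2.map_mk, Sym2.eq_iff] at heq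
    rcases heq with ⟨h1, h2⟩ | ⟨h1, h2⟩
    · exact ⟨u, v, he, h1, h2⟩
    · exact ⟨v, u, Sym2.eq_swap ▸ he, h2, h1⟩
  · rintro ⟨u, v, he, rfl, rfl⟩
    exact ⟨_, he, rfl⟩

/-- The colouring of the occurrences by two lists. -/
def lab (a b : List ℕ) : Occ → Option ℕ
  | .left i => a[i]?
  | .right j => b[j]?

/-- All ends of links lie in a sequent with `n` and `m` occurrences of letters. -/
def LinksWithin (S : Set (Sym2 Occ)) (n m : ℕ) : Prop :=
  ∀ ⦃x y⦄, s(x, y) ∈ S → x.Within n m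

/-- Different ends of adjacent links are linked. -/
def LinksTrans (S : Set (Sym2 Occ)) : Prop :=
  ∀ ⦃x y z⦄, s(x, y) ∈ S → s(y, z) ∈ S → x = z ∨ s(x, z) ∈ S

theorem glueAdj_iff {S T : Set (Sym2 Occ)} {u v : GluePoint} :
    GlueAdj S T u v ↔ (∃ x y, s(x, y) ∈ S ∧ GluePoint.ofFirst x = u ∧ GluePoint.ofFirst y = v) ∨
      ∃ x y, s(x, y) ∈ T ∧ GluePoint.ofSecond x = u ∧ GluePoint.ofSecond y = v := by
  rw [GlueAdj, Set.mem_union, mem_image_pair, mem_image_pair]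

theorem GlueAdj.within {S T : Set (Sym2 Occ)} {n m k : ℕ} (hS : LinksWithin S n m)
    (hT : LinksWithin T m k) {x : Occ} {v : GluePoint} (h : GlueAdj S T (.ofOuter x) v) :
    x.Within n k := by
  rcases glueAdj_iff.1 h with ⟨u, w, he, hu, hw⟩ | ⟨u, w, he, hu, hw⟩
  · have := hS he
    cases x <;> cases u <;> simp_all [GluePoint.ofFirst, GluePoint.ofOuter, Occ.Within]
  · have := hT he
    cases x <;> cases u <;> simp_all [GluePoint.ofSecond, GluePoint.ofOuter, Occ.Within]

theorem LinksWithin.glue {S T : Set (Sym2 Occ)} {n m k : ℕ} (hS : LinksWithin S n m)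
    (hT : LinksWithin T m k) : LinksWithin (glue S T) n k := by
  rintro x y ⟨u, v, heq, huv, hp⟩
  have key : ∀ {u v : Occ}, u ≠ v → Relation.ReflTransGen (GlueAdj S T) (GluePoint.ofOuter u)
      (GluePoint.ofOuter v) → u.Within n k := by
    intro u v huv hp
    rcases Relation.ReflTransGen.cases_head hp with h | ⟨w, h, -⟩
    · exact absurd (GluePoint.ofOuter_injective h) huv
    · exact h.within hS hT
  rw [Sym2.eq_iff] at heq
  rcases heq with ⟨rfl, rfl⟩ | ⟨rfl, rfl⟩
  · exact key huv hp
  · exact key huv.symm (glue_path_symm hp)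

theorem linksTrans_glue (S T : Set (Sym2 Occ)) : LinksTrans (glue S T) := by
  have key : ∀ {x y : Occ}, s(x, y) ∈ glue S T → Relation.ReflTransGen (GlueAdj S T)
      (GluePoint.ofOuter x) (GluePoint.ofOuter y) := by
    rintro x y ⟨u, v, heq, -, hp⟩
    rw [Sym2.eq_iff] at heq
    rcases heq with ⟨rfl, rfl⟩ | ⟨rfl, rfl⟩
    · exact hp
    · exact glue_path_symm hp
  intro x y z h1 h2
  by_cases hxz : x = z
  · exact .inl hxz
  · exact .inr ⟨x, z, rfl, hxz, (key h1).trans (key h2)⟩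

theorem LinksWithin.union_shift {S T : Set (Sym2 Occ)} {n m n' m' : ℕ} (hS : LinksWithin S n m)
    (hT : LinksWithin T n' m') :
    LinksWithin (S ∪ Sym2.map (Occ.shift n m) '' T) (n + n') (m + m') := by
  rintro x y (h | h)
  · have := hS h
    cases x <;> simp only [Occ.Within] at this ⊢ <;> omega
  · obtain ⟨u, v, h', rfl, rfl⟩ := mem_image_pair.1 h
    have := hT h'
    cases u <;> simp only [Occ.Within, Occ.shift] at this ⊢ <;> omega

theorem LinksTrans.union_shift {S T : Set (Sym2 Occ)} {n m : ℕ} (hw : LinksWithin S n m)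
    (hS : LinksTrans S) (hT : LinksTrans T) :
    LinksTrans (S ∪ Sym2.map (Occ.shift n m) '' T) := by
  rintro x y z (h1 | h1) (h2 | h2)
  · exact (hS h1 h2).imp_right .inl
  · obtain ⟨u, v, h, rfl, rfl⟩ := mem_image_pair.1 h2
    exact absurd (hw (Sym2.eq_swap ▸ h1)) (Occ.not_within_shift _ _ _)
  · obtain ⟨u, v, h, rfl, rfl⟩ := mem_image_pair.1 h1
    exact absurd (hw h2) (Occ.not_within_shift _ _ _)
  · obtain ⟨u, v, h, rfl, rfl⟩ := mem_image_pair.1 h1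
    obtain ⟨v', w, h', hv, rfl⟩ := mem_image_pair.1 h2
    obtain rfl := Occ.shift_injective _ _ hv
    rcases hT h h' with rfl | h3
    · exact .inl rfl
    · exact .inr (.inr (mem_image_pair.2 ⟨_, _, h3, rfl, rfl⟩))

namespace Term

theorem linksWithin {f : Term L} (hf : f.WellFormed) :
    LinksWithin f.links f.dom.size f.cod.size := by
  induction f with
  | id A =>
    rintro x y ⟨i, hi, h⟩
    rcases Sym2.eq_iff.1 h with ⟨rfl, rfl⟩ | ⟨rfl, rfl⟩ <;> exact hi
  | swap A B =>
    rintro x y (⟨i, hi, h⟩ | ⟨i, hi, h⟩) <;>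
      rcases Sym2.eq_iff.1 h with ⟨rfl, rfl⟩ | ⟨rfl, rfl⟩ <;>
      simp only [Occ.Within, dom, cod, Form.size_tensor] <;> omega
  | eta A B =>
    rintro x y (⟨i, hi, h⟩ | ⟨i, hi, h⟩) <;>
      rcases Sym2.eq_iff.1 h with ⟨rfl, rfl⟩ | ⟨rfl, rfl⟩ <;>
      simp only [Occ.Within, dom, cod, Form.size_tensor, Form.size_imp] <;> omega
  | eps A B =>
    rintro x y (⟨i, hi, h⟩ | ⟨i, hi, h⟩) <;>
      rcases Sym2.eq_iff.1 h with ⟨rfl, rfl⟩ | ⟨rfl, rfl⟩ <;>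
      simp only [Occ.Within, dom, cod, Form.size_tensor, Form.size_imp] <;> omega
  | comp g f ihg ihf =>
    have h := ihg hf.1
    rw [← hf.2.2] at h
    exact (ihf hf.2.1).glue h
  | tensor f g ihf ihg =>
    simp only [dom, cod, Form.size_tensor]
    exact (ihf hf.1).union_shift (ihg hf.2)
  | imp A f ih =>
    have h : LinksWithin (Term.id A).links A.size A.size := by
      rintro x y ⟨i, hi, h⟩
      rcases Sym2.eq_iff.1 h with ⟨rfl, rfl⟩ | ⟨rfl, rfl⟩ <;> exact hi
    simp only [dom, cod, Form.size_imp]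
    exact h.union_shift (ih hf)

theorem linksTrans {f : Term L} (hf : f.WellFormed) : LinksTrans f.links := by
  have hid : ∀ A : Form L, LinksTrans (Term.id A).links := by
    rintro A x y z ⟨i, hi, h⟩ ⟨j, hj, k⟩
    rcases Sym2.eq_iff.1 h with ⟨rfl, rfl⟩ | ⟨rfl, rfl⟩ <;>
      rcases Sym2.eq_iff.1 k with ⟨k1, k2⟩ | ⟨k1, k2⟩ <;> simp_all
  induction f with
  | id A => exact hid A
  | swap A B =>
    rintro x y z (⟨i, hi, h⟩ | ⟨i, hi, h⟩) (⟨j, hj, k⟩ | ⟨j, hj, k⟩) <;>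
      rcases Sym2.eq_iff.1 h with ⟨rfl, rfl⟩ | ⟨rfl, rfl⟩ <;>
      rcases Sym2.eq_iff.1 k with ⟨k1, k2⟩ | ⟨k1, k2⟩ <;>
      simp only [Occ.left.injEq, Occ.right.injEq, reduceCtorEq] at k1 <;>
      first | omega | (left; rw [k2]; simp only [Occ.left.injEq, Occ.right.injEq]; omega)
  | eta A B =>
    rintro x y z (⟨i, hi, h⟩ | ⟨i, hi, h⟩) (⟨j, hj, k⟩ | ⟨j, hj, k⟩) <;>
      rcases Sym2.eq_iff.1 h with ⟨rfl, rfl⟩ | ⟨rfl, rfl⟩ <;>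
      rcases Sym2.eq_iff.1 k with ⟨k1, k2⟩ | ⟨k1, k2⟩ <;>
      simp only [Occ.left.injEq, Occ.right.injEq, reduceCtorEq] at k1 <;>
      first | omega | (left; rw [k2]; simp only [Occ.left.injEq, Occ.right.injEq]; omega)
  | eps A B =>
    rintro x y z (⟨i, hi, h⟩ | ⟨i, hi, h⟩) (⟨j, hj, k⟩ | ⟨j, hj, k⟩) <;>
      rcases Sym2.eq_iff.1 h with ⟨rfl, rfl⟩ | ⟨rfl, rfl⟩ <;>
      rcases Sym2.eq_iff.1 k with ⟨k1, k2⟩ | ⟨k1, k2⟩ <;>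
      simp only [Occ.left.injEq, Occ.right.injEq, reduceCtorEq] at k1 <;>
      first | omega | (left; rw [k2]; simp only [Occ.left.injEq, Occ.right.injEq]; omega)
  | comp g f ihg ihf => exact linksTrans_glue _ _
  | tensor f g ihf ihg => exact (ihf hf.1).union_shift (linksWithin hf.1) (ihg hf.2)
  | imp A f ih => exact (hid A).union_shift (linksWithin (f := .id A) trivial) (ih hf)

end Term

theorem forall_getElem?_eq {x y : List ℕ} {n : ℕ} (hx : x.length = n) (hy : y.length = n) :
    (∀ i < n, x[i]? = y[i]?) ↔ x = y := by
  refine ⟨fun h => List.ext_getElem? fun i => ?_, fun h i _ => by rw [h]⟩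
  by_cases hi : i < n
  · exact h i hi
  · rw [List.getElem?_eq_none (by omega), List.getElem?_eq_none (by omega)]

theorem getElem?_append_add {x y : List ℕ} {n : ℕ} (hx : x.length = n) (i : ℕ) :
    (x ++ y)[n + i]? = y[i]? := by
  rw [List.getElem?_append_right (by omega)]
  congr 1
  omega

theorem forall_getElem?_append {x y : List ℕ} {n : ℕ} (hx : x.length = n) {P : ℕ → Option ℕ} :
    (∀ i < n, (x ++ y)[i]? = P i) ↔ ∀ i < n, x[i]? = P i := by
  refine forall₂_congr fun i hi => ?_
  rw [List.getElem?_append_left (by omega)]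

theorem forall_getElem?_append_right {x y : List ℕ} {n : ℕ} (hx : x.length = n)
    {P : ℕ → Option ℕ} :
    (∀ i < n, P i = (x ++ y)[i]?) ↔ ∀ i < n, P i = x[i]? := by
  refine forall₂_congr fun i hi => ?_
  rw [List.getElem?_append_left (by omega)]

theorem lab_append_shift {a b c d : List ℕ} {n m : ℕ} (ha : a.length = n) (hb : b.length = m) :
    lab (a ++ c) (b ++ d) ∘ Occ.shift n m = lab c d := by
  funext x
  cases x <;> simp [lab, Occ.shift, getElem?_append_add, ha, hb]

theorem lab_append {a b c d : List ℕ} {x : Occ} (h : x.Within a.length b.length) :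
    lab (a ++ c) (b ++ d) x = lab a b x := by
  cases x
  · exact List.getElem?_append_left h
  · exact List.getElem?_append_left h

theorem agree_union_shift {S T : Set (Sym2 Occ)} {a b c d : List ℕ} {n m : ℕ}
    (ha : a.length = n) (hb : b.length = m) (hS : LinksWithin S n m) :
    Agree (S ∪ Sym2.map (Occ.shift n m) '' T) (lab (a ++ c) (b ++ d)) ↔
      Agree S (lab a b) ∧ Agree T (lab c d) := by
  rw [agree_union, agree_image, lab_append_shift ha hb,
    agree_congr fun x y h => lab_append (by rw [ha, hb]; exact hS h)]

/-- A middle point takes the colour of any outer occurrence connected with it; the hypothesis says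
that the choice does not matter. -/
theorem exists_agree_of_glue {S T : Set (Sym2 Occ)} {a b : List ℕ} {m : ℕ}
    (hS : LinksWithin S a.length m) (hT : LinksWithin T m b.length)
    (h : Agree (glue S T) (lab a b)) :
    ∃ k : List ℕ, k.length = m ∧ Agree S (lab a k) ∧ Agree T (lab k b) := by
  classical
  rw [agree_glue] at h
  let R := Relation.ReflTransGen (GlueAdj S T)
  -- A component without outer occurrences, such as a closed loop, may have any constant colour; it
  -- gets 0.
  let c : GluePoint → Option ℕ := fun u =>
    if hu : ∃ x, R (GluePoint.ofOuter x) u then lab a b hu.choose else some 0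
  have hc : ∀ x u, R (GluePoint.ofOuter x) u → c u = lab a b x := by
    intro x u hx
    have hu : ∃ x, R (GluePoint.ofOuter x) u := ⟨x, hx⟩
    simp only [c, dif_pos hu]
    exact h _ _ (hu.choose_spec.trans (glue_path_symm hx))
  have hadj : ∀ u v, GlueAdj S T u v → c u = c v := by
    intro u v huv
    by_cases hu : ∃ x, R (GluePoint.ofOuter x) u
    · obtain ⟨x, hx⟩ := hu
      rw [hc x u hx, hc x v (hx.tail huv)]
    · have hv : ¬ ∃ x, R (GluePoint.ofOuter x) v := fun ⟨x, hx⟩ => hu ⟨x, hx.tail huv.symm⟩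
      simp only [c, dif_neg hu, dif_neg hv]
  have houter : ∀ x, c (GluePoint.ofOuter x) = lab a b x := fun x => hc x _ .refl
  have hmid : ∀ k, (c (.middle k)).isSome := by
    intro k
    by_cases hk : ∃ x, R (GluePoint.ofOuter x) (.middle k)
    · obtain ⟨x, hx⟩ := hk
      rw [hc x _ hx]
      -- A path from an outer occurrence to a middle point is not empty. Its first link shows that
      -- the occurrence is in range, so its colour is not `none`.
      rcases Relation.ReflTransGen.cases_head hx with he | ⟨w, hw, -⟩
      · cases x <;> simp [GluePoint.ofOuter] at he
      · have := hw.within hS hT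
        cases x <;> simpa [lab, Occ.Within] using this
    · simp [c, dif_neg hk]
  let k : List ℕ := List.ofFn fun i : Fin m => (c (.middle i)).getD 0
  have hk : ∀ i < m, k[i]? = c (.middle i) := by
    intro i hi
    obtain ⟨v, hv⟩ := Option.isSome_iff_exists.1 (hmid i)
    simp [k, hi, hv]
  have h1 : ∀ x : Occ, x.Within a.length m → lab a k x = c (.ofFirst x) := by
    rintro (i | j) hx
    · exact (houter (.left i)).symm
    · exact hk j hx
  have h2 : ∀ x : Occ, x.Within m b.length → lab k b x = c (.ofSecond x) := by
    rintro (i | j) hx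
    · exact hk i hx
    · exact (houter (.right j)).symm
  refine ⟨k, by simp [k], fun x y hxy => ?_, fun x y hxy => ?_⟩
  · rw [h1 x (hS hxy), h1 y (hS (Sym2.eq_swap ▸ hxy))]
    exact hadj _ _ (glueAdj_iff.2 (.inl ⟨_, _, hxy, rfl, rfl⟩))
  · rw [h2 x (hT hxy), h2 y (hT (Sym2.eq_swap ▸ hxy))]
    exact hadj _ _ (glueAdj_iff.2 (.inr ⟨_, _, hxy, rfl, rfl⟩))

theorem agree_glue_of {S T : Set (Sym2 Occ)} {a b k : List ℕ} (h1 : Agree S (lab a k))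
    (h2 : Agree T (lab k b)) : Agree (glue S T) (lab a b) := by
  let c : GluePoint → Option ℕ
    | .bottom i => a[i]?
    | .middle i => k[i]?
    | .top i => b[i]?
  have k1 : lab a k = c ∘ GluePoint.ofFirst := by funext x; cases x <;> rfl
  have k2 : lab k b = c ∘ GluePoint.ofSecond := by funext x; cases x <;> rfl
  have k3 : lab a b = c ∘ GluePoint.ofOuter := by funext x; cases x <;> rfl
  rw [k1] at h1
  rw [k2] at h2
  rw [agree_glue, k3]
  intro x y h
  simp only [Function.comp]
  generalize GluePoint.ofOuter y = v at h
  induction h with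
  | refl => rfl
  | tail _ h ih =>
    rw [ih]
    rcases glueAdj_iff.1 h with ⟨u, w, he, rfl, rfl⟩ | ⟨u, w, he, rfl, rfl⟩
    · exact h1 he
    · exact h2 he

namespace Term

/-- Composition is the only case that is not bookkeeping with lists: the list for the middle formula
is supplied by `exists_agree_of_glue`. -/
theorem labels_iff_agree {f : Term L} (hf : f.WellFormed) {a b : List ℕ}
    (ha : a.length = f.dom.size) (hb : b.length = f.cod.size) :
    f.Labels a b ↔ Agree f.links (lab a b) := by
  induction f generalizing a b with
  | id A =>
    refine Iff.trans ?_ agree_pairs.symm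
    exact ⟨fun h i _ => by rw [lab, lab, h.2], fun h => ⟨ha, ((forall_getElem?_eq ha hb).1 h).symm⟩⟩
  | swap A B =>
    obtain ⟨x, y, rfl, hx, hy⟩ := exists_append (ha.trans (Form.size_tensor A B))
    obtain ⟨z, w, rfl, hz, hw⟩ := exists_append (hb.trans (Form.size_tensor B A))
    rw [links, agree_union, agree_pairs, agree_pairs]
    simp only [lab, getElem?_append_add hx, getElem?_append_add hz, forall_getElem?_append hx,
      forall_getElem?_append_right hz, forall_getElem?_eq hx hw, forall_getElem?_eq hy hz]
    constructor
    · rintro ⟨x', y', hx', hy', h1, h2⟩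
      obtain ⟨rfl, rfl⟩ := List.append_inj h1 (by rw [hx, hx'])
      obtain ⟨rfl, rfl⟩ := List.append_inj h2 (by rw [hz, hy'])
      exact ⟨rfl, rfl⟩
    · rintro ⟨rfl, rfl⟩
      exact ⟨x, y, hx, hy, rfl, rfl⟩
  | eta A B =>
    obtain ⟨x, w, rfl, hx, hw⟩ := exists_append (n := A.size) (m := A.size + B.size)
      (by simpa [cod] using hb)
    obtain ⟨y, z, rfl, hy, hz⟩ := exists_append hw
    change a.length = B.size at ha
    rw [links, agree_union, agree_pairs, agree_pairs]
    simp only [lab, add_assoc, getElem?_append_add hx, getElem?_append_add hy,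
      forall_getElem?_append hx,
      forall_getElem?_append_right hy, forall_getElem?_eq hx hy, forall_getElem?_eq ha hz]
    constructor
    · rintro ⟨x', hx', -, h1⟩
      obtain ⟨rfl, h2⟩ := List.append_inj h1 (by rw [hx, hx'])
      obtain ⟨rfl, rfl⟩ := List.append_inj h2 (by rw [hx', hy])
      exact ⟨rfl, rfl⟩
    · rintro ⟨rfl, rfl⟩
      exact ⟨x, hx, ha, rfl⟩
  | eps A B =>
    obtain ⟨x, w, rfl, hx, hw⟩ := exists_append (n := A.size) (m := A.size + B.size)
      (by simpa [dom] using ha)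
    obtain ⟨y, z, rfl, hy, hz⟩ := exists_append hw
    change b.length = B.size at hb
    rw [links, agree_union, agree_pairs, agree_pairs]
    simp only [lab, add_assoc, getElem?_append_add hx, getElem?_append_add hy,
      forall_getElem?_append hx,
      forall_getElem?_append_right hy, forall_getElem?_eq hx hy, forall_getElem?_eq hz hb]
    constructor
    · rintro ⟨x', hx', -, h1⟩
      obtain ⟨rfl, h2⟩ := List.append_inj h1 (by rw [hx, hx'])
      obtain ⟨rfl, rfl⟩ := List.append_inj h2 (by rw [hx', hy])
      exact ⟨rfl, rfl⟩
    · rintro ⟨rfl, rfl⟩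
      exact ⟨x, hx, hb, rfl⟩
  | comp g f ihg ihf =>
    obtain ⟨hg, hf, hfg⟩ := hf
    change a.length = f.dom.size at ha
    change b.length = g.cod.size at hb
    constructor
    · rintro ⟨m, h1, h2⟩
      exact agree_glue_of ((ihf hf ha h1.length.2).1 h1) ((ihg hg h2.length.1 hb).1 h2)
    · intro h
      obtain ⟨k, hk, h1, h2⟩ := exists_agree_of_glue (m := f.cod.size)
        (ha ▸ linksWithin hf) (hb ▸ hfg ▸ linksWithin hg) h
      exact ⟨k, (ihf hf ha hk).2 h1, (ihg hg (hk.trans (by rw [hfg])) hb).2 h2⟩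
  | tensor f g ihf ihg =>
    obtain ⟨a₁, a₂, rfl, ha₁, ha₂⟩ := exists_append (ha.trans (Form.size_tensor _ _))
    obtain ⟨b₁, b₂, rfl, hb₁, hb₂⟩ := exists_append (hb.trans (Form.size_tensor _ _))
    rw [labels_tensor_iff ha₁ hb₁, ihf hf.1 ha₁ hb₁, ihg hf.2 ha₂ hb₂]
    exact (agree_union_shift ha₁ hb₁ (linksWithin hf.1)).symm
  | imp A f ih =>
    obtain ⟨a₁, a₂, rfl, ha₁, ha₂⟩ := exists_append (ha.trans (Form.size_imp _ _))
    obtain ⟨b₁, b₂, rfl, hb₁, hb₂⟩ := exists_append (hb.trans (Form.size_imp _ _))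
    refine Iff.trans ?_
      (agree_union_shift ha₁ hb₁ (linksWithin (f := .id A) trivial)).symm
    rw [← ih hf ha₂ hb₂, links, agree_pairs]
    simp only [lab, forall_getElem?_eq ha₁ hb₁]
    constructor
    · rintro ⟨x, a', b', hx, h1, h2, h⟩
      obtain ⟨rfl, rfl⟩ := List.append_inj h1 (by rw [ha₁, hx])
      obtain ⟨rfl, rfl⟩ := List.append_inj h2 (by rw [hb₁, hx])
      exact ⟨rfl, h⟩
    · rintro ⟨rfl, h⟩
      exact ⟨_, _, _, ha₁, rfl, rfl, h⟩

theorem ne_of_mem_links {f : Term L} {x y : Occ} (h : s(x, y) ∈ f.links) : x ≠ y := by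
  rintro rfl
  induction f generalizing x with
  | id A =>
    obtain ⟨i, hi, h⟩ := h
    rcases Sym2.eq_iff.1 h with ⟨rfl, h⟩ | ⟨rfl, h⟩ <;> simp at h
  | swap A B =>
    rcases h with ⟨i, hi, h⟩ | ⟨i, hi, h⟩ <;>
      rcases Sym2.eq_iff.1 h with ⟨rfl, h⟩ | ⟨rfl, h⟩ <;> simp at h
  | eta A B =>
    rcases h with ⟨i, hi, h⟩ | ⟨i, hi, h⟩ <;>
      rcases Sym2.eq_iff.1 h with ⟨rfl, h⟩ | ⟨rfl, h⟩ <;> simp at h <;> omega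
  | eps A B =>
    rcases h with ⟨i, hi, h⟩ | ⟨i, hi, h⟩ <;>
      rcases Sym2.eq_iff.1 h with ⟨rfl, h⟩ | ⟨rfl, h⟩ <;> simp at h <;> omega
  | comp g f ihg ihf =>
    obtain ⟨u, v, h, huv, -⟩ := h
    rcases Sym2.eq_iff.1 h with ⟨h1, h2⟩ | ⟨h1, h2⟩
    · exact huv (h1.symm.trans h2)
    · exact huv (h2.symm.trans h1)
  | tensor f g ihf ihg =>
    rcases h with h | h
    · exact ihf h
    · obtain ⟨u, v, h, h1, h2⟩ := mem_image_pair.1 h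
      obtain rfl := Occ.shift_injective _ _ (h1.trans h2.symm)
      exact ihg h
  | imp A f ih =>
    rcases h with ⟨i, hi, h⟩ | h
    · rcases Sym2.eq_iff.1 h with ⟨rfl, h⟩ | ⟨rfl, h⟩ <;> simp at h
    · obtain ⟨u, v, h, h1, h2⟩ := mem_image_pair.1 h
      obtain rfl := Occ.shift_injective _ _ (h1.trans h2.symm)
      exact ih h

/-- Two values suffice as a test: label 1 on `x` and everything that `g` links to it, and 0
elsewhere. As the links of `g` are transitive, `g` allows this labelling, hence so does `f`; so an
occurrence that `f` links to `x` has label 1. -/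
theorem links_subset {f g : Term L} {A B : Form L} (hf : f.HasType A B) (hg : g.HasType A B)
    (h : ∀ a b, g.Labels a b → f.Labels a b) : f.links ⊆ g.links := by
  classical
  obtain ⟨hf, rfl, rfl⟩ := hf
  obtain ⟨hg, hd, hc⟩ := hg
  intro e he
  induction e with | _ x y
  let χ : Occ → ℕ := fun z => if x = z ∨ s(x, z) ∈ g.links then 1 else 0
  let a : List ℕ := List.ofFn fun i : Fin f.dom.size => χ (.left i)
  let b : List ℕ := List.ofFn fun i : Fin f.cod.size => χ (.right i)
  have hlab : ∀ z : Occ, z.Within f.dom.size f.cod.size → lab a b z = some (χ z) := by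
    rintro (i | j) hz
    · have hz : i < f.dom.size := hz
      simp [lab, a, hz]
    · have hz : j < f.cod.size := hz
      simp [lab, b, hz]
  have hχ : ∀ u v, s(u, v) ∈ g.links → (x = u ∨ s(x, u) ∈ g.links) →
      (x = v ∨ s(x, v) ∈ g.links) := by
    rintro u v huv (rfl | hu)
    · exact .inr huv
    · exact linksTrans hg hu huv
  have hwg := linksWithin hg
  rw [hd, hc] at hwg
  have hgl : Agree g.links (lab a b) := by
    intro u v huv
    rw [hlab u (hwg huv), hlab v (hwg (Sym2.eq_swap ▸ huv))]
    have : (x = u ∨ s(x, u) ∈ g.links) ↔ (x = v ∨ s(x, v) ∈ g.links) :=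
      ⟨hχ u v huv, hχ v u (Sym2.eq_swap ▸ huv)⟩
    simp only [χ, this]
  have hfl := (labels_iff_agree hf (by simp [a]) (by simp [b])).1
    (h a b ((labels_iff_agree hg (by simp [a, hd]) (by simp [b, hc])).2 hgl)) he
  rw [hlab x (linksWithin hf he), hlab y (linksWithin hf (Sym2.eq_swap ▸ he))] at hfl
  by_contra hn
  have hxy : ¬ (x = y ∨ s(x, y) ∈ g.links) := fun h => h.elim (ne_of_mem_links he) hn
  simp [χ, if_neg hxy] at hfl

theorem links_eq {f g : Term L} (h : TermEq f g) : f.links = g.links := by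
  obtain ⟨hf, hg, hd, hc⟩ := h.type
  exact (links_subset ⟨hf, rfl, rfl⟩ ⟨hg, hd.symm, hc.symm⟩ fun a b => (h.labels a b).2).antisymm
    (links_subset ⟨hg, rfl, rfl⟩ ⟨hf, hd, hc⟩ fun a b => (h.labels a b).1)

theorem labels_iff_of_links_eq {f g : Term L} {A B : Form L} (hf : f.HasType A B)
    (hg : g.HasType A B) (h : f.links = g.links) {a b : List ℕ} (hab : f.Labels a b) :
    g.Labels a b := by
  obtain ⟨ha, hb⟩ := hf.length hab
  obtain ⟨hf, hd, hc⟩ := hf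
  obtain ⟨hg, rfl, rfl⟩ := hg
  rw [labels_iff_agree hg ha hb, ← h]
  exact (labels_iff_agree hf (by rw [ha, hd]) (by rw [hb, hc])).1 hab

end Term

end StrictIL

/-! ### Substitution of letters, and tagging the occurrences of letters by numbers. -/

namespace StrictIL

variable {L M : Type*}

namespace Form

/-- Replacement of the letters. -/
def map (ρ : L → M) : Form L → Form M
  | unit => unit
  | letterTensor p G => letterTensor (ρ p) (map ρ G)
  | impTensor A B G => impTensor (map ρ A) (map ρ B) (map ρ G)

@[simp] theorem map_unit (ρ : L → M) : map ρ unit = unit := rfl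

@[simp] theorem map_letter (ρ : L → M) (p : L) : map ρ (letter p) = letter (ρ p) := rfl

@[simp] theorem map_imp (ρ : L → M) (A B : Form L) : map ρ (A.imp B) = (map ρ A).imp (map ρ B) :=
  rfl

@[simp] theorem map_tensor (ρ : L → M) (A B : Form L) : map ρ (A ⊡ B) = map ρ A ⊡ map ρ B := by
  induction A with
  | unit => rfl
  | letterTensor p G ih => simp [tensor, map, ih]
  | impTensor X C G _ _ ih => simp [tensor, map, ih]

theorem map_map {N : Type*} (ρ : L → M) (σ : M → N) (A : Form L) :
    map σ (map ρ A) = map (σ ∘ ρ) A := by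
  induction A <;> simp_all [map]

theorem letters_map (ρ : L → M) (A : Form L) : (map ρ A).letters = A.letters.map ρ := by
  induction A <;> simp_all [map, letters]

theorem isConstant_map (ρ : L → M) (A : Form L) : (map ρ A).IsConstant ↔ A.IsConstant := by
  induction A <;> simp_all [map, IsConstant]

theorem isProper_map (ρ : L → M) (A : Form L) : (map ρ A).IsProper ↔ A.IsProper := by
  induction A <;> simp_all [map, IsProper, isConstant_map]

theorem exists_of_map_eq_tensor {ρ : L → M} {A : Form L} {B C : Form M} (h : map ρ A = B ⊡ C) :
    ∃ B' C', A = B' ⊡ C' ∧ map ρ B' = B ∧ map ρ C' = C := by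
  induction B generalizing A with
  | unit => exact ⟨unit, A, rfl, rfl, h⟩
  | letterTensor p G ih =>
    cases A <;> simp only [map, tensor, letterTensor.injEq, reduceCtorEq] at h
    obtain ⟨rfl, h⟩ := h
    obtain ⟨B', C', rfl, rfl, rfl⟩ := ih h
    exact ⟨letterTensor _ B', C', rfl, rfl, rfl⟩
  | impTensor X Y G _ _ ih =>
    cases A <;> simp only [map, tensor, impTensor.injEq, reduceCtorEq] at h
    obtain ⟨rfl, rfl, h⟩ := h
    obtain ⟨B', C', rfl, rfl, rfl⟩ := ih h
    exact ⟨impTensor _ _ B', C', rfl, rfl, rfl⟩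

/-- Attaching numbers to the occurrences of letters. -/
def relabel : Form L → List ℕ → Form (L × ℕ)
  | unit, _ => unit
  -- The default 0 is reached only by lists that are too short for the formula.
  | letterTensor p G, l => letterTensor (p, l.headD 0) (relabel G l.tail)
  | impTensor A B G, l => impTensor (relabel A (l.take A.size))
      (relabel B ((l.drop A.size).take B.size)) (relabel G ((l.drop A.size).drop B.size))

theorem relabel_tensor {A B : Form L} {x y : List ℕ} (hx : x.length = A.size) :
    (A ⊡ B).relabel (x ++ y) = A.relabel x ⊡ B.relabel y := by
  induction A generalizing x with
  | unit =>
    obtain rfl : x = [] := by simpa using hx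
    rfl
  | letterTensor p G ih =>
    cases x with
    | nil => simp [size] at hx; omega
    | cons n x =>
      simp only [tensor, relabel, List.cons_append, List.headD_cons, List.tail_cons]
      rw [ih (by simp [size] at hx; omega)]
  | impTensor X Y G _ _ ih =>
    simp only [size] at hx
    obtain ⟨x₁, x', rfl, h1, h2⟩ := Term.exists_append (n := X.size) (m := Y.size + G.size)
      (hx.trans (by omega))
    obtain ⟨x₂, x₃, rfl, h2, h3⟩ := Term.exists_append h2
    simp only [tensor, relabel, List.append_assoc, List.take_left' h1, List.drop_left' h1,
      List.take_left' h2, List.drop_left' h2, ih h3]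

theorem relabel_imp {A B : Form L} {x y : List ℕ} (hx : x.length = A.size)
    (hy : y.length = B.size) : (A.imp B).relabel (x ++ y) = (A.relabel x).imp (B.relabel y) := by
  simp [imp, relabel, List.take_left' hx, List.drop_left' hx, List.take_of_length_le hy.le]

theorem map_relabel (A : Form L) (l : List ℕ) : map Prod.fst (A.relabel l) = A := by
  induction A generalizing l <;> simp_all [map, relabel]

/-- The numbers attached to the occurrences of letters. -/
def tags : Form (L × ℕ) → List ℕ
  | unit => []
  | letterTensor p G => p.2 :: tags G
  | impTensor A B G => tags A ++ (tags B ++ tags G)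

@[simp] theorem tags_tensor (A B : Form (L × ℕ)) : (A ⊡ B).tags = A.tags ++ B.tags := by
  induction A <;> simp_all [tensor, tags]

@[simp] theorem tags_imp (A B : Form (L × ℕ)) : (A.imp B).tags = A.tags ++ B.tags := by
  simp [imp, tags]

theorem length_tags (A : Form (L × ℕ)) : A.tags.length = (map Prod.fst A).size := by
  induction A <;> simp_all [map, tags, size] <;> omega

theorem relabel_tags (A : Form (L × ℕ)) : (map Prod.fst A).relabel A.tags = A := by
  induction A with
  | unit => rfl
  | letterTensor p G ih => simp [map, relabel, tags, ih]
  | impTensor X Y G h1 h2 h3 =>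
    simp only [map, tags, relabel, List.take_left' (length_tags X), List.drop_left' (length_tags X),
      List.take_left' (length_tags Y), List.drop_left' (length_tags Y), h1, h2, h3]

end Form

namespace Term

/-- Replacement of the letters. -/
def map (ρ : L → M) : Term L → Term M
  | id A => id (A.map ρ)
  | swap A B => swap (A.map ρ) (B.map ρ)
  | eta A B => eta (A.map ρ) (B.map ρ)
  | eps A B => eps (A.map ρ) (B.map ρ)
  | comp g f => comp (map ρ g) (map ρ f)
  | tensor f g => tensor (map ρ f) (map ρ g)
  | imp A f => imp (A.map ρ) (map ρ f)

theorem dom_map (ρ : L → M) (f : Term L) : (map ρ f).dom = f.dom.map ρ := by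
  induction f <;> simp_all [map, dom]

theorem cod_map (ρ : L → M) (f : Term L) : (map ρ f).cod = f.cod.map ρ := by
  induction f <;> simp_all [map, cod]

theorem WellFormed.map (ρ : L → M) {f : Term L} (h : f.WellFormed) : (f.map ρ).WellFormed := by
  induction f <;> simp_all [Term.map, WellFormed, dom_map, cod_map]

theorem HasType.map (ρ : L → M) {f : Term L} {A B : Form L} (h : f.HasType A B) :
    (f.map ρ).HasType (A.map ρ) (B.map ρ) := by
  obtain ⟨h, rfl, rfl⟩ := h
  exact ⟨h.map ρ, dom_map ρ f, cod_map ρ f⟩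

theorem map_map {N : Type*} (ρ : L → M) (σ : M → N) (f : Term L) :
    map σ (map ρ f) = map (σ ∘ ρ) f := by
  induction f <;> simp_all [map, Form.map_map]

theorem TermEq.map (ρ : L → M) {f g : Term L} (h : TermEq f g) :
    TermEq (f.map ρ) (g.map ρ) := by
  induction h with
  | tensor_assoc hf hg hh => exact .tensor_assoc (hf.map ρ) (hg.map ρ) (hh.map ρ)
  | tensor_one hf => exact .tensor_one (hf.map ρ)
  | one_tensor hf => exact .one_tensor (hf.map ρ)
  | refl hf => exact .refl (hf.map ρ)
  | symm _ ih => exact ih.symm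
  | trans _ _ ih1 ih2 => exact ih1.trans ih2
  | comp_congr hf hg _ _ ih1 ih2 => exact .comp_congr (hf.map ρ) (hg.map ρ) ih1 ih2
  | tensor_congr _ _ ih1 ih2 => exact .tensor_congr ih1 ih2
  | imp_congr A _ ih => exact .imp_congr _ ih
  | comp_id hg => exact .comp_id (hg.map ρ)
  | id_comp hf => exact .id_comp (hf.map ρ)
  | comp_assoc h1 h2 h3 => exact .comp_assoc (h1.map ρ) (h2.map ρ) (h3.map ρ)
  | tensor_id A B => simpa [Term.map] using TermEq.tensor_id (A.map ρ) (B.map ρ)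
  | tensor_comp h1 h2 h3 h4 => exact .tensor_comp (h1.map ρ) (h2.map ρ) (h3.map ρ) (h4.map ρ)
  | swap_natural hf hg => exact .swap_natural (hf.map ρ) (hg.map ρ)
  | swap_swap A B => simpa [Term.map] using TermEq.swap_swap (A.map ρ) (B.map ρ)
  | swap_tensor A B C => simpa [Term.map] using TermEq.swap_tensor (A.map ρ) (B.map ρ) (C.map ρ)
  | imp_comp A hf hg => exact .imp_comp _ (hf.map ρ) (hg.map ρ)
  | imp_id A B => exact .imp_id _ _
  | eta_natural A hf => exact .eta_natural _ (hf.map ρ)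
  | eps_natural A hf => exact .eps_natural _ (hf.map ρ)
  | triangle_left A B => simpa [Term.map] using TermEq.triangle_left (A.map ρ) (B.map ρ)
  | triangle_right A B => simpa [Term.map] using TermEq.triangle_right (A.map ρ) (B.map ρ)

/-- An allowed labelling is exactly a consistent way of tagging the letters in the type; for a
composite, the intermediate list provides the tags of the middle formula. `WellFormed.labels_tags`
is the converse. -/
theorem Labels.exists_lift {f : Term L} (hf : f.WellFormed) {a b : List ℕ} (h : f.Labels a b) :
    ∃ f' : Term (L × ℕ), f'.HasType (f.dom.relabel a) (f.cod.relabel b) ∧ f'.map Prod.fst = f := by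
  induction f generalizing a b with
  | id A =>
    obtain ⟨-, rfl⟩ := h
    exact ⟨id (A.relabel _), ⟨trivial, rfl, rfl⟩, by simp [map, Form.map_relabel]⟩
  | swap A B =>
    obtain ⟨x, y, hx, hy, rfl, rfl⟩ := h
    exact ⟨swap (A.relabel x) (B.relabel y), ⟨trivial, (Form.relabel_tensor hx).symm,
      (Form.relabel_tensor hy).symm⟩, by simp [map, Form.map_relabel]⟩
  | eta A B =>
    obtain ⟨x, hx, ha, rfl⟩ := h
    exact ⟨eta (A.relabel x) (B.relabel a), ⟨trivial, rfl, by
      simp [cod, Form.relabel_imp hx (show (x ++ a).length = (A ⊡ B).size by simp [hx, ha]),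
        Form.relabel_tensor hx]⟩, by simp [map, Form.map_relabel]⟩
  | eps A B =>
    obtain ⟨x, hx, hb, rfl⟩ := h
    exact ⟨eps (A.relabel x) (B.relabel b), ⟨trivial, by
      simp [dom, Form.relabel_tensor hx, Form.relabel_imp hx hb], rfl⟩,
      by simp [map, Form.map_relabel]⟩
  | comp g f ihg ihf =>
    obtain ⟨m, h1, h2⟩ := h
    obtain ⟨f', ⟨w1, d1, c1⟩, rfl⟩ := ihf hf.2.1 h1
    obtain ⟨g', ⟨w2, d2, c2⟩, rfl⟩ := ihg hf.1 h2
    exact ⟨comp g' f', ⟨⟨w2, w1, by rw [c1, d2, hf.2.2]⟩, d1, c2⟩, rfl⟩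
  | tensor f g ihf ihg =>
    obtain ⟨a₁, a₂, b₁, b₂, rfl, rfl, h1, h2⟩ := h
    obtain ⟨f', ⟨w1, d1, c1⟩, e1⟩ := ihf hf.1 h1
    obtain ⟨g', ⟨w2, d2, c2⟩, e2⟩ := ihg hf.2 h2
    exact ⟨tensor f' g', ⟨⟨w1, w2⟩, by simp [dom, d1, d2, Form.relabel_tensor h1.length.1],
      by simp [cod, c1, c2, Form.relabel_tensor h1.length.2]⟩, by rw [map, e1, e2]⟩
  | imp A f ih =>
    obtain ⟨x, a', b', hx, rfl, rfl, h⟩ := h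
    obtain ⟨f', ⟨w, d, c⟩, e⟩ := ih hf h
    exact ⟨imp (A.relabel x) f', ⟨w, by simp [dom, d, Form.relabel_imp hx h.length.1],
      by simp [cod, c, Form.relabel_imp hx h.length.2]⟩, by simp [map, e, Form.map_relabel]⟩

theorem WellFormed.labels_tags {f : Term (L × ℕ)} (hf : f.WellFormed) :
    (f.map Prod.fst).Labels f.dom.tags f.cod.tags := by
  induction f with
  | id A => exact ⟨A.length_tags, rfl⟩
  | swap A B => exact ⟨_, _, A.length_tags, B.length_tags, by simp [dom], by simp [cod]⟩
  | eta A B => exact ⟨_, A.length_tags, B.length_tags, by simp [cod, dom]⟩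
  | eps A B => exact ⟨_, A.length_tags, B.length_tags, by simp [cod, dom]⟩
  | comp g f ihg ihf => exact ⟨_, ihf hf.2.1, hf.2.2 ▸ ihg hf.1⟩
  | tensor f g ihf ihg =>
    exact ⟨_, _, _, _, Form.tags_tensor _ _, Form.tags_tensor _ _, ihf hf.1, ihg hf.2⟩
  | imp A f ih =>
    exact ⟨_, _, _, A.length_tags, Form.tags_imp _ _, Form.tags_imp _ _, ih hf⟩

end Term

end StrictIL

/-! ### Lifting a morphism to a type in which letters occur at most twice. -/

namespace StrictIL

variable {L M : Type*}

open Mor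

/-- `f' : A' ⊢ B'` becomes a code of `f : A ⊢ B` when the letters are replaced along `ρ`. -/
structure Lifts (ρ : L → M) (f : Mor M) (A B : Form M) (f' : Term L) (A' B' : Form L) : Prop where
  type : f'.HasType A' B'
  mor : mk (f'.map ρ) = f
  dom : A'.map ρ = A
  cod : B'.map ρ = B

theorem Lifts.map {ρ : L → M} {f : Mor M} {A B : Form M} {f' : Term L} {A' B' : Form L}
    (h : Lifts ρ f A B f' A' B') {τ : L → L} (hτ : ρ ∘ τ = ρ) :
    Lifts ρ f A B (f'.map τ) (A'.map τ) (B'.map τ) :=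
  ⟨h.type.map τ, by rw [Term.map_map, hτ, h.mor], by rw [Form.map_map, hτ, h.dom], by
    rw [Form.map_map, hτ, h.cod]⟩

/-- The lifting starts from the codomain, because permutations are composed with a morphism whose
left side has already been lifted. Letters are only rearranged, so bounds on their number persist.
-/
theorem IsPerm.exists_lifts {ρ : L → M} {A B : Form M} {σ : Mor M} (h : IsPerm A B σ)
    {B' : Form L} (hB : B'.map ρ = B) :
    ∃ σ' A', Lifts ρ σ A B σ' A' B' ∧ A'.letters = B'.letters := by
  induction h generalizing B' with
  | id A =>
    subst hB
    exact ⟨.id B', B', ⟨⟨trivial, rfl, rfl⟩, rfl, rfl, rfl⟩, rfl⟩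
  | comp h1 h2 ih1 ih2 =>
    obtain ⟨τ', C', ⟨⟨w2, d2, c2⟩, m2, e2, e2'⟩, l2⟩ := ih2 hB
    obtain ⟨σ', A', ⟨⟨w1, d1, c1⟩, m1, e1, e1'⟩, l1⟩ := ih1 e2
    exact ⟨.comp τ' σ', A', ⟨⟨⟨w2, w1, c1.trans d2.symm⟩, d1, c2⟩, by
      rw [← m1, ← m2]; rfl, e1, e2'⟩, l1.trans l2⟩
  | tensor h1 h2 ih1 ih2 =>
    obtain ⟨B₁, B₂, rfl, hB₁, hB₂⟩ := Form.exists_of_map_eq_tensor hB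
    obtain ⟨σ', A₁, ⟨⟨w1, d1, c1⟩, m1, e1, e1'⟩, l1⟩ := ih1 hB₁
    obtain ⟨τ', A₂, ⟨⟨w2, d2, c2⟩, m2, e2, e2'⟩, l2⟩ := ih2 hB₂
    exact ⟨.tensor σ' τ', A₁ ⊡ A₂, ⟨⟨⟨w1, w2⟩, congrArg₂ _ d1 d2, congrArg₂ _ c1 c2⟩, by
      rw [← m1, ← m2]; rfl, by simp [e1, e2], hB⟩, by simp [l1, l2]⟩
  | swap A B =>
    obtain ⟨B₁, B₂, rfl, rfl, rfl⟩ := Form.exists_of_map_eq_tensor hB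
    exact ⟨.swap B₂ B₁, B₂ ⊡ B₁, ⟨⟨trivial, rfl, rfl⟩, rfl, by simp, hB⟩, by simp [add_comm]⟩

/-- The tags of one multiset become even and those of the other odd, injectively, so no letter is
counted in both. -/
theorem count_map_even_add_odd [DecidableEq L] (s t : Multiset (L × ℕ)) {k : ℕ}
    (hs : ∀ p, s.count p ≤ k) (ht : ∀ p, t.count p ≤ k) (p : L × ℕ) :
    (s.map (Prod.map _root_.id (2 * ·))).count p +
      (t.map (Prod.map _root_.id (2 * · + 1))).count p ≤ k := by
  have h1 : Function.Injective (Prod.map _root_.id (2 * ·) : L × ℕ → L × ℕ) :=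
    Function.injective_id.prodMap fun a b h => by simpa using h
  have h2 : Function.Injective (Prod.map _root_.id (2 * · + 1) : L × ℕ → L × ℕ) :=
    Function.injective_id.prodMap fun a b h => by simpa using h
  obtain ⟨l, n⟩ := p
  rcases Nat.even_or_odd' n with ⟨m, rfl | rfl⟩
  · have h3 : (t.map (Prod.map _root_.id (2 * · + 1))).count (l, 2 * m) = 0 := by
      rw [Multiset.count_eq_zero]
      simp
      omega
    have h4 := Multiset.count_map_eq_count' _ s h1 (l, m)
    have h5 := hs (l, m)
    simp only [Prod.map, _root_.id] at h3 h4 ⊢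
    omega
  · have h3 : (s.map (Prod.map _root_.id (2 * ·))).count (l, 2 * m + 1) = 0 := by
      rw [Multiset.count_eq_zero]
      simp
      omega
    have h4 := Multiset.count_map_eq_count' _ t h2 (l, m)
    have h5 := ht (l, m)
    simp only [Prod.map, _root_.id] at h3 h4 ⊢
    omega

variable [DecidableEq L]

/-- Two liftings can be made disjoint. -/
theorem Lifts.exists_disjoint {f g : Mor L} {A B C D : Form L} {f' g' : Term (L × ℕ)}
    {A' B' C' D' : Form (L × ℕ)} {k : ℕ} (hf : Lifts Prod.fst f A B f' A' B')
    (hg : Lifts Prod.fst g C D g' C' D') (hf' : ∀ p, (A'.letters + B'.letters).count p ≤ k)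
    (hg' : ∀ p, (C'.letters + D'.letters).count p ≤ k) :
    ∃ (f' : Term (L × ℕ)) (A' B' : Form (L × ℕ)) (g' : Term (L × ℕ)) (C' D' : Form (L × ℕ)),
      Lifts Prod.fst f A B f' A' B' ∧ Lifts Prod.fst g C D g' C' D' ∧
      ∀ p, (A'.letters + B'.letters).count p + (C'.letters + D'.letters).count p ≤ k := by
  refine ⟨_, _, _, _, _, _, hf.map (τ := Prod.map _root_.id (2 * ·)) rfl,
    hg.map (τ := Prod.map _root_.id (2 * · + 1)) rfl, fun p => ?_⟩
  simpa only [Form.letters_map, ← Multiset.map_add] using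
    count_map_even_add_odd _ _ hf' hg' p

/-- Every morphism is obtained from one in whose type each letter occurs at most twice. -/
theorem CutFree.exists_lifts {A B : Form L} {f : Mor L} (h : CutFree A B f) :
    ∃ (f' : Term (L × ℕ)) (A' B' : Form (L × ℕ)), Lifts Prod.fst f A B f' A' B' ∧
      ∀ p, (A'.letters + B'.letters).count p ≤ 2 := by
  induction h with
  | ax p =>
    refine ⟨.id (.letter (p, 0)), _, _, ⟨⟨trivial, rfl, rfl⟩, rfl, rfl, rfl⟩, fun q => ?_⟩
    have := Multiset.nodup_iff_count_le_one.1 (Multiset.nodup_singleton (p, 0)) q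
    simp only [Term.dom, Term.cod, Form.letters_letter, Multiset.count_add]
    omega
  | unit => exact ⟨.id .unit, _, _, ⟨⟨trivial, rfl, rfl⟩, rfl, rfl, rfl⟩, fun q => by
      simp [Term.dom, Term.cod]⟩
  | perm h hσ ih =>
    obtain ⟨f', A', B', ⟨⟨w1, d1, c1⟩, m1, e1, e1'⟩, hl⟩ := ih
    obtain ⟨σ', Γ', ⟨⟨w2, d2, c2⟩, m2, e2, e2'⟩, l⟩ := hσ.exists_lifts e1
    exact ⟨.comp f' σ', Γ', B', ⟨⟨⟨w1, w2, c2.trans d1.symm⟩, d2, c1⟩, by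
      rw [← m1, ← m2]; rfl, e2, e1'⟩, by rwa [l]⟩
  | tensor h1 h2 ih1 ih2 =>
    obtain ⟨_, _, _, hf, hf'⟩ := ih1
    obtain ⟨_, _, _, hg, hg'⟩ := ih2
    -- Making the tags of the two premises disjoint preserves the bound of two for the conclusion.
    obtain ⟨f', A', B', g', C', D', ⟨⟨w1, d1, c1⟩, m1, e1, e1'⟩, ⟨⟨w2, d2, c2⟩, m2, e2, e2'⟩, hc⟩ :=
      hf.exists_disjoint hg hf' hg'
    refine ⟨.tensor f' g', A' ⊡ C', B' ⊡ D', ⟨⟨⟨w1, w2⟩, congrArg₂ _ d1 d2, congrArg₂ _ c1 c2⟩, by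
      rw [← m1, ← m2]; rfl, by simp [e1, e2], by simp [e1', e2']⟩, fun p => ?_⟩
    have := hc p
    simp only [Form.letters_tensor, Multiset.count_add] at this ⊢
    omega
  | cur h ih =>
    obtain ⟨f', XA, C', ⟨⟨w, d, c⟩, m, e, e'⟩, hc⟩ := ih
    obtain ⟨X', A', rfl, rfl, rfl⟩ := Form.exists_of_map_eq_tensor e
    refine ⟨.comp (.imp X' f') (.eta X' A'), A', X'.imp C', ⟨⟨⟨w, trivial, ?_⟩, rfl, ?_⟩, ?_, rfl,
      ?_⟩, fun p => ?_⟩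
    · simp [Term.dom, Term.cod, d]
    · simp [Term.cod, c]
    · rw [← m]; rfl
    · rw [Form.map_imp, e']
    · have := hc p
      simp only [Form.letters_tensor, Form.letters_imp, Multiset.count_add] at this ⊢
      omega
  | limp h1 h2 ih1 ih2 =>
    obtain ⟨_, _, _, hf, hf'⟩ := ih1
    obtain ⟨_, _, _, hg, hg'⟩ := ih2
    obtain ⟨f', Δ', X', g', CS, B', ⟨⟨w1, d1, c1⟩, m1, e1, e1'⟩, ⟨⟨w2, d2, c2⟩, m2, e2, e2'⟩, hc⟩ :=
      hf.exists_disjoint hg hf' hg'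
    obtain ⟨C', S', rfl, rfl, rfl⟩ := Form.exists_of_map_eq_tensor e2
    refine ⟨.comp g' (.tensor (.comp (.eps X' C') (.tensor f' (.id (X'.imp C')))) (.id S')),
      Δ' ⊡ X'.imp C' ⊡ S', B', ⟨⟨⟨w2, ⟨⟨trivial, ⟨w1, trivial⟩, ?_⟩, trivial⟩, ?_⟩, ?_, c2⟩, ?_, ?_,
      e2'⟩, fun p => ?_⟩
    · simp [Term.dom, Term.cod, c1]
    · simp [Term.cod, d2]
    · simp [Term.dom, d1]
    · rw [← m1, ← m2, ← e1']; rfl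
    · simp [e1, e1']
    · have := hc p
      simp only [Form.letters_tensor, Form.letters_imp, Multiset.count_add] at this ⊢
      omega

end StrictIL

theorem mainTheorem2 {L : Type*} [Infinite L] (A B : StrictIL.Form L)
    (hA : A.IsProper) (hB : B.IsProper) (f g : StrictIL.Term L)
    (hf : f.HasType A B) (hg : g.HasType A B) :
    StrictIL.Term.TermEq f g ↔ f.links = g.links := by
  classical
  refine ⟨StrictIL.Term.links_eq, fun h => ?_⟩
  obtain ⟨f', A', B', ⟨tf, mf, rfl, rfl⟩, hc⟩ :=
    (StrictIL.Ty.cutFree (f := StrictIL.Mor.mk f) ⟨hf.1, hf.2.1, hf.2.2⟩).exists_lifts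
  have hff : StrictIL.Term.TermEq (f'.map Prod.fst) f :=
    (StrictIL.Mor.mk_eq_iff (tf.1.map _)).1 mf
  -- The tags in the type of `f'` are a labelling allowed by its untagged image. That image equals
  -- `f`, so `f` allows the labelling, and `g` does too because it has the same links.
  have hlab : g.Labels A'.tags B'.tags := by
    refine StrictIL.Term.labels_iff_of_links_eq hf hg h ((hff.labels _ _).1 ?_)
    rw [← tf.2.1, ← tf.2.2]
    exact tf.1.labels_tags
  -- Lifting along the tags of `f'` gives `g'` the same type as `f'`, so coherence applies to the
  -- two; erasing the tags afterwards returns `g` itself.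
  obtain ⟨g', tg, hg'⟩ := hlab.exists_lift hg.1
  rw [hg.2.1, hg.2.2, StrictIL.Form.relabel_tags, StrictIL.Form.relabel_tags] at tg
  have key : StrictIL.Mor.mk f' = StrictIL.Mor.mk g' :=
    StrictIL.eq_of_proper ((StrictIL.Form.isProper_map _ _).1 hA)
      ((StrictIL.Form.isProper_map _ _).1 hB) (fun p => by simpa using hc p)
      ⟨tf.1, tf.2.1, tf.2.2⟩ ⟨tg.1, tg.2.1, tg.2.2⟩
  have key' := ((StrictIL.Mor.mk_eq_iff tf.1).1 key).map Prod.fst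
  rw [hg'] at key'
  exact hff.symm.trans key'
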